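/- **Setting.** There are $K\ge 1$ agents. Agent $k$ has tasks $\mathcal T_k$ with distribution $\pi_k$; a data point $x$ of task $t\in\mathcal T_k$ has a distribution depending on $(k,t)$, and $Q_k^{(t)}(w;x)$ is the loss of the model $w\in\mathbb R^M$, twice differentiable in $w$. For a batch $\mathcal X$ let $Q_k^{(t)}(w;\mathcal X)$ be the average of $Q_k^{(t)}(w;x)$ over $x\in\mathcal X$. Let $J_k^{(t)}(w)=\mathbb E_x Q_k^{(t)}(w;x)$ and $J_k(w)=\mathbb E_{t\sim\pi_k}J_k^{(t)}(w)$ (assumed finite), and for an inner step size $\alpha>0$ $$\overline J(w)=\frac1K\sum_{k=1}^K\mathbb E_{t\sim\pi_k}J_k^{(t)}\big(w-\alpha\nabla J_k^{(t)}(w)\big),\qquad \widehat J(w)=\frac1K\sum_{k=1}^K\mathbb E_{t\sim\pi_k}\mathbb E_{\mathcal X_{in}}J_k^{(t)}\big(w-\alpha\nabla Q_k^{(t)}(w;\mathcal X_{in})\big).$$ **Algorithm (Dif-MAML).** In iteration $i\ge1$ each agent $k$ draws $|\mathcal S_k|\ge 1$ i.i.d. tasks from $\pi_k$ and, for each of them,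 an inner batch $\mathcal X_{in}$ and an outer batch $\mathcal X_o$ of $|\mathcal X_{in}|\ge1$ and $|\mathcal X_o|\ge1$ i.i.d. data points of that task; draws of different iterations are independent. With $$\nabla\overline{Q_k}(w)=\frac1{|\mathcal S_k|}\sum_{t\in\mathcal S_k}\big(I-\alpha\nabla^2Q_k^{(t)}(w;\mathcal X_{in}^{(t)})\big)\nabla Q_k^{(t)}\big(w-\alpha\nabla Q_k^{(t)}(w;\mathcal X_{in}^{(t)});\mathcal X_o^{(t)}\big),$$ computed from the draws of iteration $i$, and outer step size $\mu>0$, the models evolve from deterministic $w_{k,0}$ by $$w_{k,i}=\sum_{\ell=1}^K a_{\ell k}\big(w_{\ell,i-1}-\mu\nabla\overline{Q_\ell}(w_{\ell,i-1})\big),\qquad w_{c,i}=\frac1K\sum_{k=1}^K w_{k,i}.$$ **Assumptions.** For constants $L,\rho,B,\sigma_G,\sigma_H,\gamma_G,\gamma_H\ge0$, all $k$, all $t\in\mathcal T_k$ and all $w,u\in\mathbb R^M$ (Euclidean norm for vectors, operator norm for Hessians): 1. $\|\nabla Q_k^{(t)}(w;x)-\nabla Q_k^{(t)}(u;x)\|\le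 L^{x}\|w-u\|$ for every data point $x$, where $L^x$ may depend on $k,t,x$ and $\mathbb E_x(L^x)^2\le L^2$; 2. $\mathbb E_x\|\nabla^2Q_k^{(t)}(w;x)-\nabla^2Q_k^{(t)}(u;x)\|\le\rho\|w-u\|$; 3. $\mathbb E_x\|\nabla Q_k^{(t)}(w;x)\|\le B$; 4. $\mathbb E_x\|\nabla Q_k^{(t)}(w;x)-\nabla J_k^{(t)}(w)\|^4\le\sigma_G^4$ and $\mathbb E_x\|\nabla^2Q_k^{(t)}(w;x)-\nabla^2J_k^{(t)}(w)\|^4\le\sigma_H^4$; 5. $\mathbb E_{t\sim\pi_k}\|\nabla J_k^{(t)}(w)-\nabla J_k(w)\|^4\le\gamma_G^4$ and $\mathbb E_{t\sim\pi_k}\|\nabla^2J_k^{(t)}(w)-\nabla^2J_k(w)\|^4\le\gamma_H^4$; 6. $A=[a_{\ell k}]$ is doubly stochastic and primitive (some power of $A$ has only positive entries); 7. $\widehat J(w)\ge\widehat J^o$ for all $w$, for a constant $\widehat J^o$. **Constants.** Let $\widehat L=L(1+\alpha L)^2+\alpha\rho B$ and $C^2=\max_k\frac{3}{|\mathcal S_k|}(C_1^2+C_2^2+C_3^2)$,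 where $$C_1^2=6(1+\alpha L)^2\sigma_G^2\Big(\tfrac1{|\mathcal X_o|}+\tfrac{L^2\alpha^2}{|\mathcal X_{in}|}\Big)+\tfrac{6\alpha^2\sigma_H^2}{|\mathcal X_{in}|}\Big(B^2+\tfrac{\sigma_G^2}{|\mathcal X_o|}\Big)+\tfrac{9\alpha^4}{|\mathcal X_{in}|^2}(\sigma_H^4+L^4\sigma_G^4),$$ $$C_2^2=8(1+\alpha L)^2(1+\alpha^2L^2)\gamma_G^2+4B^2\alpha^2\gamma_H^2+2\alpha^4\gamma_H^4+16(1+\alpha^4L^4)\gamma_G^4,$$ $$C_3=(1+\alpha L)\tfrac{\alpha L\sigma_G}{\sqrt{|\mathcal X_{in}|}}+(1+\alpha L)^2\gamma_G+\tfrac{B\alpha\sigma_H}{\sqrt{|\mathcal X_{in}|}}+B\alpha\gamma_H+\tfrac{\alpha^2\sigma_H^2}{|\mathcal X_{in}|}+\alpha^2\gamma_H^2+\tfrac{\alpha^2L^2\sigma_G^2}{|\mathcal X_{in}|}+2(1+\alpha^2L^2)\gamma_G^2.$$ **Conclusion.** $\overline J$ and $\widehat J$ are differentiable, and there are $\mu_0>0$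 and $D$, independent of $\mu$, such that for every $0<\mu\le\mu_0$ there is a time $i^\star$ with $$\mathbb E\|\nabla\widehat J(w_{c,i^\star})\|^2\le2\mu\widehat LC^2+D\mu^2,$$ $$i^\star\le\frac{2(\widehat J(w_{c,0})-\widehat J^o)}{\widehat LC^2}\cdot\frac1{\mu^2}+\frac D\mu\qquad\text{if }\widehat LC^2>0,$$ and, at the same $i^\star$, $$\mathbb E\|\nabla\overline J(w_{c,i^\star})\|^2\le4\mu\widehat LC^2+D\mu^2+2\left((1+\alpha L)\frac{\alpha L\sigma_G}{\sqrt{|\mathcal X_{in}|}}+\frac{B\alpha\sigma_H}{\sqrt{|\mathcal X_{in}|}}\right)^2.$$ -/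

import Mathlib

open MeasureTheory ProbabilityTheory

namespace DifMAML

noncomputable section

/-- The parameter space `ℝ^M` with its Euclidean norm. -/
abbrev Model (M : ℕ) : Type := EuclideanSpace ℝ (Fin M)

/-- The Hessian of `f` at `w`, as a linear operator on `ℝ^M`; its norm is the operator norm. -/
def hessian {M : ℕ} (f : Model M → ℝ) (w : Model M) : Model M →L[ℝ] Model M :=
  fderiv ℝ (gradient f) w

/-- `f` has an expectation under `ν`, and this expectation is at most `c`. -/
def MeanLE {A : Type*} [MeasurableSpace A] (ν : Measure A) (f : A → ℝ) (c : ℝ) : Prop :=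
  Integrable f ν ∧ ∫ a, f a ∂ν ≤ c

/-- The law of `n` i.i.d. draws from `κ t`, as a kernel in `t`. -/
def iidKernel {A B : Type*} [MeasurableSpace A] [MeasurableSpace B]
    (κ : Kernel A B) [IsMarkovKernel κ] (n : ℕ) : Kernel A (Fin n → B) where
  toFun t := Measure.pi fun _ => κ t
  measurable' := by
    refine Measurable.measure_of_isPiSystem_of_isProbabilityMeasure
      generateFrom_pi.symm isPiSystem_pi ?_
    rintro s ⟨u, hu, rfl⟩
    simp only [Measure.pi_pi]
    exact Finset.measurable_prod _ fun i _ => κ.measurable_coe (hu i (Set.mem_univ i))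

instance {A B : Type*} [MeasurableSpace A] [MeasurableSpace B]
    (κ : Kernel A B) [IsMarkovKernel κ] (n : ℕ) : IsMarkovKernel (iidKernel κ n) :=
  ⟨fun t => inferInstanceAs (IsProbabilityMeasure (Measure.pi fun _ : Fin n => κ t))⟩

/-- The data of a network of `K` agents running Dif-MAML on models in `ℝ^M`. Agent `k` has the set
of tasks `T k`, and its data points lie in `X k`. -/
structure Network (K M : ℕ) (T X : Fin K → Type*)
    [∀ k, MeasurableSpace (T k)] [∀ k, MeasurableSpace (X k)] where
  /-- the distribution `π_k` of the tasks of agent `k` -/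
  taskLaw : ∀ k, Measure (T k)
  taskLaw_prob : ∀ k, IsProbabilityMeasure (taskLaw k)
  /-- the distribution of a data point of task `t` at agent `k` -/
  dataLaw : ∀ k, Kernel (T k) (X k)
  dataLaw_markov : ∀ k, IsMarkovKernel (dataLaw k)
  /-- the loss `Q_k^{(t)}(w; x)` -/
  loss : ∀ k, T k → Model M → X k → ℝ
  /-- the inner step size -/
  α : ℝ
  α_pos : 0 < α
  /-- the number of tasks that agent `k` draws per iteration -/
  nTasks : Fin K → ℕ
  nTasks_pos : ∀ k, 0 < nTasks k
  /-- the size of an inner batch -/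
  nIn : ℕ
  nIn_pos : 0 < nIn
  /-- the size of an outer batch -/
  nOut : ℕ
  nOut_pos : 0 < nOut
  /-- the combination matrix `A = [a_{ℓ k}]` -/
  comb : Matrix (Fin K) (Fin K) ℝ
  /-- the initial launch models `w_{k,0}` -/
  init : Fin K → Model M

attribute [instance] Network.taskLaw_prob Network.dataLaw_markov

/-- The constants of the assumptions. -/
structure Constants where
  L : ℝ
  ρ : ℝ
  B : ℝ
  σG : ℝ
  σH : ℝ
  γG : ℝ
  γH : ℝ
  L_nonneg : 0 ≤ L
  ρ_nonneg : 0 ≤ ρ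
  B_nonneg : 0 ≤ B
  σG_nonneg : 0 ≤ σG
  σH_nonneg : 0 ≤ σH
  γG_nonneg : 0 ≤ γG
  γH_nonneg : 0 ≤ γH

namespace Network

variable {K M : ℕ} {T X : Fin K → Type*}
  [∀ k, MeasurableSpace (T k)] [∀ k, MeasurableSpace (X k)] (N : Network K M T X)

/-! ### Objectives -/

/-- The loss averaged over a batch. -/
def batchLoss (k : Fin K) (t : T k) {n : ℕ} (x : Fin n → X k) (w : Model M) : ℝ :=
  (1 / (n : ℝ)) * ∑ i, N.loss k t w (x i)

/-- The risk `J_k^{(t)}` of task `t`. -/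
def taskRisk (k : Fin K) (t : T k) (w : Model M) : ℝ :=
  ∫ x, N.loss k t w x ∂(N.dataLaw k t)

/-- The mean `J_k` of the risks of the tasks of agent `k`. -/
def meanRisk (k : Fin K) (w : Model M) : ℝ :=
  ∫ t, N.taskRisk k t w ∂(N.taskLaw k)

/-- The MAML objective of agent `k`: the mean risk after one exact gradient step. -/
def mamlRisk (k : Fin K) (w : Model M) : ℝ :=
  ∫ t, N.taskRisk k t (w - N.α • gradient (N.taskRisk k t) w) ∂(N.taskLaw k)

/-- The adjusted objective of agent `k`: the mean risk after one stochastic gradient step. -/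
def adjustedRisk (k : Fin K) (w : Model M) : ℝ :=
  ∫ t, ∫ x, N.taskRisk k t (w - N.α • gradient (N.batchLoss k t x) w)
    ∂(iidKernel (N.dataLaw k) N.nIn t) ∂(N.taskLaw k)

/-- The aggregate MAML objective. -/
def mamlObjective (w : Model M) : ℝ := (1 / (K : ℝ)) * ∑ k, N.mamlRisk k w

/-- The aggregate adjusted objective. -/
def adjustedObjective (w : Model M) : ℝ := (1 / (K : ℝ)) * ∑ k, N.adjustedRisk k w

/-! ### Sampling and the algorithm -/

/-- A task drawn by agent `k`, with an inner and an outer batch of its data. -/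
abbrev TaskDraw (k : Fin K) : Type _ := T k × (Fin N.nIn → X k) × (Fin N.nOut → X k)

/-- All that the agents draw in one iteration. -/
abbrev Draw : Type _ := ∀ k, Fin (N.nTasks k) → N.TaskDraw k

/-- The law of one task draw: the task has law `π_k`; given the task, all points of the two
batches are i.i.d. data points of this task. -/
def taskDrawLaw (k : Fin K) : Measure (N.TaskDraw k) :=
  (N.taskLaw k).compProd (iidKernel (N.dataLaw k) N.nIn ×ₖ iidKernel (N.dataLaw k) N.nOut)

/-- The law of all that agent `k` draws in one iteration: i.i.d. task draws. -/
def agentDrawLaw (k : Fin K) : Measure (Fin (N.nTasks k) → N.TaskDraw k) :=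
  Measure.pi fun _ => N.taskDrawLaw k

/-- `ξ i` is what the network draws in iteration `i`: each agent draws from its own law, and the
draws of different iterations are independent. -/
structure IsSampling {Ω : Type*} [MeasurableSpace Ω] (P : Measure Ω)
    (ξ : ℕ → Ω → N.Draw) : Prop where
  measurable : ∀ i, Measurable (ξ i)
  law : ∀ i k, P.map (fun ω => ξ i ω k) = N.agentDrawLaw k
  indep : iIndepFun ξ P

/-- The task-specific stochastic MAML gradient. -/
def taskMamlGrad (k : Fin K) (w : Model M) (d : N.TaskDraw k) : Model M :=
  (ContinuousLinearMap.id ℝ (Model M) - N.α • hessian (N.batchLoss k d.1 d.2.1) w)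
    (gradient (N.batchLoss k d.1 d.2.2) (w - N.α • gradient (N.batchLoss k d.1 d.2.1) w))

/-- The stochastic MAML gradient of agent `k` at `w`. -/
def mamlGrad (k : Fin K) (w : Model M) (s : Fin (N.nTasks k) → N.TaskDraw k) : Model M :=
  (1 / (N.nTasks k : ℝ)) • ∑ j, N.taskMamlGrad k w (s j)

/-- The launch models `w_{k,i}` of Dif-MAML with outer step size `μ`: in each iteration the agents
adapt by a stochastic MAML gradient step, and then combine. -/
def launch {Ω : Type*} (μ : ℝ) (ξ : ℕ → Ω → N.Draw) : ℕ → Ω → Fin K → Model M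
  | 0, _, k => N.init k
  | i + 1, ω, k => ∑ l, N.comb l k •
      (launch μ ξ i ω l - μ • N.mamlGrad l (launch μ ξ i ω l) (ξ (i + 1) ω l))

/-- The centroid `w_{c,i}` of the launch models. -/
def centroid {Ω : Type*} (μ : ℝ) (ξ : ℕ → Ω → N.Draw) (i : ℕ) (ω : Ω) : Model M :=
  (1 / (K : ℝ)) • ∑ k, N.launch μ ξ i ω k

/-- The centroid of the initial launch models. -/
def initCentroid : Model M := (1 / (K : ℝ)) • ∑ k, N.init k

/-! ### Assumptions -/

/-- What is presupposed for the gradients, Hessians and expectations below to make sense: the loss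
is measurable in the task and the data, twice differentiable in the model, and all risks are
finite. -/
structure Regular : Prop where
  measurable : ∀ k w, Measurable fun p : T k × X k => N.loss k p.1 w p.2
  differentiable : ∀ k t x, Differentiable ℝ fun w => N.loss k t w x
  differentiable_gradient : ∀ k t x, Differentiable ℝ (gradient fun w => N.loss k t w x)
  integrable_loss : ∀ k t w, Integrable (N.loss k t w) (N.dataLaw k t)
  integrable_taskRisk : ∀ k w, Integrable (fun t => N.taskRisk k t w) (N.taskLaw k)

/-- Lipschitz gradients, with a Lipschitz constant that may depend on the data point and has a
second moment of at most `L ^ 2`. -/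
def LipschitzGradients (L : ℝ) : Prop :=
  ∀ k, ∃ lip : T k → X k → ℝ, Measurable (Function.uncurry lip) ∧
    (∀ t x w u, ‖gradient (fun v => N.loss k t v x) w - gradient (fun v => N.loss k t v x) u‖
      ≤ lip t x * ‖w - u‖) ∧
    ∀ t, MeanLE (N.dataLaw k t) (fun x => lip t x ^ 2) (L ^ 2)

/-- Hessians that are Lipschitz in expectation. -/
def LipschitzHessians (ρ : ℝ) : Prop :=
  ∀ k t w u, MeanLE (N.dataLaw k t)
    (fun x => ‖hessian (fun v => N.loss k t v x) w - hessian (fun v => N.loss k t v x) u‖)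
    (ρ * ‖w - u‖)

/-- Gradients that are bounded in expectation. -/
def BoundedGradients (B : ℝ) : Prop :=
  ∀ k t w, MeanLE (N.dataLaw k t) (fun x => ‖gradient (fun v => N.loss k t v x) w‖) B

/-- Bounded fourth-order central moments of the gradients and Hessians over the data. -/
def BoundedNoise (σG σH : ℝ) : Prop :=
  ∀ k t w,
    MeanLE (N.dataLaw k t)
      (fun x => ‖gradient (fun v => N.loss k t v x) w - gradient (N.taskRisk k t) w‖ ^ 4)
      (σG ^ 4) ∧
    MeanLE (N.dataLaw k t)
      (fun x => ‖hessian (fun v => N.loss k t v x) w - hessian (N.taskRisk k t) w‖ ^ 4)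
      (σH ^ 4)

/-- Bounded fourth-order central moments of the gradients and Hessians over the tasks. -/
def BoundedTaskVariability (γG γH : ℝ) : Prop :=
  ∀ k w,
    MeanLE (N.taskLaw k)
      (fun t => ‖gradient (N.taskRisk k t) w - gradient (N.meanRisk k) w‖ ^ 4) (γG ^ 4) ∧
    MeanLE (N.taskLaw k)
      (fun t => ‖hessian (N.taskRisk k t) w - hessian (N.meanRisk k) w‖ ^ 4) (γH ^ 4)

/-- All assumptions on the network, with the constants `c`. -/
structure Assumptions (c : Constants) : Prop where
  regular : N.Regular
  lipschitzGradients : N.LipschitzGradients c.L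
  lipschitzHessians : N.LipschitzHessians c.ρ
  boundedGradients : N.BoundedGradients c.B
  boundedNoise : N.BoundedNoise c.σG c.σH
  boundedTaskVariability : N.BoundedTaskVariability c.γG c.γH
  comb_doublyStochastic : N.comb ∈ doublyStochastic ℝ (Fin K)
  comb_primitive : N.comb.IsPrimitive

/-! ### The constants of the conclusion -/

/-- `L̂`, the Lipschitz constant of the gradient of the adjusted objective. -/
def Lhat (c : Constants) : ℝ := c.L * (1 + N.α * c.L) ^ 2 + N.α * c.ρ * c.B

/-- `C₁²` -/
def C1sq (c : Constants) : ℝ :=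
  6 * (1 + N.α * c.L) ^ 2 * c.σG ^ 2 * (1 / N.nOut + c.L ^ 2 * N.α ^ 2 / N.nIn)
  + 6 * N.α ^ 2 * c.σH ^ 2 / N.nIn * (c.B ^ 2 + c.σG ^ 2 / N.nOut)
  + 9 * N.α ^ 4 / (N.nIn : ℝ) ^ 2 * (c.σH ^ 4 + c.L ^ 4 * c.σG ^ 4)

/-- `C₂²` -/
def C2sq (c : Constants) : ℝ :=
  8 * (1 + N.α * c.L) ^ 2 * (1 + N.α ^ 2 * c.L ^ 2) * c.γG ^ 2
  + 4 * c.B ^ 2 * N.α ^ 2 * c.γH ^ 2 + 2 * N.α ^ 4 * c.γH ^ 4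
  + 16 * (1 + N.α ^ 4 * c.L ^ 4) * c.γG ^ 4

/-- `C₃` -/
def C3 (c : Constants) : ℝ :=
  (1 + N.α * c.L) * N.α * c.L * (c.σG / √N.nIn) + (1 + N.α * c.L) ^ 2 * c.γG
  + c.B * N.α * (c.σH / √N.nIn) + c.B * N.α * c.γH
  + N.α ^ 2 * (c.σH ^ 2 / N.nIn) + N.α ^ 2 * c.γH ^ 2
  + N.α ^ 2 * c.L ^ 2 * (c.σG ^ 2 / N.nIn) + 2 * (1 + N.α ^ 2 * c.L ^ 2) * c.γG ^ 2

/-- `C²`, the bound on the gradient noise of all agents: the maximum over the agents `k` of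
`(3 / |S_k|) (C₁² + C₂² + C₃²)`. -/
def Csq (c : Constants) : ℝ :=
  ⨆ k, 3 / (N.nTasks k : ℝ) * (N.C1sq c + N.C2sq c + N.C3 c ^ 2)

/-- The bound on the distance of the gradients of the two objectives. -/
def gradGap (c : Constants) : ℝ :=
  (1 + N.α * c.L) * (N.α * c.L * c.σG / √N.nIn) + c.B * N.α * c.σH / √N.nIn

end Network

end

end DifMAML

/-! Dif-MAML is a perturbed stochastic gradient method for the adjusted objective, not for the MAML
objective. Given the task and the inner batch, the outer batch is fresh, so the stochastic MAML
gradient averages to `innerGrad`. By symmetry of the Hessian this is the gradient of the task risk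
after one stochastic inner step. Hence the noise is centered around the gradient of the adjusted
risk (`integral_taskMamlGrad`). That gradient is `Lhat`-Lipschitz (`gradient_adjustedRisk_sub_le`),
and the noise has variance at most `Csq` (`taskMamlGrad_var`, `mamlGrad_var`).

Since the combination matrix is doubly stochastic, combining leaves the centroid unchanged, and the
centroid moves by the average of the stochastic gradients taken at the individual launch models.
Powers of the matrix approach the averaging matrix geometrically (`exists_abs_pow_sub_le`), and the
stochastic gradients have uniformly bounded second moments. So the launch models differ from their
centroid by a decaying transient plus `O(μ ^ 2)` in mean square (`disagreement`).

The descent lemma, averaged over the fresh draw, then lowers the mean adjusted objective by `μ / 2`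
times the mean squared gradient, up to `Lhat * Csq * μ ^ 2 / 2`, a summable transient and `O(μ ^ 3)`
(`descent`). While the squared gradient stays above the threshold, each iteration loses a fixed
amount of a quantity bounded below. The first time below the threshold therefore exists and obeys
the stated bound (`exists_small_of_descent`).

The gradients of the two objectives differ by at most `gradGap` everywhere
(`norm_gradient_mamlObjective_sub_le`), which carries the estimate over to the MAML objective at the
same time. -/

namespace DifMAML

/-! ### Calculus of bounded expectations. -/

section MeanLE

variable {A B : Type*} [MeasurableSpace A] [MeasurableSpace B] {ν : Measure A} {f g : A → ℝ}
  {a b c : ℝ}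

theorem MeanLE.of_le (h : MeanLE ν f a) (hab : a ≤ b) : MeanLE ν f b :=
  ⟨h.1, h.2.trans hab⟩

theorem MeanLE.mono (h : MeanLE ν g c) (hf : AEStronglyMeasurable f ν) (hf0 : ∀ x, 0 ≤ f x)
    (hfg : ∀ x, f x ≤ g x) : MeanLE ν f c := by
  have hi : Integrable f ν := h.1.mono' hf (Filter.Eventually.of_forall fun x => by
    rw [Real.norm_of_nonneg (hf0 x)]; exact hfg x)
  exact ⟨hi, (integral_mono hi h.1 hfg).trans h.2⟩

theorem MeanLE.congr (h : MeanLE ν g c) (hfg : ∀ x, f x = g x) : MeanLE ν f c := by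
  rwa [funext hfg]

theorem MeanLE.add (hf : MeanLE ν f a) (hg : MeanLE ν g b) :
    MeanLE ν (fun x => f x + g x) (a + b) :=
  ⟨hf.1.add hg.1, by rw [integral_add hf.1 hg.1]; exact add_le_add hf.2 hg.2⟩

theorem MeanLE.const_mul (hf : MeanLE ν f a) {r : ℝ} (hr : 0 ≤ r) :
    MeanLE ν (fun x => r * f x) (r * a) :=
  ⟨hf.1.const_mul r, by rw [integral_const_mul]; exact mul_le_mul_of_nonneg_left hf.2 hr⟩

theorem MeanLE.const [IsProbabilityMeasure ν] (r : ℝ) : MeanLE ν (fun _ => r) r :=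
  ⟨integrable_const r, by simp⟩

theorem MeanLE.sum {ι : Type*} {s : Finset ι} {F : ι → A → ℝ} {C : ι → ℝ}
    (h : ∀ i ∈ s, MeanLE ν (F i) (C i)) : MeanLE ν (fun x => ∑ i ∈ s, F i x) (∑ i ∈ s, C i) :=
  ⟨integrable_finsetSum s fun i hi => (h i hi).1, by
    rw [integral_finsetSum s fun i hi => (h i hi).1]
    exact Finset.sum_le_sum fun i hi => (h i hi).2⟩

theorem MeanLE.nonneg (h : MeanLE ν f a) (hf0 : ∀ x, 0 ≤ f x) : 0 ≤ a :=
  (integral_nonneg hf0).trans h.2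

/-- The Cauchy–Schwarz inequality. -/
theorem MeanLE.mul (hf : MeanLE ν (fun x => f x ^ 2) (a ^ 2))
    (hg : MeanLE ν (fun x => g x ^ 2) (b ^ 2)) (ha : 0 ≤ a) (hb : 0 ≤ b)
    (mf : AEStronglyMeasurable f ν) (mg : AEStronglyMeasurable g ν) :
    MeanLE ν (fun x => f x * g x) (a * b) := by
  have hi : Integrable (fun x => f x * g x) ν := by
    refine (hf.1.add hg.1).mono' (mf.mul mg) (Filter.Eventually.of_forall fun x => ?_)
    simp only [Pi.add_apply, Real.norm_eq_abs, abs_mul]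
    nlinarith [sq_nonneg (|f x| - |g x|), sq_abs (f x), sq_abs (g x), sq_nonneg (f x),
      sq_nonneg (g x)]
  refine ⟨hi, ?_⟩
  -- Weighted AM-GM needs positive weights, while `a` or `b` may vanish; both are enlarged by `ε`,
  -- which tends to `0` afterwards.
  have key : ∀ ε > 0, ∫ x, f x * g x ∂ν ≤ (a + ε) * (b + ε) := by
    intro ε hε
    have ha' : 0 < a + ε := by linarith
    have hb' : 0 < b + ε := by linarith
    have h1 : MeanLE ν (fun x => (b + ε) / (a + ε) / 2 * f x ^ 2 + (a + ε) / (b + ε) / 2 * g x ^ 2)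
        ((b + ε) / (a + ε) / 2 * a ^ 2 + (a + ε) / (b + ε) / 2 * b ^ 2) :=
      (hf.const_mul (by positivity)).add (hg.const_mul (by positivity))
    calc ∫ x, f x * g x ∂ν ≤ _ := integral_mono hi h1.1 fun x => ?_
      _ ≤ _ := h1.2
      _ ≤ (b + ε) / (a + ε) / 2 * (a + ε) ^ 2 + (a + ε) / (b + ε) / 2 * (b + ε) ^ 2 := by
        gcongr <;> linarith
      _ = (a + ε) * (b + ε) := by field_simp; ring
    have h2 : (b + ε) / (a + ε) / 2 * f x ^ 2 + (a + ε) / (b + ε) / 2 * g x ^ 2 - f x * g x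
        = ((b + ε) * f x - (a + ε) * g x) ^ 2 / (2 * (a + ε) * (b + ε)) := by
      field_simp; ring
    have h3 : 0 ≤ ((b + ε) * f x - (a + ε) * g x) ^ 2 / (2 * (a + ε) * (b + ε)) := by positivity
    simp only
    linarith
  have ht : Filter.Tendsto (fun ε : ℝ => (a + ε) * (b + ε)) (nhdsWithin 0 (Set.Ioi 0))
      (nhds (a * b)) := by
    have : Continuous fun ε : ℝ => (a + ε) * (b + ε) := by fun_prop
    simpa using (this.tendsto 0).mono_left nhdsWithin_le_nhds
  exact ge_of_tendsto ht (eventually_nhdsWithin_of_forall fun ε hε => key ε hε)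

/-- Jensen's inequality for the square. -/
theorem MeanLE.of_sq [IsProbabilityMeasure ν] (hf : MeanLE ν (fun x => f x ^ 2) (a ^ 2))
    (ha : 0 ≤ a) (mf : AEStronglyMeasurable f ν) : MeanLE ν f a := by
  have h1 : MeanLE ν (fun _ => (1 : ℝ) ^ 2) (1 ^ 2) := MeanLE.const _
  simpa using hf.mul h1 ha zero_le_one mf aestronglyMeasurable_const

theorem MeanLE.norm_integral_le {E : Type*} [NormedAddCommGroup E] [NormedSpace ℝ E] {F : A → E}
    (h : MeanLE ν (fun x => ‖F x‖) c) : ‖∫ x, F x ∂ν‖ ≤ c :=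
  (norm_integral_le_integral_norm F).trans h.2

theorem MeanLE.integrable_of_norm {E : Type*} [NormedAddCommGroup E] {F : A → E}
    (h : MeanLE ν (fun x => ‖F x‖) c) (hF : AEStronglyMeasurable F ν) : Integrable F ν :=
  (integrable_norm_iff hF).1 h.1

/-- The tower property. For a nonnegative function, finite iterated integrals already give
integrability for the joint law. -/
theorem MeanLE.compProd {τ : Measure A} [SFinite τ] {κ : Kernel A B} [IsMarkovKernel κ]
    {f : A × B → ℝ} (mf : Measurable f) (hf0 : ∀ p, 0 ≤ f p)
    (h : ∀ t, MeanLE (κ t) (fun x => f (t, x)) (g t)) (hg : MeanLE τ g c) :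
    MeanLE (τ.compProd κ) f c := by
  have hm : MeanLE τ (fun t => ∫ x, f (t, x) ∂κ t) c := by
    refine hg.mono ?_ (fun t => integral_nonneg fun x => hf0 _) fun t => (h t).2
    exact (StronglyMeasurable.integral_kernel_prod_right (κ := κ)
      (f := fun t x => f (t, x)) mf.stronglyMeasurable).aestronglyMeasurable
  have hi : Integrable f (τ.compProd κ) := by
    rw [Measure.integrable_compProd_iff mf.aestronglyMeasurable]
    refine ⟨Filter.Eventually.of_forall fun t => (h t).1, ?_⟩
    simpa only [Real.norm_of_nonneg (hf0 _)] using hm.1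
  exact ⟨hi, by rw [Measure.integral_compProd hi]; exact hm.2⟩

theorem MeanLE.prod {ρ : Measure B} [IsProbabilityMeasure ρ] [SFinite ν] {f : A × B → ℝ}
    (mf : Measurable f) (hf0 : ∀ p, 0 ≤ f p)
    (h : ∀ t, MeanLE ρ (fun x => f (t, x)) (g t)) (hg : MeanLE ν g c) :
    MeanLE (ν.prod ρ) f c := by
  rw [← Measure.compProd_const]
  exact MeanLE.compProd mf hf0 (by simpa using h) hg

theorem MeanLE.comp {ρ : Measure B} {φ : A → B} {f : B → ℝ} (hφ : MeasurePreserving φ ν ρ)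
    (h : MeanLE ρ f c) : MeanLE ν (fun x => f (φ x)) c := by
  refine ⟨(hφ.integrable_comp h.1.1).2 h.1, ?_⟩
  rw [← hφ.map_eq] at h
  have := integral_map hφ.measurable.aemeasurable h.1.1
  rw [← this]; exact h.2

/-- The mean square distance is smallest at the mean. -/
theorem MeanLE.sub_mean_sq [IsProbabilityMeasure ν] {E : Type*} [NormedAddCommGroup E]
    [InnerProductSpace ℝ E] [CompleteSpace E] {F : A → E} (hF : Integrable F ν) {m : E}
    (h : MeanLE ν (fun x => ‖F x - m‖ ^ 2) c) :
    MeanLE ν (fun x => ‖F x - ∫ y, F y ∂ν‖ ^ 2) c := by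
  set e := ∫ y, F y ∂ν with he
  have h1 : ∀ x, ‖F x - e‖ ^ 2
      = ‖F x - m‖ ^ 2 + (-2 * inner ℝ (e - m) (F x - m) + ‖e - m‖ ^ 2) := by
    intro x
    have : F x - e = (F x - m) - (e - m) := by abel
    rw [this, norm_sub_sq_real, real_inner_comm]; ring
  have hi : Integrable (fun x => F x - m) ν := hF.sub (integrable_const _)
  have h2 : Integrable (fun x => -2 * inner ℝ (e - m) (F x - m) + ‖e - m‖ ^ 2) ν :=
    ((hi.const_inner _).const_mul _).add (integrable_const _)
  -- The cross term integrates to `-2 * ‖e - m‖ ^ 2`, so the correction has mean `-‖e - m‖ ^ 2`.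
  have h3 : MeanLE ν (fun x => -2 * inner ℝ (e - m) (F x - m) + ‖e - m‖ ^ 2) 0 := by
    refine ⟨h2, ?_⟩
    rw [integral_add ((hi.const_inner _).const_mul _) (integrable_const _), integral_const_mul,
      integral_inner hi, integral_sub hF (integrable_const _)]
    simp only [integral_const, probReal_univ, one_smul, ← he, real_inner_self_eq_norm_sq]
    nlinarith [sq_nonneg ‖e - m‖]
  simpa only [h1, add_zero] using h.add h3

end MeanLE

end DifMAML

/-! ### Moments of averages of i.i.d. vectors. -/

namespace DifMAML

set_option linter.unusedSectionVars false

section Iid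

variable {A B E : Type*} [MeasurableSpace A] [MeasurableSpace B]
  [NormedAddCommGroup E] [InnerProductSpace ℝ E] [CompleteSpace E]
  {ν : Measure A} {ρ : Measure B} [IsProbabilityMeasure ν] [IsProbabilityMeasure ρ]
  {Z : A → E} {S : B → E}

theorem integrable_inner_prod (hZ : Integrable Z ν) (hS : Integrable S ρ) :
    Integrable (fun p : A × B => inner ℝ (Z p.1) (S p.2)) (ν.prod ρ) :=
  hZ.op_fst_snd (continuous_inner) ⟨1, fun x y => by simpa using norm_inner_le_norm (𝕜 := ℝ) x y⟩ hS

theorem integral_inner_prod (hZ : Integrable Z ν) (hS : Integrable S ρ) :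
    ∫ p, inner ℝ (Z p.1) (S p.2) ∂ν.prod ρ = inner ℝ (∫ x, Z x ∂ν) (∫ y, S y ∂ρ) := by
  rw [integral_prod _ (integrable_inner_prod hZ hS)]
  simp only [integral_inner hS]
  simp only [real_inner_comm (∫ y, S y ∂ρ)]
  rw [integral_inner hZ, real_inner_comm]

theorem MeanLE.prod_add_sq {a b : ℝ} (hZ : Integrable Z ν) (hS : Integrable S ρ)
    (h0 : ∫ x, Z x ∂ν = 0) (ha : MeanLE ν (fun x => ‖Z x‖ ^ 2) a)
    (hb : MeanLE ρ (fun x => ‖S x‖ ^ 2) b) :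
    MeanLE (ν.prod ρ) (fun p => ‖Z p.1 + S p.2‖ ^ 2) (a + b) := by
  have h1 : MeanLE (ν.prod ρ) (fun p => 2 * inner ℝ (Z p.1) (S p.2)) (2 * 0) :=
    MeanLE.const_mul ⟨integrable_inner_prod hZ hS, by simp [integral_inner_prod hZ hS, h0]⟩
      zero_le_two
  refine (((ha.comp measurePreserving_fst).add (hb.comp measurePreserving_snd)).add h1).congr
    (fun p => ?_) |>.of_le (by simp)
  rw [norm_add_sq_real]; ring

theorem MeanLE.integrable_norm_sq_smul {v : ℝ} (hZ : Integrable Z ν)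
    (h : MeanLE ν (fun x => ‖Z x‖ ^ 4) v) : Integrable (fun x => ‖Z x‖ ^ 2 • Z x) ν := by
  refine ((integrable_const (1 : ℝ)).add h.1).mono' ((hZ.1.norm.pow 2).smul hZ.1)
    (Filter.Eventually.of_forall fun x => ?_)
  simp only [norm_smul, norm_pow, norm_norm, Pi.add_apply]
  have := norm_nonneg (Z x)
  nlinarith [sq_nonneg (‖Z x‖ ^ 2 - ‖Z x‖), sq_nonneg (‖Z x‖ ^ 2), sq_nonneg (‖Z x‖ - 1),
    sq_nonneg (‖Z x‖ ^ 2 - 1)]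

/-- The last bracket is linear in `z` or in `s`, so it vanishes in the mean for independent centered
vectors. The coefficient `6` is `2` from the product of the squared norms plus `4` from the squared
inner product, estimated by Cauchy–Schwarz. -/
theorem norm_add_pow_four_le (z s : E) :
    ‖z + s‖ ^ 4 ≤ ‖z‖ ^ 4 + ‖s‖ ^ 4 + 6 * (‖z‖ ^ 2 * ‖s‖ ^ 2)
      + (4 * inner ℝ z (‖s‖ ^ 2 • s) + 4 * inner ℝ (‖z‖ ^ 2 • z) s) := by
  have h : ‖z + s‖ ^ 4 = (‖z‖ ^ 2 + 2 * inner ℝ z s + ‖s‖ ^ 2) ^ 2 := by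
    rw [← norm_add_sq_real]; ring
  rw [h, inner_smul_left, inner_smul_right]
  have h2 : (inner ℝ z s) ^ 2 ≤ (‖z‖ * ‖s‖) ^ 2 := by
    rw [← sq_abs]; gcongr; exact abs_real_inner_le_norm z s
  simp only [conj_trivial]
  nlinarith

theorem MeanLE.prod_add_fourth {a b u v : ℝ} (hZ : Integrable Z ν) (hS : Integrable S ρ)
    (hZ0 : ∫ x, Z x ∂ν = 0) (hS0 : ∫ x, S x ∂ρ = 0)
    (ha : MeanLE ν (fun x => ‖Z x‖ ^ 2) a) (hb : MeanLE ρ (fun x => ‖S x‖ ^ 2) b)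
    (hu : MeanLE ν (fun x => ‖Z x‖ ^ 4) u) (hv : MeanLE ρ (fun x => ‖S x‖ ^ 4) v) :
    MeanLE (ν.prod ρ) (fun p => ‖Z p.1 + S p.2‖ ^ 4) (u + v + 6 * (a * b)) := by
  have h0 : 0 ≤ a := ha.nonneg fun x => by positivity
  have h1 : MeanLE (ν.prod ρ) (fun p => ‖Z p.1‖ ^ 2 * ‖S p.2‖ ^ 2) (a * b) := by
    refine ⟨ha.1.mul_prod hb.1, ?_⟩
    rw [integral_prod_mul (fun x => ‖Z x‖ ^ 2) (fun y => ‖S y‖ ^ 2)]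
    exact mul_le_mul ha.2 hb.2 (integral_nonneg fun x => by positivity) h0
  have iS := hv.integrable_norm_sq_smul hS
  have iZ := hu.integrable_norm_sq_smul hZ
  have h2 : MeanLE (ν.prod ρ) (fun p => inner ℝ (Z p.1) (‖S p.2‖ ^ 2 • S p.2)) 0 :=
    ⟨integrable_inner_prod hZ iS, by
      rw [integral_inner_prod (S := fun y => ‖S y‖ ^ 2 • S y) hZ iS, hZ0, inner_zero_left]⟩
  have h3 : MeanLE (ν.prod ρ) (fun p => inner ℝ (‖Z p.1‖ ^ 2 • Z p.1) (S p.2)) 0 :=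
    ⟨integrable_inner_prod iZ hS, by
      rw [integral_inner_prod (Z := fun y => ‖Z y‖ ^ 2 • Z y) iZ hS, hS0, inner_zero_right]⟩
  have := (((hu.comp (measurePreserving_fst (μ := ν) (ν := ρ))).add
    (hv.comp measurePreserving_snd)).add (h1.const_mul (r := 6) (by norm_num))).add
    ((h2.const_mul (r := 4) (by norm_num)).add (h3.const_mul (r := 4) (by norm_num)))
  refine (this.mono ?_ (fun p => by positivity) fun p => norm_add_pow_four_le _ _).of_le (by simp)
  exact (((hZ.1.comp_fst).add hS.1.comp_snd).norm.pow 4)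

/-- Second and fourth moments of a sum of `n` i.i.d. centered vectors. -/
theorem pi_sum_moments {v : ℝ} (hZ : Integrable Z ν) (hZ0 : ∫ x, Z x ∂ν = 0)
    (hv : MeanLE ν (fun x => ‖Z x‖ ^ 2) v) (n : ℕ) :
    (Integrable (fun x : Fin n → A => ∑ i, Z (x i)) (Measure.pi fun _ => ν) ∧
      ∫ x : Fin n → A, ∑ i, Z (x i) ∂(Measure.pi fun _ => ν) = 0) ∧
    MeanLE (Measure.pi fun _ => ν) (fun x : Fin n → A => ‖∑ i, Z (x i)‖ ^ 2) (n * v) ∧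
    (MeanLE ν (fun x => ‖Z x‖ ^ 4) (v ^ 2) →
      MeanLE (Measure.pi fun _ => ν) (fun x : Fin n → A => ‖∑ i, Z (x i)‖ ^ 4)
        (3 * n ^ 2 * v ^ 2)) := by
  have hI (n : ℕ) : Integrable (fun x : Fin n → A => ∑ i, Z (x i)) (Measure.pi fun _ => ν) :=
    integrable_finsetSum _ fun i _ => integrable_comp_eval hZ
  have h0 (n : ℕ) : ∫ x : Fin n → A, ∑ i, Z (x i) ∂(Measure.pi fun _ => ν) = 0 := by
    rw [integral_finsetSum _ fun i _ => integrable_comp_eval hZ]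
    refine Finset.sum_eq_zero fun i _ => ?_
    rw [integral_comp_eval (μ := fun _ => ν) (f := Z) hZ.1, hZ0]
  refine ⟨⟨hI n, h0 n⟩, ?_⟩
  induction n with
  | zero =>
    constructor
    · simpa using MeanLE.const 0
    · intro _
      simpa using MeanLE.const 0
  | succ n ih =>
    have mp := measurePreserving_piFinSuccAbove (fun _ : Fin (n + 1) => ν) 0
    have e : ∀ x : Fin (n + 1) → A, ∑ i, Z (x i) = Z ((MeasurableEquiv.piFinSuccAbove
        (fun _ : Fin (n + 1) => A) 0 x).1) + ∑ i, Z ((MeasurableEquiv.piFinSuccAbove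
        (fun _ : Fin (n + 1) => A) 0 x).2 i) := by
      intro x
      rw [Fin.sum_univ_succ]; rfl
    simp only [e]
    refine ⟨((hv.prod_add_sq hZ (hI n) hZ0 ih.1).comp mp).of_le (by push_cast; linarith), ?_⟩
    intro h4
    -- The recursion yields `3 * n ^ 2 + 6 * n + 1`, which is at most `3 * (n + 1) ^ 2`.
    refine ((MeanLE.prod_add_fourth hZ (hI n) hZ0 (h0 n) hv ih.1 h4 (ih.2 h4)).comp mp).of_le ?_
    push_cast; nlinarith [sq_nonneg v]

variable {n : ℕ}

theorem integral_avg {G : Type*} [NormedAddCommGroup G] [NormedSpace ℝ G] {F : A → G}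
    (hF : Integrable F ν) (hn : 0 < n) :
    ∫ x : Fin n → A, (1 / (n : ℝ)) • ∑ i, F (x i) ∂(Measure.pi fun _ => ν) = ∫ x, F x ∂ν := by
  have hn' : (n : ℝ) ≠ 0 := by positivity
  rw [integral_smul, integral_finsetSum _ fun i _ => integrable_comp_eval hF]
  simp only [integral_comp_eval (μ := fun _ : Fin n => ν) (f := F) hF.1]
  simp [← Nat.cast_smul_eq_nsmul ℝ, smul_smul, hn']

theorem integrable_avg {G : Type*} [NormedAddCommGroup G] [NormedSpace ℝ G] {F : A → G}
    (hF : Integrable F ν) :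
    Integrable (fun x : Fin n → A => (1 / (n : ℝ)) • ∑ i, F (x i)) (Measure.pi fun _ => ν) :=
  (integrable_finsetSum _ fun _ _ => integrable_comp_eval hF).smul _

variable {F : A → E} {m : E}

theorem avg_sub (hn : 0 < n) (x : Fin n → A) :
    (1 / (n : ℝ)) • ∑ i, F (x i) - m = (1 / (n : ℝ)) • ∑ i, (F (x i) - m) := by
  have : (n : ℝ) ≠ 0 := by positivity
  rw [Finset.sum_sub_distrib, smul_sub]
  simp [← Nat.cast_smul_eq_nsmul ℝ, smul_smul, this]

/-- The variance of the mean of `n` i.i.d. vectors. -/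
theorem MeanLE.avg_sq {v : ℝ} (hF : Integrable F ν) (hm : ∫ x, F x ∂ν = m)
    (hv : MeanLE ν (fun x => ‖F x - m‖ ^ 2) v) (hn : 0 < n) :
    MeanLE (Measure.pi fun _ => ν) (fun x : Fin n → A => ‖(1 / (n : ℝ)) • ∑ i, F (x i) - m‖ ^ 2)
      (v / n) := by
  have hn' : (0 : ℝ) < n := by positivity
  have h := (pi_sum_moments (hF.sub (integrable_const m))
    (by rw [integral_sub' hF (integrable_const m), hm]; simp) hv n).2.1
  refine ((h.const_mul (r := (1 / (n : ℝ)) ^ 2) (by positivity)).congr fun x => ?_).of_le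
    (le_of_eq ?_)
  · rw [avg_sub hn, norm_smul, mul_pow, Real.norm_of_nonneg (by positivity)]; rfl
  · field_simp

/-- The fourth central moment of the mean of `n` i.i.d. vectors. -/
theorem MeanLE.avg_fourth {v : ℝ} (hv0 : 0 ≤ v) (hF : Integrable F ν) (hm : ∫ x, F x ∂ν = m)
    (hv : MeanLE ν (fun x => ‖F x - m‖ ^ 4) (v ^ 2)) (hn : 0 < n) :
    MeanLE (Measure.pi fun _ => ν) (fun x : Fin n → A => ‖(1 / (n : ℝ)) • ∑ i, F (x i) - m‖ ^ 4)
      (3 * v ^ 2 / n ^ 2) := by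
  have hn' : (0 : ℝ) < n := by positivity
  have hi := hF.sub (integrable_const m)
  have h2 : MeanLE ν (fun x => ‖F x - m‖ ^ 2) v :=
    MeanLE.of_sq (hv.congr fun x => by ring) hv0 (hi.1.norm.pow 2)
  have h := (pi_sum_moments hi
    (by rw [integral_sub' hF (integrable_const m), hm]; simp) h2 n).2.2 hv
  refine ((h.const_mul (r := (1 / (n : ℝ)) ^ 4) (by positivity)).congr fun x => ?_).of_le
    (le_of_eq ?_)
  · rw [avg_sub hn, norm_smul, mul_pow, Real.norm_of_nonneg (by positivity)]; rfl
  · field_simp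

theorem MeanLE.avg {f : A → ℝ} {v : ℝ} (h : MeanLE ν f v) (hn : 0 < n) :
    MeanLE (Measure.pi fun _ => ν) (fun x : Fin n → A => (1 / (n : ℝ)) * ∑ i, f (x i)) v := by
  have hn' : (0 : ℝ) < n := by positivity
  have := (MeanLE.sum (s := Finset.univ) fun (i : Fin n) _ =>
    h.comp (measurePreserving_eval (fun _ : Fin n => ν) i)).const_mul (r := 1 / (n : ℝ))
      (by positivity)
  refine this.of_le (le_of_eq ?_)
  simp; field_simp

theorem sq_avg_le (y : Fin n → ℝ) (hn : 0 < n) :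
    ((1 / (n : ℝ)) * ∑ i, y i) ^ 2 ≤ (1 / (n : ℝ)) * ∑ i, y i ^ 2 := by
  have hn' : (0 : ℝ) < n := by positivity
  have h := sq_sum_le_card_mul_sum_sq (s := Finset.univ) (f := y)
  simp only [Finset.card_univ, Fintype.card_fin] at h
  rw [mul_pow]
  calc (1 / (n : ℝ)) ^ 2 * (∑ i, y i) ^ 2 ≤ (1 / (n : ℝ)) ^ 2 * (n * ∑ i, y i ^ 2) := by gcongr
    _ = _ := by field_simp

end Iid

end DifMAML

/-! ### Gradients and Hessians: measurability, chain rule, integration, descent lemma. -/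

namespace DifMAML

section Calculus

open InnerProductSpace

variable {M : ℕ} {A : Type*} [MeasurableSpace A]

theorem clm_eq_sum {E F : Type*} [NormedAddCommGroup E] [NormedSpace ℝ E] [FiniteDimensional ℝ E]
    [NormedAddCommGroup F] [NormedSpace ℝ F] (T : E →L[ℝ] F) :
    T = ∑ i, ContinuousLinearMap.smulRightL ℝ E F
      (LinearMap.toContinuousLinearMap ((Module.finBasis ℝ E).coord i))
        (T (Module.finBasis ℝ E i)) := by
  ext v
  conv_lhs => rw [← (Module.finBasis ℝ E).sum_repr v]
  rw [map_sum]
  simp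

/-- Directional derivatives are pointwise limits of difference quotients along `1 / (n + 1)`, hence
jointly measurable in the parameter and the point. Finitely many of them determine the derivative
(`clm_eq_sum`). -/
theorem measurable_fderiv_param {E F : Type*} [NormedAddCommGroup E] [NormedSpace ℝ E]
    [FiniteDimensional ℝ E] [MeasurableSpace E] [BorelSpace E]
    [NormedAddCommGroup F] [NormedSpace ℝ F] [FiniteDimensional ℝ F] [MeasurableSpace F]
    [BorelSpace F] {f : A → E → F} (hf : Measurable (Function.uncurry f))
    (hd : ∀ a, Differentiable ℝ (f a)) :
    Measurable fun p : A × E => fderiv ℝ (f p.1) p.2 := by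
  have : ProperSpace E := FiniteDimensional.proper_real E
  have : ProperSpace F := FiniteDimensional.proper_real F
  have : SecondCountableTopology E := secondCountable_of_proper
  have : SecondCountableTopology F := secondCountable_of_proper
  have : SecondCountableTopology (E →L[ℝ] F) := inferInstance
  have key : ∀ v : E, Measurable fun p : A × E => fderiv ℝ (f p.1) p.2 v := by
    intro v
    refine measurable_of_tendsto_metrizable
      (f := fun (n : ℕ) (p : A × E) => ((n : ℝ) + 1) • (f p.1 (p.2 + ((n : ℝ) + 1)⁻¹ • v) -
        f p.1 p.2)) (fun n => ?_) ?_
    · have h1 : Measurable fun p : A × E => f p.1 (p.2 + ((n : ℝ) + 1)⁻¹ • v) :=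
        hf.comp (measurable_fst.prodMk (measurable_snd.add_const _))
      exact (h1.sub hf).const_smul ((n : ℝ) + 1)
    · rw [tendsto_pi_nhds]
      intro p
      exact ((hd p.1 p.2).hasFDerivAt.lim_real (v := v)).comp
        (Filter.tendsto_atTop_add_const_right _ 1 tendsto_natCast_atTop_atTop)
  have e : (fun p : A × E => fderiv ℝ (f p.1) p.2) = fun p => ∑ i,
      ContinuousLinearMap.smulRightL ℝ E F
      (LinearMap.toContinuousLinearMap ((Module.finBasis ℝ E).coord i))
        (fderiv ℝ (f p.1) p.2 (Module.finBasis ℝ E i)) := funext fun p => clm_eq_sum _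
  rw [e]
  exact Finset.measurable_sum _ fun i _ =>
    (ContinuousLinearMap.continuous _).measurable.comp (key _)

/-- The inner product as a bilinear map. -/
noncomputable def innerBilin (M : ℕ) : Model M →L[ℝ] Model M →L[ℝ] ℝ :=
  (isBoundedBilinearMap_inner (𝕜 := ℝ) (E := Model M)).toContinuousLinearMap

/-- `toDual` is conjugate-linear by type; `innerBilin` is plainly linear over `ℝ`, so sums and
scalars pass through it. -/
theorem toDual_eq_innerBilin (w : Model M) : toDual ℝ (Model M) w = innerBilin M w := rfl

theorem measurable_gradient_param {f : A → Model M → ℝ} (hf : Measurable (Function.uncurry f))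
    (hd : ∀ a, Differentiable ℝ (f a)) :
    Measurable fun p : A × Model M => gradient (f p.1) p.2 :=
  (LinearIsometryEquiv.continuous _).measurable.comp (measurable_fderiv_param hf hd)

theorem measurable_hessian_param {f : A → Model M → ℝ} (hf : Measurable (Function.uncurry f))
    (hd : ∀ a, Differentiable ℝ (f a)) (hd2 : ∀ a, Differentiable ℝ (gradient (f a))) :
    Measurable fun p : A × Model M => hessian (f p.1) p.2 :=
  measurable_fderiv_param (f := fun a => gradient (f a)) (measurable_gradient_param hf hd) hd2

/-- Second derivatives are symmetric at a point as soon as the gradient is differentiable there; the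
Hessian need not be continuous. -/
theorem inner_hessian_comm {f : Model M → ℝ} (hd : Differentiable ℝ f)
    {w : Model M} (hd2 : DifferentiableAt ℝ (gradient f) w) (u v : Model M) :
    inner ℝ (hessian f w u) v = inner ℝ u (hessian f w v) := by
  have h1 : ∀ y, HasFDerivAt f (innerBilin M (gradient f y)) y := fun y =>
    (hd y).hasGradientAt
  have h2 : HasFDerivAt (fun y => innerBilin M (gradient f y))
      ((innerBilin M).comp (hessian f w)) w :=
    (innerBilin M).hasFDerivAt.comp w hd2.hasFDerivAt
  have h3 : inner ℝ (hessian f w u) v = inner ℝ (hessian f w v) u :=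
    second_derivative_symmetric h1 h2 u v
  rw [h3, real_inner_comm]

/-- The chain rule for gradients involves the adjoint of the inner derivative, which here is the
derivative itself. -/
theorem hasGradientAt_comp {J : Model M → ℝ} {φ : Model M → Model M} {w g : Model M}
    {T : Model M →L[ℝ] Model M} (hJ : HasGradientAt J g (φ w)) (hφ : HasFDerivAt φ T w)
    (hT : ∀ u v, inner ℝ (T u) v = inner ℝ u (T v)) :
    HasGradientAt (fun v => J (φ v)) (T g) w := by
  rw [hasGradientAt_iff_hasFDerivAt]
  refine (hJ.hasFDerivAt.comp w hφ).congr_fderiv ?_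
  ext v
  simp only [ContinuousLinearMap.comp_apply, toDual_apply_apply]
  rw [hT]

/-- The gradient of the loss after one gradient step. -/
theorem hasGradientAt_step {J q : Model M → ℝ} {a : ℝ} {w : Model M} (hJ : Differentiable ℝ J)
    (hq : Differentiable ℝ q) (hq2 : DifferentiableAt ℝ (gradient q) w) :
    HasGradientAt (fun v => J (v - a • gradient q v))
      ((ContinuousLinearMap.id ℝ (Model M) - a • hessian q w)
        (gradient J (w - a • gradient q w))) w := by
  refine hasGradientAt_comp (φ := fun v => v - a • gradient q v) (hJ _).hasGradientAt
    ((hasFDerivAt_id w).sub (hq2.hasFDerivAt.const_smul a)) fun u v => ?_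
  have h := inner_hessian_comm hq hq2 u v
  simp only [sub_apply, ContinuousLinearMap.id_apply, smul_apply, inner_sub_left, inner_sub_right, inner_smul_left,
    inner_smul_right, conj_trivial]
  exact congrArg (fun r => inner ℝ u v - a * r) h

theorem norm_gradient {f : Model M → ℝ} {w : Model M} : ‖gradient f w‖ = ‖fderiv ℝ f w‖ := by
  rw [gradient, LinearIsometryEquiv.norm_map]

theorem norm_gradient_le {f : Model M → ℝ} {b : ℝ} (hb : 0 ≤ b)
    (h : ∀ u v, ‖f u - f v‖ ≤ b * ‖u - v‖) (w : Model M) : ‖gradient f w‖ ≤ b := by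
  rw [norm_gradient]
  exact norm_fderiv_le_of_lip' ℝ hb (Filter.Eventually.of_forall fun u => h u w)

theorem norm_sub_le_of_gradient {f : Model M → ℝ} {b : ℝ} (hd : Differentiable ℝ f)
    (h : ∀ w, ‖gradient f w‖ ≤ b) (u v : Model M) : ‖f u - f v‖ ≤ b * ‖u - v‖ :=
  Convex.norm_image_sub_le_of_norm_fderiv_le (s := Set.univ) (fun x _ => hd x)
    (fun x _ => by rw [← norm_gradient]; exact h x) convex_univ (Set.mem_univ _) (Set.mem_univ _)

/-- Dominated differentiation under the integral; a bound on the unit ball around the point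
suffices. -/
theorem hasGradientAt_integral {ν : Measure A} {f : A → Model M → ℝ} {w : Model M} {b : A → ℝ}
    (hm : ∀ u, AEStronglyMeasurable (fun a => f a u) ν) (hi : Integrable (fun a => f a w) ν)
    (hg : AEStronglyMeasurable (fun a => gradient (f a) w) ν)
    (hd : ∀ a, Differentiable ℝ (f a))
    (hb : ∀ a, ∀ u ∈ Metric.ball w 1, ‖gradient (f a) u‖ ≤ b a) (hbi : Integrable b ν) :
    Integrable (fun a => gradient (f a) w) ν ∧
      HasGradientAt (fun u => ∫ a, f a u ∂ν) (∫ a, gradient (f a) w ∂ν) w := by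
  have hgi : Integrable (fun a => gradient (f a) w) ν :=
    hbi.mono' hg (Filter.Eventually.of_forall fun a => hb a w (Metric.mem_ball_self one_pos))
  refine ⟨hgi, ?_⟩
  have h := hasFDerivAt_integral_of_dominated_of_fderiv_le (μ := ν) (𝕜 := ℝ) (F := fun u a => f a u)
    (F' := fun u a => fderiv ℝ (f a) u) (x₀ := w) (bound := b) (s := Metric.ball w 1)
    (Metric.ball_mem_nhds w one_pos) (Filter.Eventually.of_forall hm) hi ?_
    (Filter.Eventually.of_forall fun a u hu => by rw [← norm_gradient]; exact hb a u hu) hbi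
    (Filter.Eventually.of_forall fun a u _ => (hd a u).hasFDerivAt)
  · rw [hasGradientAt_iff_hasFDerivAt]
    refine h.congr_fderiv ?_
    refine Eq.trans ?_ ((innerBilin M).integral_comp_comm hgi)
    congr 1
    ext a : 1
    exact (toDual_gradient (f := f a) (x := w)).symm
  · have := ((toDual ℝ (Model M)).continuous).comp_aestronglyMeasurable hg
    simpa using this

/-- The descent lemma. -/
theorem le_of_lipschitz_gradient {f : Model M → ℝ} {b : ℝ} (hd : Differentiable ℝ f)
    (h : ∀ u v, ‖gradient f u - gradient f v‖ ≤ b * ‖u - v‖) (x d : Model M) :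
    f (x + d) ≤ f x + inner ℝ (gradient f x) d + b / 2 * ‖d‖ ^ 2 := by
  -- `φ` is `f` along the segment minus the linear and quadratic terms of the claimed bound. The
  -- Lipschitz condition makes its derivative nonpositive, and the claim compares its values at `1`
  -- and `0`.
  set φ : ℝ → ℝ := fun t => f (x + t • d) - (t * inner ℝ (gradient f x) d + b / 2 * t ^ 2 * ‖d‖ ^ 2)
    with hφ
  have hder : ∀ t, HasDerivAt φ (inner ℝ (gradient f (x + t • d)) d
      - (inner ℝ (gradient f x) d + b * t * ‖d‖ ^ 2)) t := by
    intro t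
    have h1 : HasDerivAt (fun t : ℝ => x + t • d) d t := by
      simpa using ((hasDerivAt_id t).smul_const d).const_add x
    have h2 := (hd (x + t • d)).hasGradientAt.hasFDerivAt.comp_hasDerivAt t h1
    have h3 : HasDerivAt (fun t : ℝ => t * inner ℝ (gradient f x) d + b / 2 * t ^ 2 * ‖d‖ ^ 2)
        (inner ℝ (gradient f x) d + b * t * ‖d‖ ^ 2) t := by
      have := ((hasDerivAt_id t).mul_const (inner ℝ (gradient f x) d)).add
        ((((hasDerivAt_id t).pow 2).const_mul (b / 2)).mul_const (‖d‖ ^ 2))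
      refine this.congr_deriv ?_
      simp only [id]; push_cast; ring
    exact h2.sub h3
  have hanti : AntitoneOn φ (Set.Icc 0 1) := by
    refine antitoneOn_of_deriv_nonpos (convex_Icc 0 1)
      (fun t _ => (hder t).continuousAt.continuousWithinAt)
      (fun t _ => (hder t).differentiableAt.differentiableWithinAt) fun t ht => ?_
    rw [interior_Icc] at ht
    rw [(hder t).deriv]
    have h1 : inner ℝ (gradient f (x + t • d) - gradient f x) d ≤ b * t * ‖d‖ ^ 2 := by
      calc _ ≤ ‖gradient f (x + t • d) - gradient f x‖ * ‖d‖ := real_inner_le_norm _ _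
        _ ≤ (b * ‖x + t • d - x‖) * ‖d‖ := by gcongr; exact h _ _
        _ = _ := by
          rw [add_sub_cancel_left, norm_smul, Real.norm_of_nonneg ht.1.le]; ring
    rw [inner_sub_left] at h1
    linarith
  have := hanti (Set.left_mem_Icc.2 zero_le_one) (Set.right_mem_Icc.2 zero_le_one) zero_le_one
  simp only [hφ, one_smul, zero_smul, add_zero] at this
  linarith

end Calculus

end DifMAML

/-! ### Task risks and batch losses: regularity inherited from the data. -/

namespace DifMAML

theorem norm_avg_sub_avg_le {E : Type*} [SeminormedAddCommGroup E] [NormedSpace ℝ E] {n : ℕ}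
    (a b : Fin n → E) : ‖(1 / (n : ℝ)) • ∑ i, a i - (1 / (n : ℝ)) • ∑ i, b i‖
      ≤ (1 / (n : ℝ)) * ∑ i, ‖a i - b i‖ := by
  rw [← smul_sub, ← Finset.sum_sub_distrib, norm_smul, Real.norm_of_nonneg (by positivity)]
  gcongr
  exact norm_sum_le _ _

namespace Network

section Agent

variable {K M : ℕ} {T X : Fin K → Type*}
  [∀ k, MeasurableSpace (T k)] [∀ k, MeasurableSpace (X k)] (N : Network K M T X)
  {c : Constants} {k : Fin K} {n : ℕ}

/-- The gradient of the loss in the model. -/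
noncomputable abbrev lossGrad (k : Fin K) (t : T k) (w : Model M) (x : X k) : Model M :=
  gradient (fun v => N.loss k t v x) w

/-- The Hessian of the loss in the model. -/
noncomputable abbrev lossHess (k : Fin K) (t : T k) (w : Model M) (x : X k) :
    Model M →L[ℝ] Model M :=
  hessian (fun v => N.loss k t v x) w

/-- The gradient of the risk of a task. -/
noncomputable abbrev taskGrad (k : Fin K) (t : T k) (w : Model M) : Model M :=
  gradient (N.taskRisk k t) w

/-- The Hessian of the risk of a task. -/
noncomputable abbrev taskHess (k : Fin K) (t : T k) (w : Model M) : Model M →L[ℝ] Model M :=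
  hessian (N.taskRisk k t) w

/-- The gradient of the loss of a batch. -/
noncomputable abbrev batchGrad (k : Fin K) (t : T k) (w : Model M) (x : Fin n → X k) : Model M :=
  gradient (N.batchLoss k t x) w

/-- The Hessian of the loss of a batch. -/
noncomputable abbrev batchHess (k : Fin K) (t : T k) (w : Model M) (x : Fin n → X k) :
    Model M →L[ℝ] Model M :=
  hessian (N.batchLoss k t x) w

variable {N} (hN : N.Assumptions c)
include hN

theorem Assumptions.measurable_loss : Measurable (Function.uncurry fun (p : T k × X k) w =>
    N.loss k p.1 w p.2) := by
  have h := measurable_uncurry_of_continuous_of_measurable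
    (u := fun (w : Model M) (p : T k × X k) => N.loss k p.1 w p.2)
    (fun p => (hN.regular.differentiable k p.1 p.2).continuous) (fun w => hN.regular.measurable k w)
  exact h.comp measurable_swap

theorem Assumptions.measurable_lossGrad : Measurable fun p : (T k × X k) × Model M =>
    N.lossGrad k p.1.1 p.2 p.1.2 :=
  measurable_gradient_param hN.measurable_loss fun p => hN.regular.differentiable k p.1 p.2

theorem Assumptions.measurable_lossHess : Measurable fun p : (T k × X k) × Model M =>
    N.lossHess k p.1.1 p.2 p.1.2 :=
  measurable_hessian_param hN.measurable_loss (fun p => hN.regular.differentiable k p.1 p.2)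
    fun p => hN.regular.differentiable_gradient k p.1 p.2

theorem Assumptions.measurable_lossGrad_right (t : T k) (w : Model M) :
    Measurable fun x => N.lossGrad k t w x :=
  hN.measurable_lossGrad.comp ((measurable_const.prodMk measurable_id).prodMk measurable_const)

theorem Assumptions.measurable_lossHess_right (t : T k) (w : Model M) :
    Measurable fun x => N.lossHess k t w x :=
  hN.measurable_lossHess.comp ((measurable_const.prodMk measurable_id).prodMk measurable_const)

/-- A nonnegative Lipschitz constant of the gradient of the loss. -/
noncomputable def Assumptions.lip (k : Fin K) (t : T k) (x : X k) : ℝ :=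
  |Classical.choose (hN.lipschitzGradients k) t x|

theorem Assumptions.measurable_lip : Measurable fun p : T k × X k => hN.lip k p.1 p.2 :=
  (Classical.choose_spec (hN.lipschitzGradients k)).1.abs

theorem Assumptions.lip_nonneg (t : T k) (x : X k) : 0 ≤ hN.lip k t x := abs_nonneg _

theorem Assumptions.lossGrad_sub_le (t : T k) (x : X k) (w u : Model M) :
    ‖N.lossGrad k t w x - N.lossGrad k t u x‖ ≤ hN.lip k t x * ‖w - u‖ :=
  ((Classical.choose_spec (hN.lipschitzGradients k)).2.1 t x w u).trans
    (mul_le_mul_of_nonneg_right (le_abs_self _) (norm_nonneg _))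

theorem Assumptions.measurable_lip_right (t : T k) : Measurable fun x => hN.lip k t x :=
  hN.measurable_lip.comp (measurable_const.prodMk measurable_id)

theorem Assumptions.lip_sq (t : T k) :
    MeanLE (N.dataLaw k t) (fun x => hN.lip k t x ^ 2) (c.L ^ 2) :=
  ((Classical.choose_spec (hN.lipschitzGradients k)).2.2 t).congr fun _ => sq_abs _

theorem Assumptions.lip_mean (t : T k) : MeanLE (N.dataLaw k t) (fun x => hN.lip k t x) c.L :=
  (hN.lip_sq t).of_sq c.L_nonneg (hN.measurable_lip_right t).aestronglyMeasurable

theorem Assumptions.norm_lossHess_le (t : T k) (x : X k) (w : Model M) :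
    ‖N.lossHess k t w x‖ ≤ hN.lip k t x :=
  norm_fderiv_le_of_lip' ℝ (hN.lip_nonneg t x)
    (Filter.Eventually.of_forall fun u => hN.lossGrad_sub_le t x u w)

theorem Assumptions.integrable_lossGrad (t : T k) (w : Model M) :
    Integrable (fun x => N.lossGrad k t w x) (N.dataLaw k t) :=
  (hN.boundedGradients k t w).integrable_of_norm
    (hN.measurable_lossGrad_right t w).aestronglyMeasurable

theorem Assumptions.integrable_lossHess (t : T k) (w : Model M) :
    Integrable (fun x => N.lossHess k t w x) (N.dataLaw k t) :=
  (hN.lip_mean t).1.mono' (hN.measurable_lossHess_right t w).aestronglyMeasurable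
    (Filter.Eventually.of_forall fun x => hN.norm_lossHess_le t x w)

theorem Assumptions.hasGradientAt_taskRisk (t : T k) (w : Model M) :
    HasGradientAt (N.taskRisk k t) (∫ x, N.lossGrad k t w x ∂N.dataLaw k t) w := by
  refine (hasGradientAt_integral (f := fun x v => N.loss k t v x)
    (b := fun x => ‖N.lossGrad k t w x‖ + hN.lip k t x)
    (fun u => (hN.regular.integrable_loss k t u).1)
    (hN.regular.integrable_loss k t w) (hN.integrable_lossGrad t w).1
    (fun x => hN.regular.differentiable k t x) (fun x u hu => ?_)
    ((hN.boundedGradients k t w).1.add (hN.lip_mean t).1)).2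
  have h1 := hN.lossGrad_sub_le t x u w
  have h2 : ‖u - w‖ ≤ 1 := (mem_ball_iff_norm.1 hu).le
  have h3 := mul_le_mul_of_nonneg_left h2 (hN.lip_nonneg t x)
  have h4 := norm_le_norm_add_norm_sub' (N.lossGrad k t u x) (N.lossGrad k t w x)
  linarith

theorem Assumptions.differentiable_taskRisk (t : T k) : Differentiable ℝ (N.taskRisk k t) :=
  fun w => (hN.hasGradientAt_taskRisk t w).differentiableAt

theorem Assumptions.taskGrad_eq (t : T k) (w : Model M) :
    N.taskGrad k t w = ∫ x, N.lossGrad k t w x ∂N.dataLaw k t :=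
  (hN.hasGradientAt_taskRisk t w).gradient

theorem Assumptions.norm_taskGrad_le (t : T k) (w : Model M) : ‖N.taskGrad k t w‖ ≤ c.B := by
  rw [hN.taskGrad_eq]
  exact (hN.boundedGradients k t w).norm_integral_le

theorem Assumptions.taskGrad_sub_le (t : T k) (w u : Model M) :
    ‖N.taskGrad k t w - N.taskGrad k t u‖ ≤ c.L * ‖w - u‖ := by
  rw [hN.taskGrad_eq, hN.taskGrad_eq, ← integral_sub (hN.integrable_lossGrad t w)
    (hN.integrable_lossGrad t u)]
  refine MeanLE.norm_integral_le (MeanLE.mono (g := fun x => ‖w - u‖ * hN.lip k t x) ?_ ?_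
    (fun x => norm_nonneg _) fun x => (hN.lossGrad_sub_le t x w u).trans_eq (mul_comm _ _))
  · rw [mul_comm]
    exact (hN.lip_mean t).const_mul (norm_nonneg _)
  · exact ((hN.integrable_lossGrad t w).sub (hN.integrable_lossGrad t u)).1.norm

theorem Assumptions.hasFDerivAt_taskGrad (t : T k) (w : Model M) :
    HasFDerivAt (gradient (N.taskRisk k t)) (∫ x, N.lossHess k t w x ∂N.dataLaw k t) w := by
  have e : gradient (N.taskRisk k t) = fun w => ∫ x, N.lossGrad k t w x ∂N.dataLaw k t :=
    funext fun w => hN.taskGrad_eq t w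
  rw [e]
  exact hasFDerivAt_integral_of_dominated_of_fderiv_le (𝕜 := ℝ) (s := Set.univ)
    (F' := fun u x => N.lossHess k t u x) (bound := fun x => hN.lip k t x)
    Filter.univ_mem (Filter.Eventually.of_forall fun u => (hN.integrable_lossGrad t u).1)
    (hN.integrable_lossGrad t w) (hN.integrable_lossHess t w).1
    (Filter.Eventually.of_forall fun x u _ => hN.norm_lossHess_le t x u) (hN.lip_mean t).1
    (Filter.Eventually.of_forall fun x u _ =>
      (hN.regular.differentiable_gradient k t x u).hasFDerivAt)

theorem Assumptions.differentiable_taskGrad (t : T k) :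
    Differentiable ℝ (gradient (N.taskRisk k t)) :=
  fun w => (hN.hasFDerivAt_taskGrad t w).differentiableAt

theorem Assumptions.taskHess_eq (t : T k) (w : Model M) :
    N.taskHess k t w = ∫ x, N.lossHess k t w x ∂N.dataLaw k t :=
  (hN.hasFDerivAt_taskGrad t w).fderiv

theorem Assumptions.norm_taskHess_le (t : T k) (w : Model M) : ‖N.taskHess k t w‖ ≤ c.L :=
  norm_fderiv_le_of_lip' ℝ c.L_nonneg
    (Filter.Eventually.of_forall fun u => hN.taskGrad_sub_le t u w)

theorem Assumptions.measurable_taskRisk :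
    Measurable (Function.uncurry fun (t : T k) (w : Model M) => N.taskRisk k t w) := by
  refine (measurable_uncurry_of_continuous_of_measurable
    (u := fun (w : Model M) (t : T k) => N.taskRisk k t w)
    (fun t => (hN.differentiable_taskRisk t).continuous) fun w => ?_).comp measurable_swap
  exact (StronglyMeasurable.integral_kernel_prod_right (κ := N.dataLaw k)
    (f := fun t x => N.loss k t w x) (hN.regular.measurable k w).stronglyMeasurable).measurable

theorem Assumptions.measurable_taskGrad :
    Measurable fun p : T k × Model M => N.taskGrad k p.1 p.2 :=
  measurable_gradient_param hN.measurable_taskRisk fun t => hN.differentiable_taskRisk t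

theorem Assumptions.measurable_taskHess :
    Measurable fun p : T k × Model M => N.taskHess k p.1 p.2 :=
  measurable_hessian_param hN.measurable_taskRisk (fun t => hN.differentiable_taskRisk t)
    fun t => hN.differentiable_taskGrad t

/-- The mean of `B`-Lipschitz risks is `B`-Lipschitz, which bounds its gradient without showing that
it is differentiable. -/
theorem Assumptions.norm_gradient_meanRisk_le (w : Model M) :
    ‖gradient (N.meanRisk k) w‖ ≤ c.B := by
  refine norm_gradient_le c.B_nonneg (fun u v => ?_) w
  rw [meanRisk, meanRisk, ← integral_sub (hN.regular.integrable_taskRisk k u)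
    (hN.regular.integrable_taskRisk k v)]
  refine MeanLE.norm_integral_le (MeanLE.mono (MeanLE.const (c.B * ‖u - v‖))
    ((hN.regular.integrable_taskRisk k u).sub (hN.regular.integrable_taskRisk k v)).1.norm
    (fun t => norm_nonneg _) fun t => ?_)
  exact norm_sub_le_of_gradient (hN.differentiable_taskRisk t) (hN.norm_taskGrad_le t) u v

/-! ### Batches -/

theorem Assumptions.hasGradientAt_batchLoss (t : T k) (w : Model M) (x : Fin n → X k) :
    HasGradientAt (N.batchLoss k t x) ((1 / (n : ℝ)) • ∑ i, N.lossGrad k t w (x i)) w := by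
  rw [hasGradientAt_iff_hasFDerivAt]
  have h := (HasFDerivAt.fun_sum (u := Finset.univ) fun i _ =>
    (hN.regular.differentiable k t (x i) w).hasGradientAt.hasFDerivAt).const_mul (1 / (n : ℝ))
  refine h.congr_fderiv ?_
  simp only [toDual_eq_innerBilin, map_smul, map_sum]

theorem Assumptions.differentiable_batchLoss (t : T k) (x : Fin n → X k) :
    Differentiable ℝ (N.batchLoss k t x) :=
  fun w => (hN.hasGradientAt_batchLoss t w x).differentiableAt

theorem Assumptions.batchGrad_eq (t : T k) (w : Model M) (x : Fin n → X k) :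
    N.batchGrad k t w x = (1 / (n : ℝ)) • ∑ i, N.lossGrad k t w (x i) :=
  (hN.hasGradientAt_batchLoss t w x).gradient

theorem Assumptions.hasFDerivAt_batchGrad (t : T k) (w : Model M) (x : Fin n → X k) :
    HasFDerivAt (gradient (N.batchLoss k t x))
      ((1 / (n : ℝ)) • ∑ i, N.lossHess k t w (x i)) w := by
  have e : gradient (N.batchLoss k t x) = fun w => (1 / (n : ℝ)) • ∑ i, N.lossGrad k t w (x i) :=
    funext fun w => hN.batchGrad_eq t w x
  rw [e]
  exact (HasFDerivAt.fun_sum (u := Finset.univ) fun i _ =>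
    (hN.regular.differentiable_gradient k t (x i) w).hasFDerivAt).const_smul (1 / (n : ℝ))

theorem Assumptions.differentiable_batchGrad (t : T k) (x : Fin n → X k) :
    Differentiable ℝ (gradient (N.batchLoss k t x)) :=
  fun w => (hN.hasFDerivAt_batchGrad t w x).differentiableAt

theorem Assumptions.batchHess_eq (t : T k) (w : Model M) (x : Fin n → X k) :
    N.batchHess k t w x = (1 / (n : ℝ)) • ∑ i, N.lossHess k t w (x i) :=
  (hN.hasFDerivAt_batchGrad t w x).fderiv

theorem Assumptions.measurable_batchGrad : Measurable fun p : (T k × (Fin n → X k)) × Model M =>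
    N.batchGrad k p.1.1 p.2 p.1.2 := by
  simp only [hN.batchGrad_eq]
  refine (Finset.measurable_sum _ fun i _ => ?_).const_smul (1 / (n : ℝ))
  exact hN.measurable_lossGrad.comp (f := fun p : (T k × (Fin n → X k)) × Model M =>
    ((p.1.1, p.1.2 i), p.2)) (by fun_prop)

theorem Assumptions.measurable_batchHess : Measurable fun p : (T k × (Fin n → X k)) × Model M =>
    N.batchHess k p.1.1 p.2 p.1.2 := by
  simp only [hN.batchHess_eq]
  refine (Finset.measurable_sum _ fun i _ => ?_).const_smul (1 / (n : ℝ))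
  exact hN.measurable_lossHess.comp (f := fun p : (T k × (Fin n → X k)) × Model M =>
    ((p.1.1, p.1.2 i), p.2)) (by fun_prop)

/-- The Lipschitz constant of the gradient of the loss of a batch. -/
noncomputable def Assumptions.batchLip (k : Fin K) (t : T k) (x : Fin n → X k) : ℝ :=
  (1 / (n : ℝ)) * ∑ i, hN.lip k t (x i)

theorem Assumptions.measurable_batchLip :
    Measurable fun p : T k × (Fin n → X k) => hN.batchLip k p.1 p.2 := by
  refine (Finset.measurable_sum _ fun i _ => ?_).const_mul (1 / (n : ℝ))
  exact hN.measurable_lip.comp (f := fun p : T k × (Fin n → X k) => (p.1, p.2 i)) (by fun_prop)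

theorem Assumptions.batchLip_nonneg (t : T k) (x : Fin n → X k) : 0 ≤ hN.batchLip k t x :=
  mul_nonneg (by positivity) (Finset.sum_nonneg fun i _ => hN.lip_nonneg t _)

theorem Assumptions.batchGrad_sub_le (t : T k) (x : Fin n → X k) (w u : Model M) :
    ‖N.batchGrad k t w x - N.batchGrad k t u x‖ ≤ hN.batchLip k t x * ‖w - u‖ := by
  rw [hN.batchGrad_eq, hN.batchGrad_eq, ← smul_sub, ← Finset.sum_sub_distrib, norm_smul, batchLip,
    Real.norm_of_nonneg (by positivity), mul_assoc, Finset.sum_mul]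
  gcongr
  exact (norm_sum_le _ _).trans (Finset.sum_le_sum fun i _ => hN.lossGrad_sub_le t _ w u)

theorem Assumptions.norm_batchHess_le (t : T k) (x : Fin n → X k) (w : Model M) :
    ‖N.batchHess k t w x‖ ≤ hN.batchLip k t x :=
  norm_fderiv_le_of_lip' ℝ (hN.batchLip_nonneg t x)
    (Filter.Eventually.of_forall fun u => hN.batchGrad_sub_le t x u w)

theorem Assumptions.batchHess_sub_le (t : T k) (x : Fin n → X k) (w u : Model M) :
    ‖N.batchHess k t w x - N.batchHess k t u x‖
      ≤ (1 / (n : ℝ)) * ∑ i, ‖N.lossHess k t w (x i) - N.lossHess k t u (x i)‖ := by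
  rw [hN.batchHess_eq, hN.batchHess_eq]
  exact norm_avg_sub_avg_le _ _

theorem Assumptions.norm_batchGrad_le (t : T k) (x : Fin n → X k) (w : Model M) :
    ‖N.batchGrad k t w x‖ ≤ (1 / (n : ℝ)) * ∑ i, ‖N.lossGrad k t w (x i)‖ := by
  rw [hN.batchGrad_eq, norm_smul, Real.norm_of_nonneg (by positivity)]
  gcongr
  exact norm_sum_le _ _

theorem Assumptions.batchLip_mean (t : T k) (hn : 0 < n) :
    MeanLE (iidKernel (N.dataLaw k) n t) (fun x => hN.batchLip k t x) c.L :=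
  (hN.lip_mean t).avg hn

theorem Assumptions.batchLip_sq (t : T k) (hn : 0 < n) :
    MeanLE (iidKernel (N.dataLaw k) n t) (fun x => hN.batchLip k t x ^ 2) (c.L ^ 2) :=
  ((hN.lip_sq t).avg hn).mono
    ((hN.measurable_batchLip.comp (measurable_const.prodMk measurable_id)).pow_const 2
      |>.aestronglyMeasurable) (fun _ => sq_nonneg _) fun _ => sq_avg_le _ hn

/-- Expanding the square uses the mean and the second moment of the batch Lipschitz constant. These
are at most `L` and `L ^ 2`, so the random factor behaves as if it were `L`. -/
theorem Assumptions.one_add_batchLip_sq (t : T k) (hn : 0 < n) :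
    MeanLE (iidKernel (N.dataLaw k) n t) (fun x => (1 + N.α * hN.batchLip k t x) ^ 2)
      ((1 + N.α * c.L) ^ 2) := by
  have h := ((MeanLE.const (ν := iidKernel (N.dataLaw k) n t) 1).add
    ((hN.batchLip_mean t hn).const_mul (r := 2 * N.α) (by linarith [N.α_pos]))).add
    ((hN.batchLip_sq t hn).const_mul (r := N.α ^ 2) (sq_nonneg _))
  exact (h.congr fun x => by ring).of_le (le_of_eq (by ring))

end Agent

end Network

end DifMAML

/-! ### Gradients of the two objectives, and their distance. -/

namespace DifMAML

theorem integrable_integral_compProd {A B E : Type*} [MeasurableSpace A] [MeasurableSpace B]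
    [NormedAddCommGroup E] [NormedSpace ℝ E] {τ : Measure A} [SFinite τ] {κ : Kernel A B}
    [IsSFiniteKernel κ] {f : A × B → E} (hf : Integrable f (τ.compProd κ)) :
    Integrable (fun t => ∫ x, f (t, x) ∂κ t) τ :=
  Integrable.integral_compProd (κ := Kernel.const Unit τ) (η := Kernel.prodMkLeft Unit κ)
    (a := ()) hf

namespace Network

section Objectives

variable {K M : ℕ} {T X : Fin K → Type*}
  [∀ k, MeasurableSpace (T k)] [∀ k, MeasurableSpace (X k)] (N : Network K M T X)
  {c : Constants} {k : Fin K} {n : ℕ}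

/-- The law of a task with an inner batch. -/
noncomputable abbrev innerLaw (k : Fin K) : Measure (T k × (Fin N.nIn → X k)) :=
  (N.taskLaw k).compProd (iidKernel (N.dataLaw k) N.nIn)

/-- The operator `I - α ∇²Q(w; 𝒳)`. -/
noncomputable abbrev batchOp (k : Fin K) (t : T k) (w : Model M) (x : Fin n → X k) :
    Model M →L[ℝ] Model M :=
  ContinuousLinearMap.id ℝ (Model M) - N.α • N.batchHess k t w x

/-- The operator `I - α ∇²J(w)`. -/
noncomputable abbrev taskOp (k : Fin K) (t : T k) (w : Model M) : Model M →L[ℝ] Model M :=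
  ContinuousLinearMap.id ℝ (Model M) - N.α • N.taskHess k t w

/-- A stochastic inner step. -/
noncomputable abbrev batchStep (k : Fin K) (t : T k) (w : Model M) (x : Fin n → X k) : Model M :=
  w - N.α • N.batchGrad k t w x

/-- An exact inner step. -/
noncomputable abbrev taskStep (k : Fin K) (t : T k) (w : Model M) : Model M :=
  w - N.α • N.taskGrad k t w

/-- The gradient of the risk after a stochastic inner step. -/
noncomputable abbrev innerGrad (k : Fin K) (w : Model M) (p : T k × (Fin N.nIn → X k)) : Model M :=
  N.batchOp k p.1 w p.2 (N.taskGrad k p.1 (N.batchStep k p.1 w p.2))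

/-- The gradient of the risk after an exact inner step. -/
noncomputable abbrev exactGrad (k : Fin K) (w : Model M) (t : T k) : Model M :=
  N.taskOp k t w (N.taskGrad k t (N.taskStep k t w))

variable {N}

theorem meanLE_innerLaw {f : T k × (Fin N.nIn → X k) → ℝ} {r : ℝ}
    (mf : Measurable f) (hf0 : ∀ p, 0 ≤ f p)
    (h : ∀ t, MeanLE (iidKernel (N.dataLaw k) N.nIn t) (fun x => f (t, x)) r) :
    MeanLE (N.innerLaw k) f r :=
  MeanLE.compProd mf hf0 h (MeanLE.const r)

variable (hN : N.Assumptions c)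
include hN

theorem Assumptions.norm_batchOp_le (t : T k) (w : Model M) (x : Fin n → X k) :
    ‖N.batchOp k t w x‖ ≤ 1 + N.α * hN.batchLip k t x := by
  refine (norm_sub_le _ _).trans (add_le_add ContinuousLinearMap.norm_id_le ?_)
  rw [norm_smul, Real.norm_of_nonneg N.α_pos.le]
  exact mul_le_mul_of_nonneg_left (hN.norm_batchHess_le t x w) N.α_pos.le

theorem Assumptions.norm_taskOp_le (t : T k) (w : Model M) :
    ‖N.taskOp k t w‖ ≤ 1 + N.α * c.L := by
  refine (norm_sub_le _ _).trans (add_le_add ContinuousLinearMap.norm_id_le ?_)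
  rw [norm_smul, Real.norm_of_nonneg N.α_pos.le]
  exact mul_le_mul_of_nonneg_left (hN.norm_taskHess_le t w) N.α_pos.le

theorem Assumptions.measurable_batchStep : Measurable fun p : (T k × (Fin n → X k)) × Model M =>
    N.batchStep k p.1.1 p.2 p.1.2 :=
  measurable_snd.sub (hN.measurable_batchGrad.const_smul N.α)

theorem Assumptions.measurable_batchOp : Measurable fun p : (T k × (Fin n → X k)) × Model M =>
    N.batchOp k p.1.1 p.2 p.1.2 :=
  measurable_const.sub (hN.measurable_batchHess.const_smul N.α)

theorem Assumptions.measurable_taskStep :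
    Measurable fun p : T k × Model M => N.taskStep k p.1 p.2 :=
  measurable_snd.sub (hN.measurable_taskGrad.const_smul N.α)

theorem Assumptions.measurable_taskOp :
    Measurable fun p : T k × Model M => N.taskOp k p.1 p.2 :=
  measurable_const.sub (hN.measurable_taskHess.const_smul N.α)

theorem Assumptions.measurable_innerGrad :
    Measurable fun p : (T k × (Fin N.nIn → X k)) × Model M => N.innerGrad k p.2 p.1 :=
  isBoundedBilinearMap_apply.continuous.measurable.comp (hN.measurable_batchOp.prodMk
    (hN.measurable_taskGrad.comp (measurable_fst.fst.prodMk hN.measurable_batchStep)))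

theorem Assumptions.measurable_innerGrad_right (w : Model M) :
    Measurable fun p : T k × (Fin N.nIn → X k) => N.innerGrad k w p :=
  hN.measurable_innerGrad.comp (f := fun p : T k × (Fin N.nIn → X k) => (p, w)) (by fun_prop)

theorem Assumptions.measurable_exactGrad :
    Measurable fun p : T k × Model M => N.exactGrad k p.2 p.1 :=
  isBoundedBilinearMap_apply.continuous.measurable.comp (hN.measurable_taskOp.prodMk
    (hN.measurable_taskGrad.comp (measurable_fst.prodMk hN.measurable_taskStep)))

theorem Assumptions.norm_innerGrad_le (w : Model M) (p : T k × (Fin N.nIn → X k)) :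
    ‖N.innerGrad k w p‖ ≤ (1 + N.α * hN.batchLip k p.1 p.2) * c.B :=
  (N.batchOp k p.1 w p.2).le_of_opNorm_le_of_le (hN.norm_batchOp_le _ _ _)
    (hN.norm_taskGrad_le _ _)

theorem Assumptions.norm_exactGrad_le (w : Model M) (t : T k) :
    ‖N.exactGrad k w t‖ ≤ (1 + N.α * c.L) * c.B :=
  (N.taskOp k t w).le_of_opNorm_le_of_le (hN.norm_taskOp_le _ _) (hN.norm_taskGrad_le _ _)

theorem Assumptions.norm_innerGrad_mean (w : Model M) :
    MeanLE (N.innerLaw k) (fun p => ‖N.innerGrad k w p‖) ((1 + N.α * c.L) * c.B) := by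
  refine meanLE_innerLaw (hN.measurable_innerGrad_right w).norm (fun p => norm_nonneg _) fun t => ?_
  refine MeanLE.mono ?_ (hN.measurable_innerGrad.comp (f := fun x => ((t, x), w))
    (by fun_prop)).norm.aestronglyMeasurable (fun _ => norm_nonneg _) fun x =>
      hN.norm_innerGrad_le w (t, x)
  exact ((((MeanLE.const 1).add ((hN.batchLip_mean t N.nIn_pos).const_mul N.α_pos.le)).const_mul
    c.B_nonneg).congr fun x => mul_comm _ _).of_le (mul_comm _ _).le

theorem Assumptions.measurable_innerRisk :
    Measurable fun p : (T k × (Fin n → X k)) × Model M =>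
      N.taskRisk k p.1.1 (N.batchStep k p.1.1 p.2 p.1.2) :=
  hN.measurable_taskRisk.comp (measurable_fst.fst.prodMk hN.measurable_batchStep)

/-- Task risks are `B`-Lipschitz, so the risk after an inner step is integrable whenever the risk
and the step are. -/
theorem Assumptions.abs_taskRisk_sub_le (t : T k) (w v : Model M) :
    |N.taskRisk k t (w - N.α • v)| ≤ |N.taskRisk k t w| + N.α * c.B * ‖v‖ := by
  have h := norm_sub_le_of_gradient (hN.differentiable_taskRisk t) (hN.norm_taskGrad_le t)
    (w - N.α • v) w
  rw [sub_sub_cancel_left, norm_neg, norm_smul, Real.norm_of_nonneg N.α_pos.le,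
    Real.norm_eq_abs] at h
  have := abs_sub_abs_le_abs_sub (N.taskRisk k t (w - N.α • v)) (N.taskRisk k t w)
  linarith

theorem Assumptions.integrable_innerRisk (w : Model M) :
    Integrable (fun p : T k × (Fin N.nIn → X k) =>
      N.taskRisk k p.1 (N.batchStep k p.1 w p.2)) (N.innerLaw k) := by
  have hm : Measurable (fun p : T k × (Fin N.nIn → X k) =>
      N.taskRisk k p.1 (N.batchStep k p.1 w p.2)) :=
    hN.measurable_innerRisk.comp (measurable_id.prodMk measurable_const)
  have h1 : MeanLE (N.taskLaw k) (fun t => |N.taskRisk k t w| + N.α * c.B * c.B)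
      (∫ t, |N.taskRisk k t w| ∂N.taskLaw k + N.α * c.B * c.B) :=
    MeanLE.add ⟨(hN.regular.integrable_taskRisk k w).abs, le_rfl⟩ (MeanLE.const _)
  refine (MeanLE.compProd hm.norm (fun _ => norm_nonneg _) (fun t => ?_)
    h1).integrable_of_norm hm.aestronglyMeasurable
  refine MeanLE.mono (((MeanLE.const _).add
    (((hN.boundedGradients k t w).avg N.nIn_pos).const_mul
    (mul_nonneg N.α_pos.le c.B_nonneg)))) ?_ (fun _ => norm_nonneg _) fun x =>
      (hN.abs_taskRisk_sub_le t w _).trans ?_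
  · exact (hm.comp measurable_prodMk_left).norm.aestronglyMeasurable
  · gcongr
    · exact mul_nonneg N.α_pos.le c.B_nonneg
    · exact hN.norm_batchGrad_le t x w

/-- The gradient after the inner step is bounded by `(1 + α * batchLip) * B` for every model. This
integrable bound allows differentiation under the joint law of task and inner batch. -/
theorem Assumptions.hasGradientAt_adjustedRisk (w : Model M) :
    HasGradientAt (N.adjustedRisk k) (∫ p, N.innerGrad k w p ∂N.innerLaw k) w := by
  have hg : ∀ (p : T k × (Fin N.nIn → X k)) (u : Model M),
      HasGradientAt (fun v => N.taskRisk k p.1 (N.batchStep k p.1 v p.2)) (N.innerGrad k u p) u :=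
    fun p u => hasGradientAt_step (hN.differentiable_taskRisk p.1)
      (hN.differentiable_batchLoss p.1 p.2) (hN.differentiable_batchGrad p.1 p.2 u)
  have h := hasGradientAt_integral (ν := N.innerLaw k) (w := w)
    (f := fun p v => N.taskRisk k p.1 (N.batchStep k p.1 v p.2))
    (b := fun p => (1 + N.α * hN.batchLip k p.1 p.2) * c.B)
    (fun u => (hN.integrable_innerRisk u).1) (hN.integrable_innerRisk w)
    (by
      simp only [fun p => (hg p w).gradient]
      exact (hN.measurable_innerGrad_right w).aestronglyMeasurable)
    (fun p u => (hg p u).differentiableAt)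
    (fun p u _ => by rw [(hg p u).gradient]; exact hN.norm_innerGrad_le u p)
    (((integrable_const 1).add ((meanLE_innerLaw hN.measurable_batchLip
      (fun p => hN.batchLip_nonneg p.1 p.2)
      fun t => hN.batchLip_mean t N.nIn_pos).1.const_mul N.α)).mul_const c.B)
  have e : N.adjustedRisk k = fun u => ∫ p : T k × (Fin N.nIn → X k),
      N.taskRisk k p.1 (N.batchStep k p.1 u p.2) ∂N.innerLaw k := by
    funext u
    rw [Measure.integral_compProd (hN.integrable_innerRisk u)]
    rfl
  rw [e]
  have e2 : (fun p : T k × (Fin N.nIn → X k) => gradient (fun v => N.taskRisk k p.1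
      (N.batchStep k p.1 v p.2)) w) = N.innerGrad k w := funext fun p => (hg p w).gradient
  rw [e2] at h
  exact h.2

theorem Assumptions.integrable_innerGrad (w : Model M) :
    Integrable (N.innerGrad k w) (N.innerLaw k) :=
  (hN.norm_innerGrad_mean w).integrable_of_norm (hN.measurable_innerGrad_right w).aestronglyMeasurable

theorem Assumptions.gradient_adjustedRisk (w : Model M) :
    gradient (N.adjustedRisk k) w = ∫ p, N.innerGrad k w p ∂N.innerLaw k :=
  (hN.hasGradientAt_adjustedRisk w).gradient

theorem Assumptions.norm_gradient_adjustedRisk_le (w : Model M) :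
    ‖gradient (N.adjustedRisk k) w‖ ≤ (1 + N.α * c.L) * c.B := by
  rw [hN.gradient_adjustedRisk]
  exact (hN.norm_innerGrad_mean w).norm_integral_le

/-- The gradient is changed first, under the operator at `w`, and then the operator, acting on a
vector of norm at most `B`. The operator and the inner step each contribute a factor `1 + α *
batchLip`, hence the square: a second moment of the Lipschitz constant is enough. -/
theorem Assumptions.innerGrad_sub_le (w u : Model M) (p : T k × (Fin N.nIn → X k)) :
    ‖N.innerGrad k w p - N.innerGrad k u p‖ ≤
      c.L * ‖w - u‖ * (1 + N.α * hN.batchLip k p.1 p.2) ^ 2 + N.α * c.B *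
        ((1 / (N.nIn : ℝ)) * ∑ i, ‖N.lossHess k p.1 w (p.2 i) - N.lossHess k p.1 u (p.2 i)‖) := by
  have e : N.innerGrad k w p - N.innerGrad k u p = N.batchOp k p.1 w p.2
      (N.taskGrad k p.1 (N.batchStep k p.1 w p.2) - N.taskGrad k p.1 (N.batchStep k p.1 u p.2))
      - N.α • (N.batchHess k p.1 w p.2 - N.batchHess k p.1 u p.2)
        (N.taskGrad k p.1 (N.batchStep k p.1 u p.2)) := by
    simp only [innerGrad, batchOp, sub_apply, smul_apply, map_sub, smul_sub]
    abel
  have hL := hN.batchLip_nonneg p.1 p.2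
  have hα := N.α_pos
  have h1 : ‖N.batchStep k p.1 w p.2 - N.batchStep k p.1 u p.2‖
      ≤ (1 + N.α * hN.batchLip k p.1 p.2) * ‖w - u‖ := by
    have : N.batchStep k p.1 w p.2 - N.batchStep k p.1 u p.2
        = (w - u) - N.α • (N.batchGrad k p.1 w p.2 - N.batchGrad k p.1 u p.2) := by
      simp only [batchStep, smul_sub]; abel
    rw [this]
    refine (norm_sub_le _ _).trans ?_
    rw [norm_smul, Real.norm_of_nonneg hα.le, add_mul, one_mul, mul_assoc]
    gcongr
    exact hN.batchGrad_sub_le _ _ _ _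
  rw [e]
  refine (norm_sub_le _ _).trans (add_le_add ?_ ?_)
  · refine ((N.batchOp k p.1 w p.2).le_of_opNorm_le_of_le (hN.norm_batchOp_le _ _ _)
      ((hN.taskGrad_sub_le _ _ _).trans (mul_le_mul_of_nonneg_left h1 c.L_nonneg))).trans
      (le_of_eq ?_)
    ring
  · rw [norm_smul, Real.norm_of_nonneg hα.le, mul_assoc]
    refine mul_le_mul_of_nonneg_left ?_ hα.le
    rw [mul_comm c.B]
    exact ContinuousLinearMap.le_of_opNorm_le_of_le _ (hN.batchHess_sub_le _ _ _ _)
      (hN.norm_taskGrad_le _ _)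

/-- The gradient of the adjusted risk is Lipschitz. -/
theorem Assumptions.gradient_adjustedRisk_sub_le (w u : Model M) :
    ‖gradient (N.adjustedRisk k) w - gradient (N.adjustedRisk k) u‖ ≤ N.Lhat c * ‖w - u‖ := by
  rw [hN.gradient_adjustedRisk, hN.gradient_adjustedRisk,
    ← integral_sub (hN.integrable_innerGrad w) (hN.integrable_innerGrad u)]
  have hm : Measurable fun p : T k × (Fin N.nIn → X k) =>
      N.innerGrad k w p - N.innerGrad k u p :=
    (hN.measurable_innerGrad_right w).sub (hN.measurable_innerGrad_right u)
  refine MeanLE.norm_integral_le (meanLE_innerLaw hm.norm (fun _ => norm_nonneg _)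
    fun t => ?_)
  have h1 := (hN.one_add_batchLip_sq t N.nIn_pos).const_mul
    (mul_nonneg c.L_nonneg (norm_nonneg (w - u)))
  have h2 : MeanLE (iidKernel (N.dataLaw k) N.nIn t) _ _ :=
    ((hN.lipschitzHessians k t w u).avg N.nIn_pos).const_mul (mul_nonneg N.α_pos.le c.B_nonneg)
  refine ((h1.add h2).mono (hm.comp measurable_prodMk_left).norm.aestronglyMeasurable
    (fun _ => norm_nonneg _) fun x => hN.innerGrad_sub_le w u (t, x)).of_le (le_of_eq ?_)
  rw [Lhat]; ring

/-! ### The exact objective -/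

theorem Assumptions.integrable_exactRisk (w : Model M) :
    Integrable (fun t => N.taskRisk k t (N.taskStep k t w)) (N.taskLaw k) := by
  refine ((hN.regular.integrable_taskRisk k w).abs.add
    (integrable_const (N.α * c.B * c.B))).mono' ?_ (Filter.Eventually.of_forall fun t => ?_)
  · exact (hN.measurable_taskRisk.comp (measurable_id.prodMk (hN.measurable_taskStep.comp
      (measurable_id.prodMk measurable_const)))).aestronglyMeasurable
  · refine (hN.abs_taskRisk_sub_le t w _).trans (add_le_add_right ?_ _)
    exact mul_le_mul_of_nonneg_left (hN.norm_taskGrad_le t w) (mul_nonneg N.α_pos.le c.B_nonneg)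

theorem Assumptions.integrable_exactGrad (w : Model M) :
    Integrable (N.exactGrad k w) (N.taskLaw k) :=
  (integrable_const ((1 + N.α * c.L) * c.B)).mono' (hN.measurable_exactGrad.comp
    (measurable_id.prodMk measurable_const)).aestronglyMeasurable
    (Filter.Eventually.of_forall fun t => hN.norm_exactGrad_le w t)

theorem Assumptions.hasGradientAt_mamlRisk (w : Model M) :
    HasGradientAt (N.mamlRisk k) (∫ t, N.exactGrad k w t ∂N.taskLaw k) w := by
  have hg : ∀ (t : T k) (u : Model M),
      HasGradientAt (fun v => N.taskRisk k t (N.taskStep k t v)) (N.exactGrad k u t) u :=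
    fun t u => hasGradientAt_step (hN.differentiable_taskRisk t)
      (hN.differentiable_taskRisk t) (hN.differentiable_taskGrad t u)
  have h := hasGradientAt_integral (ν := N.taskLaw k) (w := w)
    (f := fun t v => N.taskRisk k t (N.taskStep k t v))
    (b := fun t => (1 + N.α * c.L) * c.B)
    (fun u => (hN.integrable_exactRisk u).1) (hN.integrable_exactRisk w)
    (by
      simp only [fun t => (hg t w).gradient]
      exact (hN.integrable_exactGrad w).1)
    (fun t u => (hg t u).differentiableAt)
    (fun t u _ => by rw [(hg t u).gradient]; exact hN.norm_exactGrad_le u t)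
    (integrable_const _)
  have e2 : (fun t : T k => gradient (fun v => N.taskRisk k t
      (N.taskStep k t v)) w) = N.exactGrad k w := funext fun p => (hg p w).gradient
  rw [e2] at h
  exact h.2

/-! ### Moments of batch gradients -/

theorem Assumptions.batchGrad_var (t : T k) (w : Model M) (hn : 0 < n) :
    MeanLE (iidKernel (N.dataLaw k) n t) (fun x => ‖N.batchGrad k t w x - N.taskGrad k t w‖ ^ 2)
      (c.σG ^ 2 / n) := by
  simp only [hN.batchGrad_eq]
  refine MeanLE.avg_sq (hN.integrable_lossGrad t w) (hN.taskGrad_eq t w).symm ?_ hn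
  refine MeanLE.of_sq (((hN.boundedNoise k t w).1.congr fun x => by ring).of_le
    (le_of_eq (by ring))) (sq_nonneg _) ?_
  exact ((hN.integrable_lossGrad t w).sub (integrable_const _)).1.norm.pow 2

theorem Assumptions.batchGrad_fourth (t : T k) (w : Model M) (hn : 0 < n) :
    MeanLE (iidKernel (N.dataLaw k) n t) (fun x => ‖N.batchGrad k t w x - N.taskGrad k t w‖ ^ 4)
      (3 * c.σG ^ 4 / n ^ 2) := by
  simp only [hN.batchGrad_eq]
  refine (MeanLE.avg_fourth (sq_nonneg c.σG) (hN.integrable_lossGrad t w)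
    (hN.taskGrad_eq t w).symm ?_ hn).of_le (le_of_eq (by ring))
  exact (hN.boundedNoise k t w).1.of_le (le_of_eq (by ring))

theorem Assumptions.lossHess_apply_var (t : T k) (w v : Model M) :
    MeanLE (N.dataLaw k t) (fun x => ‖N.lossHess k t w x v - N.taskHess k t w v‖ ^ 2)
      (c.σH ^ 2 * ‖v‖ ^ 2) := by
  have hi := (hN.integrable_lossHess t w).apply_continuousLinearMap v
  have h2 : MeanLE (N.dataLaw k t) (fun x => ‖N.lossHess k t w x - N.taskHess k t w‖ ^ 2)
      (c.σH ^ 2) := by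
    refine MeanLE.of_sq (((hN.boundedNoise k t w).2.congr fun x => by ring).of_le
      (le_of_eq (by ring))) (sq_nonneg _) ?_
    exact ((hN.integrable_lossHess t w).sub (integrable_const _)).1.norm.pow 2
  have h3 := h2.const_mul (sq_nonneg ‖v‖)
  rw [mul_comm]
  refine h3.mono ((hi.sub (integrable_const _)).1.norm.pow 2) (fun _ => sq_nonneg _) fun x => ?_
  rw [← mul_pow, mul_comm, ← sub_apply]
  gcongr
  exact ContinuousLinearMap.le_opNorm _ _

/-- The gain `1 / n` rests on orthogonality of independent centered vectors. The operator norm has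
no inner product behind it, so the Hessians are applied to a fixed vector. -/
theorem Assumptions.batchHess_apply_var (t : T k) (w v : Model M) (hn : 0 < n) :
    MeanLE (iidKernel (N.dataLaw k) n t)
      (fun x => ‖(N.batchHess k t w x - N.taskHess k t w) v‖ ^ 2)
      (c.σH ^ 2 * ‖v‖ ^ 2 / n) := by
  have hi := (hN.integrable_lossHess t w).apply_continuousLinearMap v
  have e : ∀ x : Fin n → X k, (N.batchHess k t w x - N.taskHess k t w) v
      = (1 / (n : ℝ)) • ∑ i, N.lossHess k t w (x i) v - N.taskHess k t w v := by
    intro x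
    rw [hN.batchHess_eq]
    simp only [sub_apply, smul_apply, sum_apply]
  have hm : ∫ x, N.lossHess k t w x v ∂N.dataLaw k t = N.taskHess k t w v := by
    rw [hN.taskHess_eq, ContinuousLinearMap.integral_apply (hN.integrable_lossHess t w)]
  have h := MeanLE.avg_sq (F := fun x => N.lossHess k t w x v) hi hm
    (hN.lossHess_apply_var t w v) hn
  exact h.congr fun x => by rw [e]

theorem Assumptions.integrable_batchHess (t : T k) (w : Model M) (hn : 0 < n) :
    Integrable (fun x => N.batchHess k t w x) (iidKernel (N.dataLaw k) n t) :=
  (hN.batchLip_mean t hn).1.mono' (hN.measurable_batchHess.comp (f := fun x => ((t, x), w))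
    (by fun_prop)).aestronglyMeasurable
    (Filter.Eventually.of_forall fun x => hN.norm_batchHess_le t x w)

theorem Assumptions.integral_batchHess (t : T k) (w : Model M) (hn : 0 < n) :
    ∫ x : Fin n → X k, N.batchHess k t w x ∂iidKernel (N.dataLaw k) n t = N.taskHess k t w := by
  simp only [hN.batchHess_eq]
  rw [hN.taskHess_eq]
  exact integral_avg (hN.integrable_lossHess t w) hn

/-! ### The distance of the gradients -/

theorem Assumptions.norm_integral_innerGrad_sub_le (w : Model M) (t : T k) :
    ‖∫ x, N.innerGrad k w (t, x) ∂iidKernel (N.dataLaw k) N.nIn t - N.exactGrad k w t‖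
      ≤ N.gradGap c := by
  set g := N.taskGrad k t (N.taskStep k t w) with hg
  set κ := iidKernel (N.dataLaw k) N.nIn t
  have hα := N.α_pos.le
  have hi : Integrable (fun x => N.batchOp k t w x) κ :=
    (integrable_const _).sub ((hN.integrable_batchHess t w N.nIn_pos).smul N.α)
  have hi1 : Integrable (fun x => N.batchOp k t w x g) κ := hi.apply_continuousLinearMap g
  have h0 : ∫ x, N.batchOp k t w x ∂κ = N.taskOp k t w := by
    rw [taskOp, ← hN.integral_batchHess t w N.nIn_pos, ← integral_smul]
    refine (integral_sub (integrable_const _)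
      ((hN.integrable_batchHess t w N.nIn_pos).smul N.α)).trans ?_
    simp
  -- As `g` does not depend on the batch, the Hessian noise averages out exactly; only the noise of
  -- the inner step is left.
  have h1 : ∫ x, N.batchOp k t w x g ∂κ = N.exactGrad k w t := by
    rw [← ContinuousLinearMap.integral_apply hi, h0]
  have hm : Measurable fun x : Fin N.nIn → X k => N.innerGrad k w (t, x) :=
    hN.measurable_innerGrad.comp (f := fun x => ((t, x), w)) (by fun_prop)
  have mL : Measurable fun x : Fin N.nIn → X k => 1 + N.α * hN.batchLip k t x :=
    ((hN.measurable_batchLip.comp measurable_prodMk_left).const_mul N.α).const_add 1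
  have mG : Measurable fun x : Fin N.nIn → X k => ‖N.batchGrad k t w x - N.taskGrad k t w‖ :=
    ((hN.measurable_batchGrad.comp (f := fun x => ((t, x), w)) (by fun_prop)).sub_const _).norm
  have hi2 : Integrable (fun x => N.innerGrad k w (t, x)) κ := by
    refine (((integrable_const (1 : ℝ)).add ((hN.batchLip_mean t N.nIn_pos).1.const_mul
      N.α)).mul_const c.B).mono' hm.aestronglyMeasurable
      (Filter.Eventually.of_forall fun x => hN.norm_innerGrad_le w (t, x))
  -- Operator and inner gradient share the batch, so Cauchy–Schwarz separates them.
  have hb : MeanLE κ (fun x => ‖N.innerGrad k w (t, x) - N.batchOp k t w x g‖)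
      (c.L * N.α * ((1 + N.α * c.L) * (c.σG / √N.nIn))) := by
    refine MeanLE.mono (((hN.one_add_batchLip_sq t N.nIn_pos).mul
      ((hN.batchGrad_var t w N.nIn_pos).of_le (b := (c.σG / √N.nIn) ^ 2) ?_) ?_ ?_
      mL.aestronglyMeasurable mG.aestronglyMeasurable).const_mul (mul_nonneg c.L_nonneg hα))
      (hi2.sub hi1).1.norm (fun _ => norm_nonneg _) fun x => ?_
    · rw [div_pow, Real.sq_sqrt (by positivity)]
    · have := c.L_nonneg; positivity
    · have := c.σG_nonneg; positivity
    · rw [innerGrad, ← map_sub]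
      have h3 : ‖N.taskGrad k t (N.batchStep k t w x) - g‖
          ≤ c.L * (N.α * ‖N.batchGrad k t w x - N.taskGrad k t w‖) := by
        refine (hN.taskGrad_sub_le t _ _).trans (mul_le_mul_of_nonneg_left ?_ c.L_nonneg)
        rw [sub_sub_sub_cancel_left, ← smul_sub, norm_smul, Real.norm_of_nonneg hα, norm_sub_rev]
      refine ((N.batchOp k t w x).le_of_opNorm_le_of_le (hN.norm_batchOp_le _ _ _) h3).trans
        (le_of_eq ?_)
      ring
  rw [← h1, ← integral_sub hi2 hi1]
  refine hb.norm_integral_le.trans ?_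
  -- The first summand of `gradGap` already bounds the distance; the second is only added.
  have h2 : 0 ≤ c.B * N.α * c.σH / √N.nIn := by
    have := c.B_nonneg; have := c.σH_nonneg; positivity
  rw [gradGap]
  refine le_trans (le_of_eq ?_) (le_add_of_nonneg_right h2)
  ring

theorem Assumptions.norm_gradient_mamlRisk_sub_le (w : Model M) :
    ‖gradient (N.adjustedRisk k) w - gradient (N.mamlRisk k) w‖ ≤ N.gradGap c := by
  rw [hN.gradient_adjustedRisk, (hN.hasGradientAt_mamlRisk w).gradient,
    Measure.integral_compProd (hN.integrable_innerGrad w)]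
  have h1 : Integrable (fun t => ∫ x, N.innerGrad k w (t, x) ∂iidKernel (N.dataLaw k) N.nIn t)
      (N.taskLaw k) := integrable_integral_compProd (hN.integrable_innerGrad w)
  rw [← integral_sub h1 (hN.integrable_exactGrad w)]
  exact MeanLE.norm_integral_le (MeanLE.mono (MeanLE.const _)
    (h1.sub (hN.integrable_exactGrad w)).1.norm (fun _ => norm_nonneg _)
    fun t => hN.norm_integral_innerGrad_sub_le w t)

end Objectives

end Network

end DifMAML

/-! ### Mean and variance of the stochastic MAML gradient. -/

namespace DifMAML

namespace Network

section Noise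

variable {K M : ℕ} {T X : Fin K → Type*}
  [∀ k, MeasurableSpace (T k)] [∀ k, MeasurableSpace (X k)] {N : Network K M T X}
  {c : Constants} {k : Fin K} {n : ℕ}

/-- Expectations are bounded in the order outer batch, inner batch, task, each given what comes
after it in this list. -/
theorem meanLE_taskDrawLaw {f : N.TaskDraw k → ℝ} {g : T k → ℝ} {r : ℝ}
    {h : T k → (Fin N.nIn → X k) → ℝ} (mf : Measurable f) (hf0 : ∀ p, 0 ≤ f p)
    (hf : ∀ t x, MeanLE (iidKernel (N.dataLaw k) N.nOut t) (fun y => f (t, (x, y))) (h t x))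
    (hh : ∀ t, MeanLE (iidKernel (N.dataLaw k) N.nIn t) (h t) (g t))
    (hg : MeanLE (N.taskLaw k) g r) : MeanLE (N.taskDrawLaw k) f r := by
  refine MeanLE.compProd mf hf0 (fun t => ?_) hg
  rw [Kernel.prod_apply]
  exact MeanLE.prod (mf.comp measurable_prodMk_left) (fun _ => hf0 _) (hf t) (hh t)

variable (hN : N.Assumptions c)
include hN

theorem Assumptions.measurable_taskMamlGrad :
    Measurable fun p : N.TaskDraw k × Model M => N.taskMamlGrad k p.2 p.1 := by
  have h1 : Measurable fun p : N.TaskDraw k × Model M => N.batchOp k p.1.1 p.2 p.1.2.1 :=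
    hN.measurable_batchOp.comp (f := fun p : N.TaskDraw k × Model M => ((p.1.1, p.1.2.1), p.2))
      (by fun_prop)
  have h2 : Measurable fun p : N.TaskDraw k × Model M => N.batchStep k p.1.1 p.2 p.1.2.1 :=
    hN.measurable_batchStep.comp (f := fun p : N.TaskDraw k × Model M => ((p.1.1, p.1.2.1), p.2))
      (by fun_prop)
  have h3 : Measurable fun p : N.TaskDraw k × Model M =>
      N.batchGrad k p.1.1 (N.batchStep k p.1.1 p.2 p.1.2.1) p.1.2.2 :=
    hN.measurable_batchGrad.comp (f := fun p : N.TaskDraw k × Model M =>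
      ((p.1.1, p.1.2.2), N.batchStep k p.1.1 p.2 p.1.2.1)) (by fun_prop)
  exact isBoundedBilinearMap_apply.continuous.measurable.comp (h1.prodMk h3)

theorem Assumptions.measurable_taskMamlGrad_right (w : Model M) :
    Measurable fun d : N.TaskDraw k => N.taskMamlGrad k w d :=
  hN.measurable_taskMamlGrad.comp (f := fun d : N.TaskDraw k => (d, w)) (by fun_prop)

theorem Assumptions.norm_taskMamlGrad_right (w : Model M) (t : T k) (x : Fin N.nIn → X k) :
    MeanLE (iidKernel (N.dataLaw k) N.nOut t) (fun y => ‖N.taskMamlGrad k w (t, (x, y))‖)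
      ((1 + N.α * hN.batchLip k t x) * c.B) := by
  have h0 : 0 ≤ 1 + N.α * hN.batchLip k t x :=
    add_nonneg zero_le_one (mul_nonneg N.α_pos.le (hN.batchLip_nonneg t x))
  have h := ((hN.boundedGradients k t (N.batchStep k t w x)).avg N.nOut_pos).const_mul h0
  refine h.mono ((hN.measurable_taskMamlGrad_right w).comp (f := fun y => (t, (x, y)))
    (by fun_prop)).norm.aestronglyMeasurable (fun _ => norm_nonneg _) fun y => ?_
  exact (N.batchOp k t w x).le_of_opNorm_le_of_le (hN.norm_batchOp_le _ _ _)
    (hN.norm_batchGrad_le _ _ _)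

theorem Assumptions.norm_taskMamlGrad_mean (t : T k) :
    MeanLE (iidKernel (N.dataLaw k) N.nIn t) (fun x => (1 + N.α * hN.batchLip k t x) * c.B)
      ((1 + N.α * c.L) * c.B) :=
  ((((MeanLE.const 1).add ((hN.batchLip_mean t N.nIn_pos).const_mul N.α_pos.le)).const_mul
    c.B_nonneg).congr fun _ => mul_comm _ _).of_le (mul_comm _ _).le

theorem Assumptions.integrable_taskMamlGrad (w : Model M) :
    Integrable (N.taskMamlGrad k w) (N.taskDrawLaw k) :=
  (meanLE_taskDrawLaw (hN.measurable_taskMamlGrad_right w).norm (fun _ => norm_nonneg _)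
    (hN.norm_taskMamlGrad_right w) hN.norm_taskMamlGrad_mean
    (MeanLE.const _)).integrable_of_norm
    (hN.measurable_taskMamlGrad_right w).aestronglyMeasurable

theorem Assumptions.integral_batchGrad (t : T k) (w : Model M) (hn : 0 < n) :
    ∫ x : Fin n → X k, N.batchGrad k t w x ∂iidKernel (N.dataLaw k) n t = N.taskGrad k t w := by
  simp only [hN.batchGrad_eq]
  rw [hN.taskGrad_eq]
  exact integral_avg (hN.integrable_lossGrad t w) hn

theorem Assumptions.integrable_batchGrad (t : T k) (w : Model M) :
    Integrable (fun x : Fin n → X k => N.batchGrad k t w x) (iidKernel (N.dataLaw k) n t) := by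
  simp only [hN.batchGrad_eq]
  exact integrable_avg (hN.integrable_lossGrad t w)

/-- The stochastic MAML gradient is an unbiased estimate of the gradient of the adjusted risk. -/
theorem Assumptions.integral_taskMamlGrad (w : Model M) :
    ∫ d, N.taskMamlGrad k w d ∂N.taskDrawLaw k = gradient (N.adjustedRisk k) w := by
  rw [hN.gradient_adjustedRisk, Measure.integral_compProd (hN.integrable_innerGrad w), taskDrawLaw,
    Measure.integral_compProd (hN.integrable_taskMamlGrad w)]
  congr 1
  ext1 t
  have mt : Measurable fun p : (Fin N.nIn → X k) × (Fin N.nOut → X k) =>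
      N.taskMamlGrad k w (t, p) := (hN.measurable_taskMamlGrad_right w).comp measurable_prodMk_left
  rw [Kernel.prod_apply, integral_prod]
  · congr 1
    ext1 x
    refine ((N.batchOp k t w x).integral_comp_comm
      (hN.integrable_batchGrad (n := N.nOut) t (N.batchStep k t w x))).trans ?_
    rw [hN.integral_batchGrad _ _ N.nOut_pos]
  · exact (MeanLE.prod mt.norm (fun _ => norm_nonneg _) (hN.norm_taskMamlGrad_right w t)
      (hN.norm_taskMamlGrad_mean t)).integrable_of_norm mt.aestronglyMeasurable

/-! ### Norms of Hessians -/

theorem Assumptions.norm_lossHess_fourth (t : T k) (w : Model M) :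
    MeanLE (N.dataLaw k t) (fun x => ‖‖N.lossHess k t w x‖
      - ∫ y, ‖N.lossHess k t w y‖ ∂N.dataLaw k t‖ ^ 4) ((4 * c.σH ^ 2) ^ 2) := by
  set m := ∫ y, ‖N.lossHess k t w y‖ ∂N.dataLaw k t with hm
  set H := N.taskHess k t w with hH
  have hi := (hN.integrable_lossHess t w).norm
  have h4 := (hN.boundedNoise k t w).2
  have hs : AEStronglyMeasurable (fun x => ‖N.lossHess k t w x - H‖) (N.dataLaw k t) :=
    ((hN.integrable_lossHess t w).sub (integrable_const H)).1.norm
  have h1 : MeanLE (N.dataLaw k t) (fun x => ‖N.lossHess k t w x - H‖) c.σH := by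
    refine MeanLE.of_sq (MeanLE.of_sq ((h4.congr fun x => ?_).of_le (le_of_eq ?_)) (sq_nonneg _)
      (hs.pow 2)) c.σH_nonneg hs <;> ring
  have h2 : |m - ‖H‖| ≤ c.σH := by
    have e : m - ‖H‖ = ∫ x, (‖N.lossHess k t w x‖ - ‖H‖) ∂N.dataLaw k t := by
      rw [integral_sub hi (integrable_const _)]; simp [hm]
    rw [e, ← Real.norm_eq_abs]
    exact MeanLE.norm_integral_le (h1.mono (hi.sub (integrable_const _)).1.norm
      (fun _ => norm_nonneg _) fun x => abs_norm_sub_norm_le _ _)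
  have h3 := (h4.add (MeanLE.const (c.σH ^ 4))).const_mul (r := 8) (by norm_num)
  refine (h3.mono ((hi.sub (integrable_const m)).1.norm.pow 4)
    (fun _ => pow_nonneg (norm_nonneg _) 4) fun x => ?_).of_le (le_of_eq (by ring))
  -- The norm is compared with `‖H‖`, and `‖H‖` with `m`; then `(a + b) ^ 4 ≤ 8 * (a ^ 4 + b ^ 4)`
  -- produces `16 * σH ^ 4`.
  have h5 : ‖‖N.lossHess k t w x‖ - m‖ ≤ ‖N.lossHess k t w x - H‖ + c.σH := by
    have := abs_norm_sub_norm_le (N.lossHess k t w x) H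
    calc ‖‖N.lossHess k t w x‖ - m‖ = |(‖N.lossHess k t w x‖ - ‖H‖) - (m - ‖H‖)| := by
          rw [Real.norm_eq_abs]; congr 1; ring
      _ ≤ |‖N.lossHess k t w x‖ - ‖H‖| + |m - ‖H‖| := abs_sub _ _
      _ ≤ _ := add_le_add this h2
  calc ‖‖N.lossHess k t w x‖ - m‖ ^ 4 ≤ (‖N.lossHess k t w x - H‖ + c.σH) ^ 4 := by gcongr
    _ ≤ _ := by
      have := add_pow_le (norm_nonneg (N.lossHess k t w x - H)) c.σH_nonneg 4
      norm_num at this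
      exact this

/-- The mean of the norms of the Hessians over a batch. -/
noncomputable abbrev batchHessNorm (N : Network K M T X) (k : Fin K) (t : T k) (w : Model M)
    (x : Fin n → X k) : ℝ :=
  (1 / (n : ℝ)) * ∑ i, ‖N.lossHess k t w (x i)‖

/-- Noise of batch Hessians and gradients is, in the mean, uncorrelated up to `O(1 / n ^ 2)`. -/
theorem Assumptions.batchHessNorm_mul_batchGrad (t : T k) (w : Model M) (hn : 0 < n) :
    MeanLE (iidKernel (N.dataLaw k) n t)
      (fun x => (1 + N.α * N.batchHessNorm k t w x) ^ 2
        * ‖N.batchGrad k t w x - N.taskGrad k t w‖ ^ 2)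
      (4 * (1 + N.α * c.L) ^ 2 * (c.σG ^ 2 / n)
        + 16 * N.α ^ 2 * (c.σH ^ 2 * c.σG ^ 2 / n ^ 2)) := by
  set m := ∫ y, ‖N.lossHess k t w y‖ ∂N.dataLaw k t with hm
  have hm0 : 0 ≤ m := integral_nonneg fun _ => norm_nonneg _
  have hmL : m ≤ c.L :=
    ((hN.lip_mean t).mono (hN.integrable_lossHess t w).1.norm (fun _ => norm_nonneg _)
      fun x => hN.norm_lossHess_le t x w).2
  have hα := N.α_pos
  have hn' : (0 : ℝ) < n := by positivity
  have h1 : MeanLE (iidKernel (N.dataLaw k) n t)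
      (fun x => ‖N.batchHessNorm k t w x - m‖ ^ 4) (3 * (4 * c.σH ^ 2) ^ 2 / n ^ 2) :=
    MeanLE.avg_fourth (F := fun x => ‖N.lossHess k t w x‖) (by positivity)
      (hN.integrable_lossHess t w).norm rfl (hN.norm_lossHess_fourth t w) hn
  have h2 := hN.batchGrad_fourth t w hn
  have s1 : AEStronglyMeasurable (fun x => N.batchHessNorm k t w x)
      (iidKernel (N.dataLaw k) n t) := by
    refine ((Finset.measurable_sum _ fun i _ => ?_).const_mul _).aestronglyMeasurable
    exact ((hN.measurable_lossHess_right t w).comp (measurable_pi_apply i)).norm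
  have s2 : AEStronglyMeasurable (fun x => ‖N.batchGrad k t w x - N.taskGrad k t w‖ ^ 2)
      (iidKernel (N.dataLaw k) n t) :=
    ((hN.integrable_batchGrad t w).sub (integrable_const _)).1.norm.pow 2
  -- The factors are dependent and `batchLip` has only a second moment. The Hessian norms serve
  -- instead: their average has a fourth central moment of order `1 / n ^ 2`, like that of the
  -- gradient, and Cauchy–Schwarz gives `12 * σH ^ 2 * σG ^ 2 / n ^ 2`.
  have h3 : MeanLE (iidKernel (N.dataLaw k) n t)
      (fun x => ‖N.batchHessNorm k t w x - m‖ ^ 2 * ‖N.batchGrad k t w x - N.taskGrad k t w‖ ^ 2)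
      (√3 * (4 * c.σH ^ 2) / n * (√3 * c.σG ^ 2 / n)) := by
    refine MeanLE.mul ((h1.congr fun x => by ring).of_le (le_of_eq ?_))
      ((h2.congr fun x => by ring).of_le (le_of_eq ?_)) (by positivity) (by positivity)
      ((s1.sub aestronglyMeasurable_const).norm.pow 2) s2
    · rw [div_pow, mul_pow √3, Real.sq_sqrt zero_le_three]
    · rw [div_pow, mul_pow √3, Real.sq_sqrt zero_le_three]; ring
  have h4 := ((hN.batchGrad_var t w hn).const_mul (r := 4 * (1 + N.α * c.L) ^ 2)
    (by positivity)).add (h3.const_mul (r := 4 / 3 * N.α ^ 2) (by positivity))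
  refine MeanLE.of_le (MeanLE.mono h4
    (((aestronglyMeasurable_const.add (s1.const_mul _)).pow 2).mul s2)
    (fun _ => mul_nonneg (sq_nonneg _) (sq_nonneg _)) fun x => ?_) (le_of_eq ?_)
  -- This is `(a + b) ^ 2 ≤ 4 * a ^ 2 + 4 / 3 * b ^ 2`, with `a` the value at the mean `m ≤ L`. The
  -- weight `4 / 3` turns the `12` of the mixed moment into `16`.
  · have key : ∀ h : ℝ, (1 + N.α * h) ^ 2
        ≤ 4 * (1 + N.α * c.L) ^ 2 + 4 / 3 * N.α ^ 2 * ‖h - m‖ ^ 2 := by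
      intro h
      have h5 : (1 + N.α * m) ^ 2 ≤ (1 + N.α * c.L) ^ 2 := by gcongr
      rw [Real.norm_eq_abs, sq_abs]
      nlinarith [sq_nonneg (3 * (1 + N.α * m) - N.α * (h - m))]
    exact (mul_le_mul_of_nonneg_right (key _) (sq_nonneg _)).trans_eq (by ring)
  · have : √3 * √3 = 3 := Real.mul_self_sqrt (by norm_num)
    have e : √3 * (4 * c.σH ^ 2) / n * (√3 * c.σG ^ 2 / n)
        = (√3 * √3) * (4 * c.σH ^ 2 * c.σG ^ 2 / n ^ 2) := by field_simp
    rw [e, this]; ring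

theorem Assumptions.norm_batchOp_le' (t : T k) (w : Model M) (x : Fin n → X k) :
    ‖N.batchOp k t w x‖ ≤ 1 + N.α * N.batchHessNorm k t w x := by
  refine (norm_sub_le _ _).trans (add_le_add ContinuousLinearMap.norm_id_le ?_)
  rw [norm_smul, Real.norm_of_nonneg N.α_pos.le]
  refine mul_le_mul_of_nonneg_left ?_ N.α_pos.le
  have := norm_avg_sub_avg_le (fun i => N.lossHess k t w (x i)) (fun _ => 0)
  simp only [Finset.sum_const_zero, smul_zero, sub_zero] at this
  rw [hN.batchHess_eq]
  exact this

/-! ### The gradient noise -/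

/-- The gradient of the risk of the mean task after an exact inner step. -/
noncomputable abbrev refGrad (N : Network K M T X) (k : Fin K) (w : Model M) : Model M :=
  (ContinuousLinearMap.id ℝ (Model M) - N.α • hessian (N.meanRisk k) w)
    (gradient (N.meanRisk k) (w - N.α • gradient (N.meanRisk k) w))

/-- The reference gradient depends neither on the task nor on the data. Three changes lead to it: of
the point of the inner step, of the outer gradient, and of the Hessian. Task variability controls
each. The Hessian of the mean risk enters only as a fixed operator. -/
theorem Assumptions.exactGrad_sub_refGrad (w : Model M) (t : T k) :
    ‖N.exactGrad k w t - N.refGrad k w‖ ^ 2 ≤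
      4 * (1 + N.α * c.L) ^ 2 * (c.L ^ 2 * N.α ^ 2 *
          ‖N.taskGrad k t w - gradient (N.meanRisk k) w‖ ^ 2
        + ‖N.taskGrad k t (w - N.α • gradient (N.meanRisk k) w)
          - gradient (N.meanRisk k) (w - N.α • gradient (N.meanRisk k) w)‖ ^ 2)
      + 2 * N.α ^ 2 * c.B ^ 2 * ‖N.taskHess k t w - hessian (N.meanRisk k) w‖ ^ 2 := by
  set g := gradient (N.meanRisk k) w with hg
  set v := gradient (N.meanRisk k) (w - N.α • g) with hv
  set H := hessian (N.meanRisk k) w with hH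
  set p := ‖N.taskGrad k t w - g‖
  set q := ‖N.taskGrad k t (w - N.α • g) - v‖
  set r := ‖N.taskHess k t w - H‖
  have hα := N.α_pos.le
  have hL := c.L_nonneg
  have e : N.exactGrad k w t - N.refGrad k w =
      N.taskOp k t w ((N.taskGrad k t (N.taskStep k t w) - N.taskGrad k t (w - N.α • g))
        + (N.taskGrad k t (w - N.α • g) - v)) - N.α • (N.taskHess k t w - H) v := by
    simp only [exactGrad, refGrad, taskOp, sub_apply, smul_apply, map_sub, map_add, smul_sub,
      ← hg, ← hv, ← hH, ContinuousLinearMap.id_apply]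
    abel
  have h1 : ‖N.taskGrad k t (N.taskStep k t w) - N.taskGrad k t (w - N.α • g)‖
      ≤ c.L * (N.α * p) := by
    refine (hN.taskGrad_sub_le t _ _).trans (mul_le_mul_of_nonneg_left ?_ hL)
    rw [sub_sub_sub_cancel_left, ← smul_sub, norm_smul, Real.norm_of_nonneg hα, norm_sub_rev]
  have h2 : ‖N.exactGrad k w t - N.refGrad k w‖
      ≤ (1 + N.α * c.L) * (c.L * (N.α * p) + q) + N.α * (r * c.B) := by
    rw [e]
    refine (norm_sub_le _ _).trans (add_le_add ?_ ?_)
    · exact (N.taskOp k t w).le_of_opNorm_le_of_le (hN.norm_taskOp_le _ _)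
        ((norm_add_le _ _).trans (add_le_add h1 le_rfl))
    · rw [norm_smul, Real.norm_of_nonneg hα]
      refine mul_le_mul_of_nonneg_left ?_ hα
      exact ContinuousLinearMap.le_of_opNorm_le_of_le _ le_rfl (hN.norm_gradient_meanRisk_le _)
  calc _ ≤ ((1 + N.α * c.L) * (c.L * (N.α * p) + q) + N.α * (r * c.B)) ^ 2 := by gcongr
    _ ≤ _ := by
      nlinarith [sq_nonneg ((1 + N.α * c.L) * (c.L * (N.α * p) + q) - N.α * (r * c.B)),
        sq_nonneg ((1 + N.α * c.L) * (c.L * (N.α * p) - q))]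

theorem Assumptions.exactGrad_sub_refGrad_mean (w : Model M) :
    MeanLE (N.taskLaw k) (fun t => ‖N.exactGrad k w t - N.refGrad k w‖ ^ 2)
      (4 * (1 + N.α * c.L) ^ 2 * (1 + N.α ^ 2 * c.L ^ 2) * c.γG ^ 2
        + 2 * N.α ^ 2 * c.B ^ 2 * c.γH ^ 2) := by
  have hG (u : Model M) : MeanLE (N.taskLaw k)
      (fun t => ‖N.taskGrad k t u - gradient (N.meanRisk k) u‖ ^ 2) (c.γG ^ 2) := by
    refine MeanLE.of_sq (((hN.boundedTaskVariability k u).1.congr fun x => by ring).of_le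
      (le_of_eq (by ring))) (sq_nonneg _) ?_
    exact (((hN.measurable_taskGrad.comp (f := fun t => (t, u)) (by fun_prop)).sub_const
      _).norm.pow_const 2).aestronglyMeasurable
  have hH : MeanLE (N.taskLaw k)
      (fun t => ‖N.taskHess k t w - hessian (N.meanRisk k) w‖ ^ 2) (c.γH ^ 2) := by
    refine MeanLE.of_sq (((hN.boundedTaskVariability k w).2.congr fun x => by ring).of_le
      (le_of_eq (by ring))) (sq_nonneg _) ?_
    exact (((hN.measurable_taskHess.comp (f := fun t => (t, w)) (by fun_prop)).sub_const
      _).norm.pow_const 2).aestronglyMeasurable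
  have hα := N.α_pos.le
  have hL := c.L_nonneg
  have h := ((((hG w).const_mul (r := c.L ^ 2 * N.α ^ 2) (by positivity)).add
    (hG (w - N.α • gradient (N.meanRisk k) w))).const_mul (r := 4 * (1 + N.α * c.L) ^ 2)
    (by positivity)).add (hH.const_mul (r := 2 * N.α ^ 2 * c.B ^ 2) (by positivity))
  refine MeanLE.of_le (MeanLE.mono h (((hN.integrable_exactGrad w).sub
    (integrable_const _)).1.norm.pow 2) (fun _ => sq_nonneg _)
    fun t => hN.exactGrad_sub_refGrad w t) (le_of_eq (by ring))

theorem Assumptions.taskMamlGrad_sub_refGrad (w : Model M) (t : T k) (x : Fin N.nIn → X k)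
    (y : Fin N.nOut → X k) :
    ‖N.taskMamlGrad k w (t, (x, y)) - N.refGrad k w‖ ^ 2 ≤
      9 * (1 + N.α * hN.batchLip k t x) ^ 2 * ‖N.batchGrad k t (N.batchStep k t w x) y
        - N.taskGrad k t (N.batchStep k t w x)‖ ^ 2
      + 27 / 8 * (c.L ^ 2 * N.α ^ 2 * ((1 + N.α * N.batchHessNorm k t w x) ^ 2
          * ‖N.batchGrad k t w x - N.taskGrad k t w‖ ^ 2)
        + N.α ^ 2 * ‖(N.batchHess k t w x - N.taskHess k t w)
          (N.taskGrad k t (N.taskStep k t w))‖ ^ 2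
        + ‖N.exactGrad k w t - N.refGrad k w‖ ^ 2) := by
  set u := N.batchStep k t w x with hu
  set g := N.taskGrad k t (N.taskStep k t w) with hg
  have hα := N.α_pos.le
  -- Four sources of deviation: outer batch, inner step, inner Hessian on a fixed vector, and task.
  have e : N.taskMamlGrad k w (t, (x, y)) - N.refGrad k w =
      N.batchOp k t w x (N.batchGrad k t u y - N.taskGrad k t u)
      + (N.batchOp k t w x (N.taskGrad k t u - g)
        - N.α • (N.batchHess k t w x - N.taskHess k t w) g
        + (N.exactGrad k w t - N.refGrad k w)) := by
    have e1 : N.taskMamlGrad k w (t, (x, y)) = N.batchOp k t w x (N.batchGrad k t u y) := rfl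
    rw [e1]
    simp only [exactGrad, batchOp, taskOp, sub_apply, smul_apply, map_sub, smul_sub, ← hg,
      ContinuousLinearMap.id_apply]
    abel
  have h1 : ‖N.batchOp k t w x (N.batchGrad k t u y - N.taskGrad k t u)‖
      ≤ (1 + N.α * hN.batchLip k t x) * ‖N.batchGrad k t u y - N.taskGrad k t u‖ :=
    (N.batchOp k t w x).le_of_opNorm_le (hN.norm_batchOp_le _ _ _) _
  have h2 : ‖N.batchOp k t w x (N.taskGrad k t u - g)‖ ≤ (1 + N.α * N.batchHessNorm k t w x)
      * (c.L * (N.α * ‖N.batchGrad k t w x - N.taskGrad k t w‖)) := by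
    refine (N.batchOp k t w x).le_of_opNorm_le_of_le (hN.norm_batchOp_le' _ _ _)
      ((hN.taskGrad_sub_le t _ _).trans (mul_le_mul_of_nonneg_left ?_ c.L_nonneg))
    rw [sub_sub_sub_cancel_left, ← smul_sub, norm_smul, Real.norm_of_nonneg hα, norm_sub_rev]
  rw [e]
  set A := N.batchOp k t w x (N.batchGrad k t u y - N.taskGrad k t u)
  set B := N.batchOp k t w x (N.taskGrad k t u - g)
  set C := (N.batchHess k t w x - N.taskHess k t w) g
  set D := N.exactGrad k w t - N.refGrad k w
  have h3 : ‖A + (B - N.α • C + D)‖ ≤ ‖A‖ + (‖B‖ + N.α * ‖C‖ + ‖D‖) := by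
    refine (norm_add_le _ _).trans (add_le_add le_rfl ((norm_add_le _ _).trans
      (add_le_add ((norm_sub_le _ _).trans (add_le_add le_rfl ?_)) le_rfl)))
    rw [norm_smul, Real.norm_of_nonneg hα]
  have h4 := pow_le_pow_left₀ (norm_nonneg A) h1 2
  have h5 := pow_le_pow_left₀ (norm_nonneg B) h2 2
  -- From `(a + b) ^ 2 ≤ 9 * a ^ 2 + 9 / 8 * b ^ 2` and three terms in `b`. The weight `27 / 8` is
  -- chosen because `27 / 8 * 16 = 54` is exactly what `3 * C1sq` affords for the mixed term.
  have h6 : (‖A‖ + (‖B‖ + N.α * ‖C‖ + ‖D‖)) ^ 2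
      ≤ 9 * ‖A‖ ^ 2 + 27 / 8 * (‖B‖ ^ 2 + (N.α * ‖C‖) ^ 2 + ‖D‖ ^ 2) := by
    nlinarith [sq_nonneg (8 * ‖A‖ - (‖B‖ + N.α * ‖C‖ + ‖D‖)), sq_nonneg (‖B‖ - N.α * ‖C‖),
      sq_nonneg (‖B‖ - ‖D‖), sq_nonneg (N.α * ‖C‖ - ‖D‖)]
  refine (pow_le_pow_left₀ (norm_nonneg _) h3 2).trans (h6.trans ?_)
  rw [mul_pow] at h4 h5
  have e5 : (c.L * (N.α * ‖N.batchGrad k t w x - N.taskGrad k t w‖)) ^ 2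
      = c.L ^ 2 * N.α ^ 2 * ‖N.batchGrad k t w x - N.taskGrad k t w‖ ^ 2 := by ring
  rw [e5] at h5
  rw [mul_pow N.α]
  linarith

theorem Assumptions.taskMamlGrad_sub_refGrad_mean (w : Model M) :
    MeanLE (N.taskDrawLaw k) (fun d => ‖N.taskMamlGrad k w d - N.refGrad k w‖ ^ 2)
      (9 * (1 + N.α * c.L) ^ 2 * (c.σG ^ 2 / N.nOut)
      + 27 / 8 * (c.L ^ 2 * N.α ^ 2 * (4 * (1 + N.α * c.L) ^ 2 * (c.σG ^ 2 / N.nIn)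
        + 16 * N.α ^ 2 * (c.σH ^ 2 * c.σG ^ 2 / N.nIn ^ 2))
        + N.α ^ 2 * (c.σH ^ 2 * c.B ^ 2 / N.nIn)
        + (4 * (1 + N.α * c.L) ^ 2 * (1 + N.α ^ 2 * c.L ^ 2) * c.γG ^ 2
          + 2 * N.α ^ 2 * c.B ^ 2 * c.γH ^ 2))) := by
  have hm := (((hN.measurable_taskMamlGrad_right (k := k) w).sub_const
    (N.refGrad k w)).norm.pow_const 2)
  have hL := c.L_nonneg
  have hα := N.α_pos.le
  refine meanLE_taskDrawLaw hm (fun _ => sq_nonneg _)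
    (h := fun t x => 9 * (1 + N.α * hN.batchLip k t x) ^ 2 * (c.σG ^ 2 / N.nOut)
      + 27 / 8 * (c.L ^ 2 * N.α ^ 2 * ((1 + N.α * N.batchHessNorm k t w x) ^ 2
          * ‖N.batchGrad k t w x - N.taskGrad k t w‖ ^ 2)
        + N.α ^ 2 * ‖(N.batchHess k t w x - N.taskHess k t w)
          (N.taskGrad k t (N.taskStep k t w))‖ ^ 2
        + ‖N.exactGrad k w t - N.refGrad k w‖ ^ 2))
    (g := fun t => 9 * (1 + N.α * c.L) ^ 2 * (c.σG ^ 2 / N.nOut)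
      + 27 / 8 * (c.L ^ 2 * N.α ^ 2 * (4 * (1 + N.α * c.L) ^ 2 * (c.σG ^ 2 / N.nIn)
        + 16 * N.α ^ 2 * (c.σH ^ 2 * c.σG ^ 2 / N.nIn ^ 2))
        + N.α ^ 2 * (c.σH ^ 2 * c.B ^ 2 / N.nIn)
        + ‖N.exactGrad k w t - N.refGrad k w‖ ^ 2))
    (fun t x => ?_) (fun t => ?_) ?_
  · refine MeanLE.mono (((hN.batchGrad_var t (N.batchStep k t w x) N.nOut_pos).const_mul
      (r := 9 * (1 + N.α * hN.batchLip k t x) ^ 2) (by positivity)).add (MeanLE.const _))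
      (hm.comp (g := fun d : N.TaskDraw k => ‖N.taskMamlGrad k w d - N.refGrad k w‖ ^ 2)
        (f := fun y => (t, (x, y))) (by fun_prop)).aestronglyMeasurable (fun _ => sq_nonneg _)
      fun y => hN.taskMamlGrad_sub_refGrad w t x y
  · have h1 := (hN.one_add_batchLip_sq t N.nIn_pos).const_mul (r := 9 * (c.σG ^ 2 / N.nOut))
      (by positivity)
    have h2 := (hN.batchHessNorm_mul_batchGrad t w N.nIn_pos).const_mul
      (r := c.L ^ 2 * N.α ^ 2) (by positivity)
    have h3 := (hN.batchHess_apply_var t w (N.taskGrad k t (N.taskStep k t w))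
      N.nIn_pos).const_mul (r := N.α ^ 2) (by positivity)
    have h4 := h1.add (((h2.add h3).add (MeanLE.const
      (‖N.exactGrad k w t - N.refGrad k w‖ ^ 2))).const_mul (r := 27 / 8) (by norm_num))
    refine MeanLE.of_le (h4.congr fun x => by ring) ?_
    have h5 : ‖N.taskGrad k t (N.taskStep k t w)‖ ≤ c.B := hN.norm_taskGrad_le _ _
    rw [mul_right_comm 9]
    gcongr
  · exact (MeanLE.const _).add (((MeanLE.const _).add
      (hN.exactGrad_sub_refGrad_mean w)).const_mul (r := 27 / 8) (by norm_num))

-- The only coefficient without slack is that of the mixed term `α ^ 4 * L ^ 2 * σH ^ 2 * σG ^ 2 /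
-- nIn ^ 2`. It is covered by the fourth powers in `C1sq`, since `σH ^ 4 + L ^ 4 * σG ^ 4` is a
-- square plus `2 * L ^ 2 * σH ^ 2 * σG ^ 2`. The term `C3 ^ 2` is only added.
omit hN in
theorem noise_le_C : 9 * (1 + N.α * c.L) ^ 2 * (c.σG ^ 2 / N.nOut)
      + 27 / 8 * (c.L ^ 2 * N.α ^ 2 * (4 * (1 + N.α * c.L) ^ 2 * (c.σG ^ 2 / N.nIn)
        + 16 * N.α ^ 2 * (c.σH ^ 2 * c.σG ^ 2 / N.nIn ^ 2))
        + N.α ^ 2 * (c.σH ^ 2 * c.B ^ 2 / N.nIn)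
        + (4 * (1 + N.α * c.L) ^ 2 * (1 + N.α ^ 2 * c.L ^ 2) * c.γG ^ 2
          + 2 * N.α ^ 2 * c.B ^ 2 * c.γH ^ 2))
      ≤ 3 * (N.C1sq c + N.C2sq c + N.C3 c ^ 2) := by
  have hα := N.α_pos.le
  have hL := c.L_nonneg
  have h1 : 0 ≤ (1 + N.α * c.L) ^ 2 * (c.σG ^ 2 / N.nOut) := by positivity
  have h2 : 0 ≤ c.L ^ 2 * N.α ^ 2 * ((1 + N.α * c.L) ^ 2 * (c.σG ^ 2 / N.nIn)) := by positivity
  have h3 : 0 ≤ N.α ^ 4 / (N.nIn : ℝ) ^ 2 * (c.σH ^ 2 - c.L ^ 2 * c.σG ^ 2) ^ 2 := by positivity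
  have h4 : 0 ≤ N.α ^ 2 * (c.σH ^ 2 * c.B ^ 2 / N.nIn) := by positivity
  have h5 : 0 ≤ N.α ^ 2 * (c.σH ^ 2 / N.nIn) * (c.σG ^ 2 / N.nOut) := by positivity
  have h6 : 0 ≤ (1 + N.α * c.L) ^ 2 * (1 + N.α ^ 2 * c.L ^ 2) * c.γG ^ 2 := by positivity
  have h7 : 0 ≤ N.α ^ 2 * c.B ^ 2 * c.γH ^ 2 := by positivity
  have h8 : 0 ≤ 2 * N.α ^ 4 * c.γH ^ 4 + 16 * (1 + N.α ^ 4 * c.L ^ 4) * c.γG ^ 4 := by positivity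
  have e1 : N.C1sq c = 6 * ((1 + N.α * c.L) ^ 2 * (c.σG ^ 2 / N.nOut))
      + 6 * (c.L ^ 2 * N.α ^ 2 * ((1 + N.α * c.L) ^ 2 * (c.σG ^ 2 / N.nIn)))
      + 6 * (N.α ^ 2 * (c.σH ^ 2 * c.B ^ 2 / N.nIn))
      + 6 * (N.α ^ 2 * (c.σH ^ 2 / N.nIn) * (c.σG ^ 2 / N.nOut))
      + 9 * (N.α ^ 4 / (N.nIn : ℝ) ^ 2 * (c.σH ^ 2 - c.L ^ 2 * c.σG ^ 2) ^ 2)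
      + 18 * (c.L ^ 2 * N.α ^ 2 * (N.α ^ 2 * (c.σH ^ 2 * c.σG ^ 2 / N.nIn ^ 2))) := by
    rw [C1sq]; ring
  rw [e1, C2sq]
  nlinarith [sq_nonneg (N.C3 c)]

/-- By unbiasedness the deviation is taken from the mean, so any fixed reference point, here
`refGrad`, gives an upper bound. -/
theorem Assumptions.taskMamlGrad_var (w : Model M) :
    MeanLE (N.taskDrawLaw k) (fun d => ‖N.taskMamlGrad k w d - gradient (N.adjustedRisk k) w‖ ^ 2)
      (3 * (N.C1sq c + N.C2sq c + N.C3 c ^ 2)) := by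
  have : IsProbabilityMeasure (N.taskDrawLaw k) := by unfold taskDrawLaw; infer_instance
  rw [← hN.integral_taskMamlGrad w]
  exact ((hN.taskMamlGrad_sub_refGrad_mean w).of_le noise_le_C).sub_mean_sq
    (hN.integrable_taskMamlGrad w)

end Noise

end Network

end DifMAML

namespace DifMAML

/-! ### Mixing of the combination matrix -/

/-- The powers of a doubly stochastic primitive matrix converge geometrically to the matrix with all
entries `1 / K`. -/
theorem exists_abs_pow_sub_le {K : ℕ} [NeZero K] {A : Matrix (Fin K) (Fin K) ℝ}
    (hA : A ∈ doublyStochastic ℝ (Fin K)) (hp : A.IsPrimitive) :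
    ∃ C r : ℝ, 0 ≤ C ∧ 0 ≤ r ∧ r < 1 ∧ ∀ i l k, |(A ^ i) l k - 1 / K| ≤ C * r ^ i := by
  obtain ⟨p, hp0, hpos⟩ := hp.exists_pos_pow
  have hK : (0 : ℝ) < K := by exact_mod_cast Nat.pos_of_ne_zero (NeZero.ne K)
  have hds : ∀ i, A ^ i ∈ doublyStochastic ℝ (Fin K) := fun i => pow_mem hA i
  obtain ⟨⟨l₀, k₀⟩, hmin⟩ := Finite.exists_min fun q : Fin K × Fin K => (A ^ p) q.1 q.2
  set ε := (A ^ p) l₀ k₀ with hε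
  have hε0 : 0 < ε := hpos l₀ k₀
  have hle : ∀ l k, ε ≤ (A ^ p) l k := fun l k => hmin (l, k)
  have hq0 : 0 ≤ 1 - K * ε := by
    have h := sum_row_of_mem_doublyStochastic (hds p) l₀
    have h2 : ∑ _j : Fin K, ε ≤ ∑ j, (A ^ p) l₀ j := Finset.sum_le_sum fun j _ => hle l₀ j
    rw [h] at h2
    simp at h2
    linarith
  have key : ∀ m i l k, |(A ^ (p * m + i)) l k - 1 / K| ≤ (1 - K * ε) ^ m := by
    intro m
    induction m with
    | zero =>
      intro i l k
      have h1 := nonneg_of_mem_doublyStochastic (hds (p * 0 + i)) (i := l) (j := k)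
      have h2 := le_one_of_mem_doublyStochastic (hds (p * 0 + i)) (i := l) (j := k)
      have h3 : 1 / (K : ℝ) ≤ 1 := by
        rw [div_le_one hK]; exact_mod_cast Nat.pos_of_ne_zero (NeZero.ne K)
      have h4 : 0 ≤ 1 / (K : ℝ) := by positivity
      rw [pow_zero, abs_le]
      constructor <;> linarith
    | succ m ih =>
      intro i l k
      have e : A ^ (p * (m + 1) + i) = A ^ p * A ^ (p * m + i) := by
        rw [← pow_add]; congr 1; ring
      -- Deviations from `1 / K` sum to zero over a column, so the least entry `ε` may be subtracted
      -- from all weights. The remaining weights are nonnegative with row sum `1 - K * ε`, which is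
      -- the contraction factor.
      have e2 : (A ^ p * A ^ (p * m + i)) l k - 1 / K
          = ∑ j, ((A ^ p) l j - ε) * ((A ^ (p * m + i)) j k - 1 / K) := by
        have h1 := sum_row_of_mem_doublyStochastic (hds p) l
        have h2 := sum_col_of_mem_doublyStochastic (hds (p * m + i)) k
        rw [Matrix.mul_apply]
        simp only [sub_mul, mul_sub, Finset.sum_sub_distrib, ← Finset.mul_sum, ← Finset.sum_mul,
          h1, h2]
        simp only [Finset.sum_const, Finset.card_univ, Fintype.card_fin, nsmul_eq_mul]
        field_simp
        ring
      rw [e, e2, pow_succ']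
      calc _ ≤ ∑ j, |((A ^ p) l j - ε) * ((A ^ (p * m + i)) j k - 1 / K)| :=
            Finset.abs_sum_le_sum_abs _ _
        _ ≤ ∑ j, ((A ^ p) l j - ε) * (1 - K * ε) ^ m := by
            refine Finset.sum_le_sum fun j _ => ?_
            rw [abs_mul, abs_of_nonneg (sub_nonneg.2 (hle l j))]
            exact mul_le_mul_of_nonneg_left (ih i j k) (sub_nonneg.2 (hle l j))
        _ = _ := by
            rw [← Finset.sum_mul, Finset.sum_sub_distrib,
              sum_row_of_mem_doublyStochastic (hds p) l]
            simp
  -- The maximum keeps `q` positive, also when `1 - K * ε = 0`, so that `1 / r ^ p` can pay for the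
  -- incomplete last block of length below `p`.
  set q := max (1 - K * ε) (1 / 2) with hq
  have hq1 : q < 1 := max_lt (by nlinarith) (by norm_num)
  have hq2 : 0 < q := lt_of_lt_of_le (by norm_num) (le_max_right _ _)
  set r := q ^ ((p : ℝ)⁻¹) with hr
  have hr0 : 0 < r := Real.rpow_pos_of_pos hq2 _
  have hr1 : r < 1 := Real.rpow_lt_one hq2.le hq1 (by positivity)
  have hrp : r ^ p = q := Real.rpow_inv_natCast_pow hq2.le hp0.ne'
  refine ⟨1 / r ^ p, r, by positivity, hr0.le, hr1, fun i l k => ?_⟩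
  have h := key (i / p) (i % p) l k
  rw [Nat.div_add_mod] at h
  refine h.trans ?_
  calc (1 - K * ε) ^ (i / p) ≤ q ^ (i / p) := by gcongr; exact le_max_left _ _
    _ = r ^ (p * (i / p)) := by rw [pow_mul, hrp]
    _ ≤ 1 / r ^ p * r ^ i := by
      rw [one_div, ← div_eq_inv_mul, le_div_iff₀ (by positivity), ← pow_add]
      refine pow_le_pow_of_le_one hr0.le hr1.le ?_
      have h1 := Nat.div_add_mod i p
      have h2 := Nat.mod_lt i hp0
      omega

/-! ### Descent -/

/-- The first time at which the mean squared gradient is small. -/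
theorem exists_small_of_descent {V e : ℕ → ℝ} {μ a b r s : ℝ} (hμ : 0 < μ) (ha : 0 ≤ a)
    (hr0 : 0 ≤ r) (hr1 : r < 1) (hs : 0 ≤ s) (hV : ∀ i, 0 ≤ V i)
    (h : ∀ i, V (i + 1) ≤ V i - μ / 2 * e i + μ / 2 * (a * r ^ i + b * μ ^ 2) + s / 2 * μ ^ 2) :
    ∃ i : ℕ, e i ≤ 2 * μ * s + (b + 1) * μ ^ 2 ∧
      (0 < s → (i : ℝ) ≤ 2 * V 0 / s * (1 / μ ^ 2) + a / (1 - r) / s * (1 / μ)) := by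
  have hr : 0 < 1 - r := by linarith
  have hc : 0 ≤ a / (1 - r) := by positivity
  -- Above the threshold each step lowers `V` by the bracket on the left, apart from the transient,
  -- whose partial geometric sum stands on the right.
  have hsum : ∀ m, (∀ i < m, 2 * μ * s + (b + 1) * μ ^ 2 < e i) →
      V m + m * (s * μ ^ 2 / 2 + μ ^ 3 / 2) ≤ V 0 + μ / 2 * (a / (1 - r)) * (1 - r ^ m) := by
    intro m
    induction m with
    | zero => intro _; simp
    | succ m ih =>
      intro hm
      have h1 := ih fun i hi => hm i (by omega)
      have h2 := h m
      have h3 := mul_le_mul_of_nonneg_left (hm m (by omega)).le (half_pos hμ).le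
      have h4 : μ / 2 * (a / (1 - r)) * (1 - r ^ (m + 1))
          = μ / 2 * (a / (1 - r)) * (1 - r ^ m) + μ / 2 * (a * r ^ m) := by
        field_simp; ring
      rw [h4]; push_cast
      linarith
  have hbd : ∀ m : ℕ, (∀ i < m, 2 * μ * s + (b + 1) * μ ^ 2 < e i) →
      m * (s * μ ^ 2 / 2 + μ ^ 3 / 2) ≤ V 0 + μ / 2 * (a / (1 - r)) := by
    intro m hm
    have h1 := hsum m hm
    have h2 : 0 ≤ μ / 2 * (a / (1 - r)) * r ^ m := by positivity
    linarith [hV m]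
  -- The `1` in `b + 1` leaves a decrease `μ ^ 3 / 2` per step, so a small gradient occurs even when
  -- `s = 0`.
  have hex : ∃ i, e i ≤ 2 * μ * s + (b + 1) * μ ^ 2 := by
    by_contra! hcon
    have hpos : 0 < s * μ ^ 2 / 2 + μ ^ 3 / 2 := by positivity
    obtain ⟨m, hm⟩ := exists_nat_gt ((V 0 + μ / 2 * (a / (1 - r))) / (s * μ ^ 2 / 2 + μ ^ 3 / 2))
    rw [div_lt_iff₀ hpos] at hm
    linarith [hbd m fun i _ => hcon i]
  classical
  refine ⟨Nat.find hex, Nat.find_spec hex, fun hs' => ?_⟩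
  have h1 := hbd (Nat.find hex) fun i hi => not_le.1 (Nat.find_min hex hi)
  have h2 : (Nat.find hex : ℝ) * (s * μ ^ 2 / 2) ≤ V 0 + μ / 2 * (a / (1 - r)) := by
    have : 0 ≤ (Nat.find hex : ℝ) * (μ ^ 3 / 2) := by positivity
    linarith
  rw [← le_div_iff₀ (by positivity)] at h2
  refine h2.trans (le_of_eq ?_)
  field_simp

/-- In the quadratic upper bound the terms linear in the noise vanish in the mean. The rest is the
identity `-2⟨G, g⟩ = ‖g - G‖ ^ 2 - ‖G‖ ^ 2 - ‖g‖ ^ 2`; its last term absorbs the quadratic term in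
`g` because `μ * b ≤ 1`. -/
theorem descent_step {M : ℕ} {S : Type*} [MeasurableSpace S] {ν : Measure S}
    [IsProbabilityMeasure ν] {f : Model M → ℝ} {b μ J v : ℝ} (hd : Differentiable ℝ f)
    (hb : 0 ≤ b) (hL : ∀ u v, ‖gradient f u - gradient f v‖ ≤ b * ‖u - v‖) (hμ : 0 < μ)
    (hμb : μ * b ≤ 1) (hJ : ∀ w, J ≤ f w) {n : S → Model M} (hn : Integrable n ν)
    (hn0 : ∫ s, n s ∂ν = 0) (hv : MeanLE ν (fun s => ‖n s‖ ^ 2) v) (x g : Model M) :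
    MeanLE ν (fun s => f (x - μ • (g + n s)) - J)
      (f x - J - μ / 2 * ‖gradient f x‖ ^ 2 + μ / 2 * ‖g - gradient f x‖ ^ 2
        + b / 2 * μ ^ 2 * v) := by
  set G := gradient f x
  have h1 : MeanLE ν (fun s => inner ℝ ((b * μ ^ 2) • g - μ • G) (n s)) 0 :=
    ⟨hn.const_inner _, by rw [integral_inner hn, hn0, inner_zero_right]⟩
  have h2 := ((MeanLE.const (ν := ν) (f x - J - μ * inner ℝ G g + b / 2 * μ ^ 2 * ‖g‖ ^ 2)).add
    h1).add (hv.const_mul (r := b / 2 * μ ^ 2) (by positivity))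
  refine MeanLE.of_le (MeanLE.mono h2 ?_ (fun s => sub_nonneg.2 (hJ _)) fun s => ?_) ?_
  · exact ((hd.continuous.comp_aestronglyMeasurable (aestronglyMeasurable_const.sub
      ((aestronglyMeasurable_const.add hn.1).const_smul μ))).sub aestronglyMeasurable_const)
  · have h3 := le_of_lipschitz_gradient hd hL x (-(μ • (g + n s)))
    rw [← sub_eq_add_neg] at h3
    have h4 : inner ℝ G (-(μ • (g + n s))) = -(μ * inner ℝ G g) - μ * inner ℝ G (n s) := by
      rw [inner_neg_right, inner_smul_right, inner_add_right]; ring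
    have h5 : ‖-(μ • (g + n s))‖ ^ 2 = μ ^ 2 * (‖g‖ ^ 2 + 2 * inner ℝ g (n s) + ‖n s‖ ^ 2) := by
      rw [norm_neg, norm_smul, mul_pow, Real.norm_eq_abs, sq_abs, norm_add_sq_real]
    have h6 : inner ℝ ((b * μ ^ 2) • g - μ • G) (n s)
        = b * μ ^ 2 * inner ℝ g (n s) - μ * inner ℝ G (n s) := by
      rw [inner_sub_left, inner_smul_left, inner_smul_left]; simp
    rw [h4, h5] at h3
    rw [h6]
    linarith
  · have h3 : ‖g - G‖ ^ 2 = ‖g‖ ^ 2 - 2 * inner ℝ G g + ‖G‖ ^ 2 := by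
      rw [norm_sub_sq_real, real_inner_comm]
    rw [h3]
    have h4 : 0 ≤ (1 - μ * b) * (μ / 2 * ‖g‖ ^ 2) :=
      mul_nonneg (by linarith) (by positivity)
    nlinarith

namespace Network

variable {K M : ℕ} {T X : Fin K → Type*}
  [∀ k, MeasurableSpace (T k)] [∀ k, MeasurableSpace (X k)] {N : Network K M T X}
  {c : Constants} {k : Fin K}

instance (k : Fin K) : IsProbabilityMeasure (N.taskDrawLaw k) := by
  unfold taskDrawLaw; infer_instance

instance (k : Fin K) : IsProbabilityMeasure (N.agentDrawLaw k) := by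
  unfold agentDrawLaw; infer_instance

theorem le_Csq (k : Fin K) :
    3 / (N.nTasks k : ℝ) * (N.C1sq c + N.C2sq c + N.C3 c ^ 2) ≤ N.Csq c :=
  le_ciSup (f := fun k => 3 / (N.nTasks k : ℝ) * (N.C1sq c + N.C2sq c + N.C3 c ^ 2))
    (Set.finite_range _).bddAbove k

theorem Lhat_nonneg : 0 ≤ N.Lhat c := by
  have := N.α_pos; have := c.L_nonneg; have := c.ρ_nonneg; have := c.B_nonneg
  unfold Lhat; positivity

variable (hN : N.Assumptions c)
include hN

/-! ### The stochastic gradient of an agent -/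

theorem Assumptions.measurable_mamlGrad :
    Measurable fun p : (Fin (N.nTasks k) → N.TaskDraw k) × Model M => N.mamlGrad k p.2 p.1 := by
  refine (Finset.measurable_sum _ fun j _ => ?_).const_smul (1 / (N.nTasks k : ℝ))
  exact hN.measurable_taskMamlGrad.comp
    (f := fun p : (Fin (N.nTasks k) → N.TaskDraw k) × Model M => (p.1 j, p.2)) (by fun_prop)

theorem Assumptions.integrable_mamlGrad (w : Model M) :
    Integrable (N.mamlGrad k w) (N.agentDrawLaw k) :=
  integrable_avg (hN.integrable_taskMamlGrad w)

theorem Assumptions.integral_mamlGrad (w : Model M) :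
    ∫ s, N.mamlGrad k w s ∂N.agentDrawLaw k = gradient (N.adjustedRisk k) w :=
  (integral_avg (hN.integrable_taskMamlGrad w) (N.nTasks_pos k)).trans (hN.integral_taskMamlGrad w)

theorem Assumptions.mamlGrad_var (w : Model M) :
    MeanLE (N.agentDrawLaw k) (fun s => ‖N.mamlGrad k w s - gradient (N.adjustedRisk k) w‖ ^ 2)
      (N.Csq c) :=
  (MeanLE.avg_sq (hN.integrable_taskMamlGrad w) (hN.integral_taskMamlGrad w)
    (hN.taskMamlGrad_var w) (N.nTasks_pos k)).of_le
    ((le_of_eq (by ring)).trans (le_Csq k))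

theorem Assumptions.Csq_nonneg [NeZero K] : 0 ≤ N.Csq c :=
  (hN.mamlGrad_var (k := 0) 0).nonneg fun _ => sq_nonneg _

/-- The bound is uniform in the model, which lets the disagreement be estimated without prior
control of the iterates. -/
theorem Assumptions.mamlGrad_sq (w : Model M) :
    MeanLE (N.agentDrawLaw k) (fun s => ‖N.mamlGrad k w s‖ ^ 2)
      (2 * N.Csq c + 2 * ((1 + N.α * c.L) * c.B) ^ 2) := by
  have h := ((hN.mamlGrad_var (k := k) w).const_mul zero_le_two).add
    (MeanLE.const (2 * ((1 + N.α * c.L) * c.B) ^ 2))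
  refine h.mono ((hN.integrable_mamlGrad w).1.norm.pow 2) (fun _ => sq_nonneg _) fun s => ?_
  have h1 := norm_le_norm_add_norm_sub' (N.mamlGrad k w s) (gradient (N.adjustedRisk k) w)
  have h2 := hN.norm_gradient_adjustedRisk_le (k := k) w
  have h3 := norm_nonneg (gradient (N.adjustedRisk k) w)
  calc ‖N.mamlGrad k w s‖ ^ 2
      ≤ ((1 + N.α * c.L) * c.B + ‖N.mamlGrad k w s - gradient (N.adjustedRisk k) w‖) ^ 2 := by
        gcongr; linarith
    _ ≤ _ := by
        nlinarith [sq_nonneg ((1 + N.α * c.L) * c.B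
          - ‖N.mamlGrad k w s - gradient (N.adjustedRisk k) w‖)]

/-! ### The aggregate objectives -/

theorem Assumptions.hasGradientAt_adjustedObjective (w : Model M) :
    HasGradientAt N.adjustedObjective ((1 / (K : ℝ)) • ∑ k, gradient (N.adjustedRisk k) w) w := by
  rw [hasGradientAt_iff_hasFDerivAt]
  have h := (HasFDerivAt.fun_sum (u := Finset.univ) fun k _ =>
    (hN.hasGradientAt_adjustedRisk (k := k) w).differentiableAt.hasGradientAt.hasFDerivAt).const_mul
      (1 / (K : ℝ))
  refine h.congr_fderiv ?_
  simp only [toDual_eq_innerBilin, map_smul, map_sum]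

theorem Assumptions.hasGradientAt_mamlObjective (w : Model M) :
    HasGradientAt N.mamlObjective ((1 / (K : ℝ)) • ∑ k, gradient (N.mamlRisk k) w) w := by
  rw [hasGradientAt_iff_hasFDerivAt]
  have h := (HasFDerivAt.fun_sum (u := Finset.univ) fun k _ =>
    (hN.hasGradientAt_mamlRisk (k := k) w).differentiableAt.hasGradientAt.hasFDerivAt).const_mul
      (1 / (K : ℝ))
  refine h.congr_fderiv ?_
  simp only [toDual_eq_innerBilin, map_smul, map_sum]

theorem Assumptions.differentiable_adjustedObjective : Differentiable ℝ N.adjustedObjective :=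
  fun w => (hN.hasGradientAt_adjustedObjective w).differentiableAt

theorem Assumptions.differentiable_mamlObjective : Differentiable ℝ N.mamlObjective :=
  fun w => (hN.hasGradientAt_mamlObjective w).differentiableAt

theorem Assumptions.gradient_adjustedObjective_sub_le [NeZero K] (w u : Model M) :
    ‖gradient N.adjustedObjective w - gradient N.adjustedObjective u‖
      ≤ N.Lhat c * ‖w - u‖ := by
  rw [(hN.hasGradientAt_adjustedObjective w).gradient,
    (hN.hasGradientAt_adjustedObjective u).gradient]
  refine (norm_avg_sub_avg_le _ _).trans ?_
  have hK : (K : ℝ) ≠ 0 := by exact_mod_cast NeZero.ne K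
  calc _ ≤ 1 / (K : ℝ) * ∑ _k : Fin K, N.Lhat c * ‖w - u‖ := by
        gcongr with k; exact hN.gradient_adjustedRisk_sub_le w u
    _ = _ := by simp; field_simp

theorem Assumptions.norm_gradient_adjustedObjective_le [NeZero K] (w : Model M) :
    ‖gradient N.adjustedObjective w‖ ≤ (1 + N.α * c.L) * c.B := by
  rw [(hN.hasGradientAt_adjustedObjective w).gradient]
  have h := norm_avg_sub_avg_le (fun k => gradient (N.adjustedRisk k) w) fun _ => 0
  simp only [Finset.sum_const_zero, smul_zero, sub_zero] at h
  refine h.trans ?_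
  have hK : (K : ℝ) ≠ 0 := by exact_mod_cast NeZero.ne K
  calc _ ≤ 1 / (K : ℝ) * ∑ _k : Fin K, (1 + N.α * c.L) * c.B := by
        gcongr with k; exact hN.norm_gradient_adjustedRisk_le w
    _ = _ := by simp; field_simp

theorem Assumptions.norm_gradient_mamlObjective_sub_le [NeZero K] (w : Model M) :
    ‖gradient N.adjustedObjective w - gradient N.mamlObjective w‖ ≤ N.gradGap c := by
  rw [(hN.hasGradientAt_adjustedObjective w).gradient,
    (hN.hasGradientAt_mamlObjective w).gradient]
  refine (norm_avg_sub_avg_le _ _).trans ?_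
  have hK : (K : ℝ) ≠ 0 := by exact_mod_cast NeZero.ne K
  calc _ ≤ 1 / (K : ℝ) * ∑ _k : Fin K, N.gradGap c := by
        gcongr with k; exact hN.norm_gradient_mamlRisk_sub_le w
    _ = _ := by simp; field_simp

end Network

end DifMAML

/-! ### The random iteration: disagreement, independence, mean decrease. -/

namespace DifMAML

theorem sum_range_pow_sub_le {r : ℝ} (hr0 : 0 ≤ r) (hr1 : r < 1) (i : ℕ) :
    ∑ j ∈ Finset.range i, r ^ (i - j) ≤ 1 / (1 - r) := by
  have h : ∑ j ∈ Finset.range i, r ^ (i - j) ≤ ∑ j ∈ Finset.range i, r ^ (i - 1 - j) :=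
    Finset.sum_le_sum fun j _ => pow_le_pow_of_le_one hr0 hr1.le (by omega)
  refine h.trans ?_
  rw [Finset.sum_range_reflect (fun j => r ^ j) i, one_div, ← tsum_geometric_of_lt_one hr0 hr1]
  exact (summable_geometric_of_lt_one hr0 hr1).sum_le_tsum _ fun j _ => by positivity

theorem MeanLE.map {A B : Type*} [MeasurableSpace A] [MeasurableSpace B] {ν : Measure A}
    {φ : A → B} {f : B → ℝ} {r : ℝ} (h : MeanLE ν (fun x => f (φ x)) r) (hφ : Measurable φ)
    (hf : Measurable f) : MeanLE (ν.map φ) f r :=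
  ⟨(integrable_map_measure hf.aestronglyMeasurable hφ.aemeasurable).2 h.1, by
    rw [integral_map hφ.aemeasurable hf.aestronglyMeasurable]; exact h.2⟩

namespace Network

variable {K M : ℕ} {T X : Fin K → Type*}
  [∀ k, MeasurableSpace (T k)] [∀ k, MeasurableSpace (X k)] {N : Network K M T X}
  {c : Constants} {k : Fin K} {Ω : Type*}

/-- The centroid of a family of models. -/
noncomputable abbrev mean (W : Fin K → Model M) : Model M := (1 / (K : ℝ)) • ∑ k, W k

/-- The stochastic gradients that agent `k` uses in iteration `i + 1`. -/
noncomputable abbrev noisyGrad (N : Network K M T X) (μ : ℝ) (ξ : ℕ → Ω → N.Draw) (i : ℕ) (ω : Ω)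
    (k : Fin K) : Model M :=
  N.mamlGrad k (N.launch μ ξ i ω k) (ξ (i + 1) ω k)

/-- The unrolled recursion. Agents combine after adapting, so even the latest gradient, `j = i - 1`,
carries one factor of the matrix. -/
theorem launch_eq (μ : ℝ) (ξ : ℕ → Ω → N.Draw) (i : ℕ) (ω : Ω) (k : Fin K) :
    N.launch μ ξ i ω k = ∑ l, (N.comb ^ i) l k • N.init l
      - μ • ∑ j ∈ Finset.range i, ∑ l, (N.comb ^ (i - j)) l k • N.noisyGrad μ ξ j ω l := by
  induction i generalizing k with
  | zero => simp [launch, Matrix.one_apply]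
  | succ i ih =>
    have hpow (n : ℕ) (F : Fin K → Model M) :
        ∑ l, (N.comb ^ (n + 1)) l k • F l = ∑ m, N.comb m k • ∑ l, (N.comb ^ n) l m • F l := by
      simp only [pow_succ, Matrix.mul_apply, Finset.sum_smul, Finset.smul_sum, smul_smul]
      rw [Finset.sum_comm]
      simp only [mul_comm]
    have e : N.launch μ ξ (i + 1) ω k
        = ∑ l, N.comb l k • (N.launch μ ξ i ω l - μ • N.noisyGrad μ ξ i ω l) := rfl
    rw [e, Finset.sum_range_succ, hpow]
    have h1 : ∀ j ∈ Finset.range i, ∑ l, (N.comb ^ (i + 1 - j)) l k • N.noisyGrad μ ξ j ω l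
        = ∑ m, N.comb m k • ∑ l, (N.comb ^ (i - j)) l m • N.noisyGrad μ ξ j ω l := by
      intro j hj
      rw [Finset.mem_range] at hj
      rw [show i + 1 - j = (i - j) + 1 by omega, hpow]
    rw [Finset.sum_congr rfl h1]
    simp only [smul_sub, Finset.sum_sub_distrib]
    rw [show i + 1 - i = 1 by omega, pow_one]
    conv_lhs => enter [1, 2, l]; rw [ih l]
    simp only [smul_sub, Finset.sum_sub_distrib, smul_add]
    rw [Finset.sum_comm]
    simp only [Finset.smul_sum, smul_comm μ]
    abel

theorem measurable_mean : Measurable fun W : Fin K → Model M => mean W :=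
  (Finset.measurable_sum _ fun l _ => measurable_pi_apply l).const_smul (1 / (K : ℝ))

theorem measurable_gradient (f : Model M → ℝ) : Measurable (gradient f) :=
  (LinearIsometryEquiv.continuous _).measurable.comp (measurable_fderiv ℝ f)

variable (hN : N.Assumptions c)
include hN

theorem Assumptions.mean_comb (F : Fin K → Model M) :
    mean (fun k => ∑ l, N.comb l k • F l) = mean F := by
  rw [mean, Finset.sum_comm]
  simp only [← Finset.sum_smul, sum_row_of_mem_doublyStochastic hN.comb_doublyStochastic, one_smul]

theorem Assumptions.centroid_succ (μ : ℝ) (ξ : ℕ → Ω → N.Draw) (i : ℕ) (ω : Ω) :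
    N.centroid μ ξ (i + 1) ω = N.centroid μ ξ i ω - μ • mean (N.noisyGrad μ ξ i ω) := by
  have h := hN.mean_comb fun l => N.launch μ ξ i ω l - μ • N.noisyGrad μ ξ i ω l
  refine h.trans ?_
  rw [mean, Finset.sum_sub_distrib, smul_sub, ← Finset.smul_sum, smul_comm]
  rfl

theorem Assumptions.centroid_eq (μ : ℝ) (ξ : ℕ → Ω → N.Draw) (i : ℕ) (ω : Ω) :
    N.centroid μ ξ i ω = mean N.init
      - μ • ∑ j ∈ Finset.range i, mean (N.noisyGrad μ ξ j ω) := by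
  induction i with
  | zero => simp [centroid, launch, mean]
  | succ i ih => rw [hN.centroid_succ, ih, Finset.sum_range_succ, smul_add]; abel

/-- The disagreement of the launch models. -/
theorem Assumptions.launch_sub_centroid {C r : ℝ} (hC : 0 ≤ C) (hr0 : 0 ≤ r) (hr1 : r < 1)
    (hA : ∀ i l k, |(N.comb ^ i) l k - 1 / K| ≤ C * r ^ i) {μ : ℝ} (hμ : 0 < μ)
    (ξ : ℕ → Ω → N.Draw) (i : ℕ) (ω : Ω) (k : Fin K) :
    ‖N.launch μ ξ i ω k - N.centroid μ ξ i ω‖ ^ 2 ≤ 2 * (C * ∑ l, ‖N.init l‖) ^ 2 * (r ^ 2) ^ i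
      + 2 * μ ^ 2 * (K * C / (1 - r) * ∑ j ∈ Finset.range i, ∑ l,
        C * r ^ (i - j) * ‖N.noisyGrad μ ξ j ω l‖ ^ 2) := by
  have hr : 0 < 1 - r := sub_pos.2 hr1
  set G := N.noisyGrad μ ξ with hG
  -- The centroid has the same expansion with every matrix power replaced by the constant `1 / K`.
  have e : N.launch μ ξ i ω k - N.centroid μ ξ i ω
      = ∑ l, ((N.comb ^ i) l k - 1 / K) • N.init l
        - μ • ∑ j ∈ Finset.range i, ∑ l, ((N.comb ^ (i - j)) l k - 1 / K) • G j ω l := by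
    rw [launch_eq, hN.centroid_eq]
    simp only [sub_smul, Finset.sum_sub_distrib, smul_sub, mean, Finset.smul_sum]
    abel
  have h1 : ‖∑ l, ((N.comb ^ i) l k - 1 / K) • N.init l‖ ≤ C * r ^ i * ∑ l, ‖N.init l‖ := by
    rw [Finset.mul_sum]
    refine norm_sum_le_of_le _ fun l _ => ?_
    rw [norm_smul, Real.norm_eq_abs]
    gcongr
    exact hA i l k
  have h2 : ‖∑ j ∈ Finset.range i, ∑ l, ((N.comb ^ (i - j)) l k - 1 / K) • G j ω l‖
      ≤ ∑ j ∈ Finset.range i, ∑ l, C * r ^ (i - j) * ‖G j ω l‖ := by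
    refine norm_sum_le_of_le _ fun j _ => norm_sum_le_of_le _ fun l _ => ?_
    rw [norm_smul, Real.norm_eq_abs]
    gcongr
    exact hA (i - j) l k
  -- Cauchy–Schwarz with the geometric weights themselves, of total mass at most `K * C / (1 - r)`;
  -- the bound does not grow with `i`.
  have h3 : (∑ j ∈ Finset.range i, ∑ l, C * r ^ (i - j) * ‖G j ω l‖) ^ 2
      ≤ K * C / (1 - r) * ∑ j ∈ Finset.range i, ∑ l, C * r ^ (i - j) * ‖G j ω l‖ ^ 2 := by
    rw [← Finset.sum_product', ← Finset.sum_product']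
    have hcs := Finset.sum_sq_le_sum_mul_sum_of_sq_le_mul (Finset.range i ×ˢ Finset.univ)
      (r := fun p : ℕ × Fin K => C * r ^ (i - p.1) * ‖G p.1 ω p.2‖)
      (f := fun p => C * r ^ (i - p.1)) (g := fun p => C * r ^ (i - p.1) * ‖G p.1 ω p.2‖ ^ 2)
      (fun p _ => by positivity) (fun p _ => by positivity) (fun p _ => le_of_eq (by ring))
    refine hcs.trans (mul_le_mul_of_nonneg_right ?_ (Finset.sum_nonneg fun p _ => by positivity))
    rw [Finset.sum_product]
    simp only [Finset.sum_const, Finset.card_univ, Fintype.card_fin, nsmul_eq_mul,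
      ← Finset.mul_sum]
    calc (K : ℝ) * (C * ∑ j ∈ Finset.range i, r ^ (i - j)) ≤ K * (C * (1 / (1 - r))) := by
          gcongr; exact sum_range_pow_sub_le hr0 hr1 i
      _ = _ := by ring
  rw [e]
  set S := ∑ j ∈ Finset.range i, ∑ l, C * r ^ (i - j) * ‖G j ω l‖
  have h5 := (norm_sub_le (∑ l, ((N.comb ^ i) l k - 1 / K) • N.init l)
    (μ • ∑ j ∈ Finset.range i, ∑ l, ((N.comb ^ (i - j)) l k - 1 / K) • G j ω l)).trans
    (add_le_add h1 ((norm_smul_of_nonneg hμ.le _).trans_le (mul_le_mul_of_nonneg_left h2 hμ.le)))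
  calc _ ≤ (C * r ^ i * ∑ l, ‖N.init l‖ + μ * S) ^ 2 := by gcongr
    _ ≤ 2 * (C * ∑ l, ‖N.init l‖) ^ 2 * (r ^ 2) ^ i + 2 * μ ^ 2 * S ^ 2 := by
      have : (r ^ 2) ^ i = (r ^ i) ^ 2 := by ring
      rw [this]
      nlinarith [sq_nonneg (C * r ^ i * ∑ l, ‖N.init l‖ - μ * S)]
    _ ≤ _ := by gcongr

/-! ### Independence -/

/-- The σ-algebra on `Ω` is arbitrary, so that the one generated by the draws up to time `i` can be
used for independence. -/
theorem Assumptions.measurable_launch {m : MeasurableSpace Ω} (μ : ℝ) {ξ : ℕ → Ω → N.Draw} (i : ℕ)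
    (hξ : ∀ j ≤ i, Measurable (ξ j)) : Measurable (N.launch μ ξ i) := by
  induction i with
  | zero => exact measurable_const
  | succ i ih =>
    have h1 := ih fun j hj => hξ j (by omega)
    have h2 := hξ (i + 1) le_rfl
    refine measurable_pi_lambda _ fun k => Finset.measurable_sum _ fun l _ => ?_
    have h3 : Measurable fun ω => N.launch μ ξ i ω l := (measurable_pi_apply l).comp h1
    have h4 : Measurable fun ω => ξ (i + 1) ω l := (measurable_pi_apply l).comp h2
    exact (h3.sub ((hN.measurable_mamlGrad.comp (h4.prodMk h3)).const_smul μ)).const_smul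
      (N.comb l k)

variable [MeasurableSpace Ω] {P : Measure Ω} [IsProbabilityMeasure P] {ξ : ℕ → Ω → N.Draw}
  (hξ : N.IsSampling P ξ)
include hξ

omit [IsProbabilityMeasure P] in
theorem Assumptions.indepFun_launch (μ : ℝ) (i : ℕ) :
    IndepFun (N.launch μ ξ i) (ξ (i + 1)) P := by
  have h := indep_iSup_of_disjoint (μ := P) (m := fun j => MeasurableSpace.comap (ξ j) inferInstance)
    (fun j => (hξ.measurable j).comap_le) hξ.indep (S := Set.Iic i) (T := {i + 1})
    (by simp)
  rw [IndepFun_iff_Indep]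
  refine indep_of_indep_of_le_right (indep_of_indep_of_le_left h ?_) ?_
  · refine Measurable.comap_le ?_
    refine hN.measurable_launch μ i fun j hj => ?_
    exact Measurable.mono (comap_measurable (ξ j))
      (le_iSup₂_of_le (f := fun j (_ : j ∈ Set.Iic i) =>
        MeasurableSpace.comap (ξ j) inferInstance) j hj le_rfl) le_rfl
  · simp

theorem Assumptions.map_launch_draw (μ : ℝ) (i : ℕ) :
    MeasurePreserving (fun ω => (N.launch μ ξ i ω, ξ (i + 1) ω)) P
      ((P.map (N.launch μ ξ i)).prod (P.map (ξ (i + 1)))) := by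
  have h1 : Measurable (N.launch μ ξ i) := hN.measurable_launch μ i fun j _ => hξ.measurable j
  have h2 := hξ.measurable (i + 1)
  exact ⟨h1.prodMk h2, (indepFun_iff_map_prod_eq_prod_map_map h1.aemeasurable
    h2.aemeasurable).1 (hN.indepFun_launch hξ μ i)⟩

omit hN [IsProbabilityMeasure P] in
theorem IsSampling.measurePreserving (i : ℕ) (k : Fin K) :
    MeasurePreserving (fun s : N.Draw => s k) (P.map (ξ i)) (N.agentDrawLaw k) := by
  refine ⟨measurable_pi_apply k, ?_⟩
  rw [Measure.map_map (measurable_pi_apply k) (hξ.measurable i)]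
  exact hξ.law i k

/-- The draw is independent of the launch models, so the bound at a fixed model is averaged over
them. -/
theorem Assumptions.noisyGrad_sq (μ : ℝ) (i : ℕ) (k : Fin K) :
    MeanLE P (fun ω => ‖N.noisyGrad μ ξ i ω k‖ ^ 2)
      (2 * N.Csq c + 2 * ((1 + N.α * c.L) * c.B) ^ 2) := by
  have h1 : Measurable (N.launch μ ξ i) := hN.measurable_launch μ i fun j _ => hξ.measurable j
  have := Measure.isProbabilityMeasure_map (μ := P) h1.aemeasurable
  have := Measure.isProbabilityMeasure_map (μ := P) (hξ.measurable (i + 1)).aemeasurable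
  have hm : Measurable fun p : (Fin K → Model M) × N.Draw => ‖N.mamlGrad k (p.1 k) (p.2 k)‖ ^ 2 :=
    (hN.measurable_mamlGrad.comp (f := fun p : (Fin K → Model M) × N.Draw => (p.2 k, p.1 k))
      (by fun_prop)).norm.pow_const 2
  exact (MeanLE.prod hm (fun _ => sq_nonneg _) (fun W => (hN.mamlGrad_sq (W k)).comp
    (hξ.measurePreserving (i + 1) k)) (MeanLE.const _)).comp (hN.map_launch_draw hξ μ i)

theorem Assumptions.disagreement {C r : ℝ} (hC : 0 ≤ C) (hr0 : 0 ≤ r) (hr1 : r < 1)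
    (hA : ∀ i l k, |(N.comb ^ i) l k - 1 / K| ≤ C * r ^ i) {μ : ℝ} (hμ : 0 < μ)
    (i : ℕ) (k : Fin K) :
    MeanLE P (fun ω => ‖N.launch μ ξ i ω k - N.centroid μ ξ i ω‖ ^ 2)
      (2 * (C * ∑ l, ‖N.init l‖) ^ 2 * (r ^ 2) ^ i + 2 * μ ^ 2 * ((K * C / (1 - r)) ^ 2
        * (2 * N.Csq c + 2 * ((1 + N.α * c.L) * c.B) ^ 2))) := by
  have hr : 0 < 1 - r := sub_pos.2 hr1
  set R := 2 * N.Csq c + 2 * ((1 + N.α * c.L) * c.B) ^ 2 with hR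
  have hR0 : 0 ≤ R := (hN.noisyGrad_sq hξ μ i k).nonneg fun _ => sq_nonneg _
  have h1 : MeanLE P (fun ω => ∑ j ∈ Finset.range i, ∑ l,
      C * r ^ (i - j) * ‖N.noisyGrad μ ξ j ω l‖ ^ 2) (K * C / (1 - r) * R) := by
    refine (MeanLE.sum fun j _ => MeanLE.sum fun l _ =>
      (hN.noisyGrad_sq hξ μ j l).const_mul (by positivity)).of_le ?_
    simp only [Finset.sum_const, Finset.card_univ, Fintype.card_fin, nsmul_eq_mul, ← hR,
      ← Finset.mul_sum, ← Finset.sum_mul]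
    calc (K : ℝ) * (C * (∑ j ∈ Finset.range i, r ^ (i - j)) * R)
        ≤ K * (C * (1 / (1 - r)) * R) := by gcongr; exact sum_range_pow_sub_le hr0 hr1 i
      _ = _ := by ring
  have h2 := (MeanLE.const (ν := P) (2 * (C * ∑ l, ‖N.init l‖) ^ 2 * (r ^ 2) ^ i)).add
    ((h1.const_mul (r := K * C / (1 - r)) (by positivity)).const_mul (r := 2 * μ ^ 2)
      (by positivity))
  have hm : Measurable (N.launch μ ξ i) := hN.measurable_launch μ i fun j _ => hξ.measurable j
  refine MeanLE.of_le (MeanLE.mono h2 ?_ (fun _ => sq_nonneg _)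
    fun ω => hN.launch_sub_centroid hC hr0 hr1 hA hμ ξ i ω k) (le_of_eq (by ring))
  exact ((((measurable_pi_apply k).comp hm).sub ((measurable_mean).comp hm)).norm.pow_const
    2).aestronglyMeasurable

/-- The mean decrease of the adjusted objective in one iteration. -/
theorem Assumptions.descent [NeZero K] {Jo : ℝ} (hJo : ∀ w, Jo ≤ N.adjustedObjective w) {μ δ : ℝ}
    (hμ : 0 < μ) (hμL : μ * N.Lhat c ≤ 1) (i : ℕ)
    (hδ : ∀ k, MeanLE P (fun ω => ‖N.launch μ ξ i ω k - N.centroid μ ξ i ω‖ ^ 2) δ)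
    (hi : Integrable (fun ω => N.adjustedObjective (N.centroid μ ξ i ω) - Jo) P) :
    MeanLE P (fun ω => N.adjustedObjective (N.centroid μ ξ (i + 1) ω) - Jo)
      (∫ ω, (N.adjustedObjective (N.centroid μ ξ i ω) - Jo) ∂P
        - μ / 2 * ∫ ω, ‖gradient N.adjustedObjective (N.centroid μ ξ i ω)‖ ^ 2 ∂P
        + μ / 2 * (N.Lhat c ^ 2 * δ) + N.Lhat c / 2 * μ ^ 2 * N.Csq c) := by
  set f := N.adjustedObjective with hf
  have hK : (0 : ℝ) < K := by exact_mod_cast Nat.pos_of_ne_zero (NeZero.ne K)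
  have hm : Measurable (N.launch μ ξ i) := hN.measurable_launch μ i fun j _ => hξ.measurable j
  have := Measure.isProbabilityMeasure_map (μ := P) hm.aemeasurable
  have := Measure.isProbabilityMeasure_map (μ := P) (hξ.measurable (i + 1)).aemeasurable
  have hfc : Measurable f := hN.differentiable_adjustedObjective.continuous.measurable
  have hgm : Measurable (gradient f) := measurable_gradient f
  -- `g` is the conditional mean of the averaged gradient given the launch models, `n` its noise,
  -- and `h` the conditional bound on the next value.
  let g : (Fin K → Model M) → Model M := fun W => mean fun l => gradient (N.adjustedRisk l) (W l)
  let n : (Fin K → Model M) → N.Draw → Model M := fun W s =>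
    mean (fun l => N.mamlGrad l (W l) (s l)) - g W
  let h : (Fin K → Model M) → ℝ := fun W => f (mean W) - Jo
    - μ / 2 * ‖gradient f (mean W)‖ ^ 2
    + μ / 2 * (N.Lhat c ^ 2 * ((1 / (K : ℝ)) * ∑ l, ‖W l - mean W‖ ^ 2))
    + N.Lhat c / 2 * μ ^ 2 * N.Csq c
  have hmean : Measurable fun W : Fin K → Model M => mean W := measurable_mean
  have hh : Measurable h := by
    have h1 : Measurable fun W : Fin K → Model M => ∑ l, ‖W l - mean W‖ ^ 2 :=
      Finset.measurable_sum _ fun l _ =>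
        ((measurable_pi_apply l).sub hmean).norm.pow_const 2
    exact ((((hfc.comp hmean).sub_const Jo).sub
      (((hgm.comp hmean).norm.pow_const 2).const_mul (μ / 2))).add
      (((h1.const_mul _).const_mul _).const_mul _)).add_const _
  -- the conditional decrease, given the launch models
  have hstep : ∀ W, MeanLE (P.map (ξ (i + 1))) (fun s => f (mean W - μ • (g W + n W s)) - Jo)
      (h W) := by
    intro W
    have hint : ∀ l, Integrable (fun s : N.Draw => N.mamlGrad l (W l) (s l))
        (P.map (ξ (i + 1))) := fun l =>
      ((hξ.measurePreserving (i + 1) l).integrable_comp (hN.integrable_mamlGrad (W l)).1).2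
        (hN.integrable_mamlGrad (W l))
    have hint' : ∀ l, ∫ s : N.Draw, N.mamlGrad l (W l) (s l) ∂(P.map (ξ (i + 1)))
        = gradient (N.adjustedRisk l) (W l) := by
      intro l
      rw [← hN.integral_mamlGrad (W l), ← (hξ.measurePreserving (i + 1) l).map_eq,
        integral_map (measurable_pi_apply l).aemeasurable]
      rw [(hξ.measurePreserving (i + 1) l).map_eq]
      exact (hN.integrable_mamlGrad (W l)).1
    have hsum : Integrable (fun s : N.Draw => mean fun l => N.mamlGrad l (W l) (s l))
        (P.map (ξ (i + 1))) := 
      (integrable_finsetSum Finset.univ fun l _ => hint l).smul (1 / (K : ℝ))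
    have hn : Integrable (n W) (P.map (ξ (i + 1))) := hsum.sub (integrable_const _)
    have hn0 : ∫ s, n W s ∂(P.map (ξ (i + 1))) = 0 := by
      rw [integral_sub hsum (integrable_const _), integral_smul,
        integral_finsetSum _ fun l _ => hint l]
      simp only [hint', integral_const, probReal_univ, one_smul]
      exact sub_self _
    -- Only the marginal law of each agent's draw is known, so the variances are averaged by
    -- convexity, with no gain from the number of agents.
    have hv : MeanLE (P.map (ξ (i + 1))) (fun s => ‖n W s‖ ^ 2) (N.Csq c) := by
      have h1 := (MeanLE.sum (s := Finset.univ) fun (l : Fin K) _ =>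
        (hN.mamlGrad_var (W l)).comp (hξ.measurePreserving (i + 1) l)).const_mul
        (r := 1 / (K : ℝ)) (by positivity)
      refine MeanLE.of_le (MeanLE.mono h1 (hn.1.norm.pow 2) (fun _ => sq_nonneg _) fun s => ?_) ?_
      · refine (pow_le_pow_left₀ (norm_nonneg _) (norm_avg_sub_avg_le _ _) 2).trans ?_
        exact sq_avg_le _ (Nat.pos_of_ne_zero (NeZero.ne K))
      · simp; field_simp; exact le_rfl
    refine (descent_step hN.differentiable_adjustedObjective Lhat_nonneg
      hN.gradient_adjustedObjective_sub_le hμ hμL hJo hn hn0 hv (mean W) (g W)).of_le ?_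
    -- The gradients at the launch models differ from those at the centroid by at most `Lhat` times
    -- the disagreement; convexity of the square does the rest.
    have h2 : ‖g W - gradient f (mean W)‖ ^ 2
        ≤ N.Lhat c ^ 2 * ((1 / (K : ℝ)) * ∑ l, ‖W l - mean W‖ ^ 2) := by
      rw [(hN.hasGradientAt_adjustedObjective (mean W)).gradient]
      refine (pow_le_pow_left₀ (norm_nonneg _) (norm_avg_sub_avg_le _ _) 2).trans ?_
      refine (sq_avg_le _ (Nat.pos_of_ne_zero (NeZero.ne K))).trans ?_
      rw [mul_left_comm, Finset.mul_sum _ _ (N.Lhat c ^ 2)]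
      refine mul_le_mul_of_nonneg_left (Finset.sum_le_sum fun l _ => ?_) (by positivity)
      rw [← mul_pow]
      exact pow_le_pow_left₀ (norm_nonneg _) (hN.gradient_adjustedRisk_sub_le _ _) 2
    have h3 := mul_le_mul_of_nonneg_left h2 (half_pos hμ).le
    change _ ≤ f (mean W) - Jo - μ / 2 * ‖gradient f (mean W)‖ ^ 2
      + μ / 2 * (N.Lhat c ^ 2 * ((1 / (K : ℝ)) * ∑ l, ‖W l - mean W‖ ^ 2))
      + N.Lhat c / 2 * μ ^ 2 * N.Csq c
    linarith
  have hnm : Measurable fun p : (Fin K → Model M) × N.Draw =>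
      mean fun l => N.mamlGrad l (p.1 l) (p.2 l) := by
    refine (Finset.measurable_sum _ fun l _ => ?_).const_smul (1 / (K : ℝ))
    exact hN.measurable_mamlGrad.comp (f := fun p : (Fin K → Model M) × N.Draw => (p.2 l, p.1 l))
      (by fun_prop)
  have e : ∀ W s, g W + n W s = mean fun l => N.mamlGrad l (W l) (s l) := fun W s =>
    add_sub_cancel _ _
  simp only [e] at hstep
  have hgrad : Integrable (fun ω => ‖gradient f (N.centroid μ ξ i ω)‖ ^ 2) P := by
    refine (integrable_const (((1 + N.α * c.L) * c.B) ^ 2)).mono'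
      (((hgm.comp (hmean.comp hm)).norm.pow_const 2).aestronglyMeasurable)
      (Filter.Eventually.of_forall fun ω => ?_)
    rw [Real.norm_of_nonneg (sq_nonneg _)]
    exact pow_le_pow_left₀ (norm_nonneg _) (hN.norm_gradient_adjustedObjective_le _) 2
  have hlaw : MeanLE (P.map (N.launch μ ξ i)) h
      (∫ ω, (f (N.centroid μ ξ i ω) - Jo) ∂P
        - μ / 2 * ∫ ω, ‖gradient f (N.centroid μ ξ i ω)‖ ^ 2 ∂P
        + μ / 2 * (N.Lhat c ^ 2 * δ) + N.Lhat c / 2 * μ ^ 2 * N.Csq c) := by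
    refine MeanLE.map ?_ hm hh
    have h1 : MeanLE P (fun ω => f (N.centroid μ ξ i ω) - Jo
        - μ / 2 * ‖gradient f (N.centroid μ ξ i ω)‖ ^ 2)
        (∫ ω, (f (N.centroid μ ξ i ω) - Jo) ∂P
          - μ / 2 * ∫ ω, ‖gradient f (N.centroid μ ξ i ω)‖ ^ 2 ∂P) :=
      ⟨hi.sub (hgrad.const_mul _), by rw [integral_sub hi (hgrad.const_mul _), integral_const_mul]⟩
    have h2 := (((MeanLE.sum (s := Finset.univ) fun (l : Fin K) _ => hδ l).const_mul
      (r := 1 / (K : ℝ)) (by positivity)).const_mul (sq_nonneg (N.Lhat c))).const_mul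
      (half_pos hμ).le
    refine MeanLE.of_le ((h1.add h2).add (MeanLE.const (N.Lhat c / 2 * μ ^ 2 * N.Csq c)))
      (le_of_eq ?_)
    have e : 1 / (K : ℝ) * ∑ _l : Fin K, δ = δ := by simp; field_simp
    rw [e]
  have hfm : Measurable fun p : (Fin K → Model M) × N.Draw =>
      f (mean p.1 - μ • mean fun l => N.mamlGrad l (p.1 l) (p.2 l)) - Jo :=
    (hfc.comp ((hmean.comp measurable_fst).sub (hnm.const_smul μ))).sub_const Jo
  refine ((MeanLE.prod hfm (fun p => sub_nonneg.2 (hJo _)) hstep hlaw).comp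
    (hN.map_launch_draw hξ μ i)).congr fun ω => ?_
  rw [hN.centroid_succ]
  rfl

end Network

end DifMAML

/-! ### Choice of constants and conclusion. -/

theorem corollary1 {K M : ℕ} [NeZero K] {T X : Fin K → Type*}
    [∀ k, MeasurableSpace (T k)] [∀ k, MeasurableSpace (X k)]
    (N : DifMAML.Network K M T X) (c : DifMAML.Constants) (hN : N.Assumptions c)
    (Jo : ℝ) (hJo : ∀ w, Jo ≤ N.adjustedObjective w) :
    Differentiable ℝ N.mamlObjective ∧ Differentiable ℝ N.adjustedObjective ∧
    ∃ μ₀ > 0, ∃ D : ℝ,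
      ∀ (Ω : Type*) [MeasurableSpace Ω] (P : Measure Ω) [IsProbabilityMeasure P]
        (ξ : ℕ → Ω → N.Draw), N.IsSampling P ξ →
      ∀ μ : ℝ, 0 < μ → μ ≤ μ₀ →
      ∃ i : ℕ,
        DifMAML.MeanLE P (fun ω => ‖gradient N.adjustedObjective (N.centroid μ ξ i ω)‖ ^ 2)
          (2 * μ * N.Lhat c * N.Csq c + D * μ ^ 2) ∧
        (0 < N.Lhat c * N.Csq c →
          (i : ℝ) ≤ 2 * (N.adjustedObjective N.initCentroid - Jo) / (N.Lhat c * N.Csq c)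
            * (1 / μ ^ 2) + D * (1 / μ)) ∧
        DifMAML.MeanLE P (fun ω => ‖gradient N.mamlObjective (N.centroid μ ξ i ω)‖ ^ 2)
          (4 * μ * N.Lhat c * N.Csq c + D * μ ^ 2 + 2 * N.gradGap c ^ 2) := by
  obtain ⟨C, r, hC, hr0, hr1, hA⟩ :=
    DifMAML.exists_abs_pow_sub_le hN.comb_doublyStochastic hN.comb_primitive
  have hL := DifMAML.Network.Lhat_nonneg (N := N) (c := c)
  have hCsq := hN.Csq_nonneg
  have hr2 : r ^ 2 < 1 := pow_lt_one₀ hr0 hr1 two_ne_zero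
  set f := N.adjustedObjective with hf
  set s := N.Lhat c * N.Csq c with hs
  set G := (1 + N.α * c.L) * c.B with hG
  set a := N.Lhat c ^ 2 * (2 * (C * ∑ l, ‖N.init l‖) ^ 2) with ha
  set b := N.Lhat c ^ 2 * (2 * ((K * C / (1 - r)) ^ 2 * (2 * N.Csq c + 2 * G ^ 2))) with hb
  have hs0 : 0 ≤ s := mul_nonneg hL hCsq
  have ha0 : 0 ≤ a := by positivity
  have hb0 : 0 ≤ b := by positivity
  have hD0 : 0 ≤ a / (1 - r ^ 2) / s := div_nonneg (div_nonneg ha0 (by linarith)) hs0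
  -- The choice of `μ₀` forces `μ * Lhat ≤ 1`, also when `Lhat = 0`. In `D`, the summand `2 * (b +
  -- 1)` survives the doubling in the bound for the MAML objective, and the other one pays for the
  -- transient in the time bound; it is `0` by convention when `s = 0`.
  refine ⟨hN.differentiable_mamlObjective, hN.differentiable_adjustedObjective,
    1 / (N.Lhat c + 1), by positivity, 2 * (b + 1) + a / (1 - r ^ 2) / s, ?_⟩
  intro Ω _ P _ ξ hξ μ hμ hμ₀
  have hμL : μ * N.Lhat c ≤ 1 := by
    rw [le_div_iff₀ (by positivity)] at hμ₀
    linarith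
  have hdis := hN.disagreement hξ hC hr0 hr1 hA hμ
  have hdesc := fun i => hN.descent hξ hJo hμ hμL i (hdis i)
  -- Integrability of the objective along the iteration is carried forward by the descent estimate
  -- itself, starting from a deterministic model.
  have hint : ∀ i, Integrable (fun ω => f (N.centroid μ ξ i ω) - Jo) P := by
    intro i
    induction i with
    | zero => exact integrable_const (f N.initCentroid - Jo)
    | succ i ih => exact (hdesc i ih).1
  have hm : ∀ i, Measurable (N.centroid μ ξ i) := fun i =>
    DifMAML.Network.measurable_mean.comp (hN.measurable_launch μ i fun j _ => hξ.measurable j)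
  obtain ⟨i, hi, hit⟩ := DifMAML.exists_small_of_descent
    (V := fun i => ∫ ω, (f (N.centroid μ ξ i ω) - Jo) ∂P)
    (e := fun i => ∫ ω, ‖gradient f (N.centroid μ ξ i ω)‖ ^ 2 ∂P)
    (b := b) hμ ha0 (sq_nonneg r) hr2 hs0
    (fun i => integral_nonneg fun ω => sub_nonneg.2 (hJo _)) fun i =>
      (hdesc i (hint i)).2.trans (le_of_eq (by rw [ha, hb, hs]; ring))
  have hV0 : ∫ ω, (f (N.centroid μ ξ 0 ω) - Jo) ∂P = f N.initCentroid - Jo := by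
    change ∫ _, (f N.initCentroid - Jo) ∂P = _
    simp
  have he : DifMAML.MeanLE P (fun ω => ‖gradient f (N.centroid μ ξ i ω)‖ ^ 2)
      (2 * μ * s + (b + 1) * μ ^ 2) := by
    refine ⟨(integrable_const (G ^ 2)).mono'
      ((((DifMAML.Network.measurable_gradient f).comp (hm i)).norm.pow_const
        2).aestronglyMeasurable) (Filter.Eventually.of_forall fun ω => ?_), hi⟩
    rw [Real.norm_of_nonneg (sq_nonneg _)]
    exact pow_le_pow_left₀ (norm_nonneg _) (hN.norm_gradient_adjustedObjective_le _) 2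
  have hμD := mul_nonneg hD0 (sq_nonneg μ)
  have hμb := mul_nonneg hb0 (sq_nonneg μ)
  refine ⟨i, he.of_le (by rw [hs] at *; nlinarith [sq_nonneg μ]), fun hpos => ?_, ?_⟩
  · rw [hV0] at hit
    refine (hit hpos).trans ?_
    gcongr
    linarith
  -- From `(x + y) ^ 2 ≤ 2 * x ^ 2 + 2 * y ^ 2`, with `y` the uniform distance of the two gradients.
  · refine DifMAML.MeanLE.of_le (DifMAML.MeanLE.mono ((he.const_mul zero_le_two).add
      (DifMAML.MeanLE.const (2 * N.gradGap c ^ 2)))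
      ((((DifMAML.Network.measurable_gradient N.mamlObjective).comp (hm i)).norm.pow_const
        2).aestronglyMeasurable) (fun _ => sq_nonneg _) fun ω => ?_) ?_
    · have h1 := hN.norm_gradient_mamlObjective_sub_le (N.centroid μ ξ i ω)
      have h2 := norm_le_norm_add_norm_sub (gradient N.adjustedObjective (N.centroid μ ξ i ω))
        (gradient N.mamlObjective (N.centroid μ ξ i ω))
      calc ‖gradient N.mamlObjective (N.centroid μ ξ i ω)‖ ^ 2
          ≤ (‖gradient f (N.centroid μ ξ i ω)‖ + N.gradGap c) ^ 2 := by gcongr; linarith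
        _ ≤ _ := by
          linarith [two_mul_le_add_sq ‖gradient f (N.centroid μ ξ i ω)‖ (N.gradGap c),
            add_sq ‖gradient f (N.centroid μ ξ i ω)‖ (N.gradGap c)]
    · rw [hs] at *; nlinarith [sq_nonneg μ]
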